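/- **Setting.** Let $d\ge 1$, let $|\cdot|$ be the Euclidean norm, and let $(X_t)_{t\in\mathbb Z}$ be a strictly stationary $\mathbb R^d$-valued sequence, with generic element $X$. Let $\alpha>0$ and assume that $(X_t)$ is regularly varying with index $\alpha$: for every $k\ge1$ there is a probability measure $\sigma_k$ on the unit sphere of $\mathbb R^{dk}$ such that $Z=(X_1,\dots,X_k)$ satisfies, for every $u>0$, $$\frac{P(|Z|>ux,\ Z/|Z|\in\cdot)}{P(|Z|>x)}\xrightarrow{w}u^{-\alpha}\sigma_k(\cdot),\qquad x\to\infty .$$ Let $(\Theta_t)_{t\in\mathbb Z}$ be its spectral tail process: for every $k\ge 0$, $P(|X_0|^{-1}(X_{-k},\dots,X_k)\in\cdot\mid|X_0|>x)\xrightarrow{w}P((\Theta_{-k},\dots,\Theta_k)\in\cdot)$ as $x\to\infty$. Put $S_n=X_1+\dots+X_n$ and, for $\varepsilon,x>0$, $\overline S_n=\sum_{i=1}^nX_i\mathbf 1_{\{|X_i|\le\varepsilon x\}}$. Let $\Lambda_n\subset(0,\infty)$, $n\ge1$, be non-empty Borel sets such that $\inf\Lambda_n\to\infty$ and $n\,P(|X_0|>\inf\Lambda_n)\to0$.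 Assume the uniform anti-clustering condition $$\lim_{k\to\infty}\limsup_{n\to\infty}\sup_{x\in\Lambda_n}P\Big(\max_{k\le i\le n}|X_i|>x\delta\ \Big|\ |X_0|>x\delta\Big)=0,\qquad\delta>0 .$$ If $\alpha\ge1$, assume also the vanishing-small-values condition $$\lim_{\varepsilon\downarrow0}\limsup_{n\to\infty}\sup_{x\in\Lambda_n}\frac{P(x^{-1}|\overline S_n|>\delta)}{n\,P(|X|>x)}=0,\qquad\delta>0,$$ and if $\alpha>1$, assume also $E\big(\sum_{i\ge1}|\Theta_i|\big)^{\alpha-1}<\infty$. **Theorem 4.7.** (1) Almost surely $\sum_{i\ge0}|\Theta_i|<\infty$, and for every $\theta\in\mathbb S^{d-1}$ the random variable $\big(\theta'\sum_{i\ge0}\Theta_i\big)_+^\alpha-\big(\theta'\sum_{i\ge1}\Theta_i\big)_+^\alpha$ is integrable and $$\sup_{x\in\Lambda_n}\left|\frac{P(\theta'S_n>x)}{n\,P(|X|>x)}-E\Big[\Big(\theta'\sum_{i\ge0}\Theta_i\Big)_+^\alpha-\Big(\theta'\sum_{i\ge1}\Theta_i\Big)_+^\alpha\Big]\right|\to0,\qquad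 n\to\infty .$$ (2) If $\alpha\notin\mathbb N$ or $X$ is symmetric ($-X\overset d=X$), then there is a unique Radon measure $\mu_\alpha$ on $\overline{\mathbb R}{}_0^d=[-\infty,\infty]^d\setminus\{0\}$ such that $\mu_\alpha(t\,\cdot)=t^{-\alpha}\mu_\alpha(\cdot)$ for all $t>0$ and, for every sequence $(x_n)$ with $x_n\in\Lambda_n$, $n\ge1$, $$\frac{P(x_n^{-1}S_n\in\cdot)}{n\,P(|X|>x_n)}\xrightarrow{v}\mu_\alpha(\cdot),\qquad n\to\infty,$$ where $\xrightarrow{v}$ denotes vague convergence on $\overline{\mathbb R}{}_0^d$. (3) In the situation of (2), $\mu_\alpha$ is determined by its values on the half-spaces $\{y\in\mathbb R^d:\theta'y>1\}$, $\theta\in\mathbb S^{d-1}$, in the following sense. If $\alpha\notin\mathbb N$ or $d=1$, any Radon measure $\nu$ on $\overline{\mathbb R}{}_0^d$ with $\nu(t\,\cdot)=t^{-\alpha}\nu(\cdot)$, $t>0$, that agrees with $\mu_\alpha$ on all these half-spaces equals $\mu_\alpha$. If $\alpha$ is an odd integer and the sequence $(X_t)$ is symmetric ($(-X_t)_{t\in\mathbb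 Z}\overset d=(X_t)_{t\in\mathbb Z}$), then $\mu_\alpha$ is symmetric ($\mu_\alpha(-\,\cdot)=\mu_\alpha(\cdot)$), and any symmetric Radon measure $\nu$ with $\nu(t\,\cdot)=t^{-\alpha}\nu(\cdot)$, $t>0$, that agrees with $\mu_\alpha$ on all these half-spaces equals $\mu_\alpha$. -/

import Mathlib

open MeasureTheory ProbabilityTheory Filter Topology
open scoped ENNReal BoundedContinuousFunction

noncomputable section

namespace HeavyTail

/-- Euclidean space `ℝ^d`. -/
abbrev E (d : ℕ) : Type := EuclideanSpace ℝ (Fin d)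

/-! ### Stationary, regularly varying sequences and their spectral tail process -/

section Sequences

variable {Ω : Type*} [MeasurableSpace Ω]

/-- Strict stationarity of a sequence indexed by `ℤ`: the law of the whole sequence is invariant
under every time shift. -/
def StrictlyStationary {d : ℕ} (P : Measure Ω) (X : ℤ → Ω → E d) : Prop :=
  ∀ h : ℤ, P.map (fun ω (t : ℤ) => X (t + h) ω) = P.map (fun ω (t : ℤ) => X t ω)

/-- The whole sequence is symmetric: `(-X_t)` and `(X_t)` have the same law. -/
def SymmetricSequence {d : ℕ} (P : Measure Ω) (X : ℤ → Ω → E d) : Prop :=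
  P.map (fun ω (t : ℤ) => -X t ω) = P.map (fun ω (t : ℤ) => X t ω)

/-- A random vector `Z` is regularly varying with index `α`: there is a probability measure `σ`
on the unit sphere such that, for every `u > 0`, the finite measures
`P(‖Z‖ > u x, Z / ‖Z‖ ∈ ·) / P(‖Z‖ > x)` converge weakly to `u ^ (-α) σ` as `x → ∞`. -/
def RegVarVector {F : Type*} [NormedAddCommGroup F] [NormedSpace ℝ F] [MeasurableSpace F]
    (P : Measure Ω) (Z : Ω → F) (α : ℝ) : Prop :=
  ∃ σ : Measure F, IsProbabilityMeasure σ ∧ σ (Metric.sphere 0 1)ᶜ = 0 ∧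
    ∀ u : ℝ, 0 < u → ∀ f : F →ᵇ ℝ,
      Tendsto (fun x : ℝ =>
          (∫ ω in {ω | u * x < ‖Z ω‖}, f (‖Z ω‖⁻¹ • Z ω) ∂P) / P.real {ω | x < ‖Z ω‖})
        atTop (𝓝 (u ^ (-α) * ∫ s, f s ∂σ))

/-- The lagged vector `(X_1, …, X_k)` as an element of `(ℝ^d)^k` with its Euclidean norm. -/
def laggedVector {d : ℕ} (X : ℤ → Ω → E d) (k : ℕ) (ω : Ω) : PiLp 2 (fun _ : Fin k => E d) :=
  WithLp.toLp 2 (fun i : Fin k => X ((i : ℤ) + 1) ω)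

/-- Regular variation with index `α` of a sequence: all lagged vectors are regularly varying. -/
def RegVarSequence {d : ℕ} (P : Measure Ω) (X : ℤ → Ω → E d) (α : ℝ) : Prop :=
  ∀ k : ℕ, 1 ≤ k → RegVarVector P (laggedVector X k) α

/-- `Θ` (defined on a possibly different probability space) is the spectral tail process of `X`:
for every `k`, the conditional law of `‖X_0‖⁻¹ (X_{-k}, …, X_k)` given `‖X_0‖ > x` converges
weakly to the law of `(Θ_{-k}, …, Θ_k)` as `x → ∞`. -/
def IsSpectralTailProcess {Ω' : Type*} [MeasurableSpace Ω'] {d : ℕ} (P : Measure Ω)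
    (X : ℤ → Ω → E d) (P' : Measure Ω') (Θ : ℤ → Ω' → E d) : Prop :=
  ∀ (k : ℕ) (f : (Finset.Icc (-(k : ℤ)) k → E d) →ᵇ ℝ),
    Tendsto (fun x : ℝ =>
        ∫ ω, f (fun t => ‖X 0 ω‖⁻¹ • X t ω) ∂(ProbabilityTheory.cond P {ω | x < ‖X 0 ω‖}))
      atTop (𝓝 (∫ ω, f (fun t => Θ t ω) ∂P'))

/-- The partial sum `S_n = X_1 + ⋯ + X_n`. -/
def partialSum {d : ℕ} (X : ℤ → Ω → E d) (n : ℕ) (ω : Ω) : E d :=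
  ∑ i ∈ Finset.Icc (1 : ℤ) n, X i ω

open Classical in
/-- The truncated partial sum `∑_{i=1}^n X_i 1{‖X_i‖ ≤ c}`. -/
def truncSum {d : ℕ} (X : ℤ → Ω → E d) (c : ℝ) (n : ℕ) (ω : Ω) : E d :=
  ∑ i ∈ Finset.Icc (1 : ℤ) n, if ‖X i ω‖ ≤ c then X i ω else 0

/-- Standing requirements on the regions `Λ_n`: non-empty Borel subsets of `(0, ∞)` whose infima
`x_n` satisfy `x_n → ∞` and `n P(‖X_0‖ > x_n) → 0`. -/
structure AdmissibleRegions {d : ℕ} (P : Measure Ω) (X : ℤ → Ω → E d) (Λ : ℕ → Set ℝ) :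
    Prop where
  measurable : ∀ n, 1 ≤ n → MeasurableSet (Λ n)
  nonempty : ∀ n, 1 ≤ n → (Λ n).Nonempty
  pos : ∀ n, 1 ≤ n → Λ n ⊆ Set.Ioi 0
  inf_tendsto : Tendsto (fun n => sInf (Λ n)) atTop atTop
  tail_tendsto : Tendsto (fun n : ℕ => (n : ℝ) * P.real {ω | sInf (Λ n) < ‖X 0 ω‖}) atTop (𝓝 0)

/-- The uniform anti-clustering condition: for all `δ > 0`,
`lim_{k → ∞} limsup_{n → ∞} sup_{x ∈ Λ_n} P(max_{k ≤ i ≤ n} ‖X_i‖ > x δ | ‖X_0‖ > x δ) = 0`. -/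
def AntiClustering {d : ℕ} (P : Measure Ω) (X : ℤ → Ω → E d) (Λ : ℕ → Set ℝ) : Prop :=
  ∀ δ : ℝ, 0 < δ →
    Tendsto (fun k : ℕ => limsup (fun n : ℕ => ⨆ x ∈ Λ n,
        ProbabilityTheory.cond P {ω | x * δ < ‖X 0 ω‖}
          {ω | ∃ i ∈ Finset.Icc (k : ℤ) n, x * δ < ‖X i ω‖}) atTop)
      atTop (𝓝 (0 : ℝ≥0∞))

/-- The vanishing-small-values condition: for all `δ > 0`, with `S̄_n` the sum of the `X_i`,
`1 ≤ i ≤ n`, truncated at `‖X_i‖ ≤ ε x`,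
`lim_{ε ↓ 0} limsup_{n → ∞} sup_{x ∈ Λ_n} P(x⁻¹ ‖S̄_n‖ > δ) / (n P(‖X_0‖ > x)) = 0`. -/
def VanishingSmallValues {d : ℕ} (P : Measure Ω) (X : ℤ → Ω → E d) (Λ : ℕ → Set ℝ) : Prop :=
  ∀ δ : ℝ, 0 < δ →
    Tendsto (fun ε : ℝ => limsup (fun n : ℕ => ⨆ x ∈ Λ n,
        P {ω | δ < x⁻¹ * ‖truncSum X (ε * x) n ω‖} / ((n : ℝ≥0∞) * P {ω | x < ‖X 0 ω‖})) atTop)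
      (𝓝[>] 0) (𝓝 (0 : ℝ≥0∞))

end Sequences

/-- The integrand `(θ'∑_{i ≥ 0} Θ_i)_+^α - (θ'∑_{i ≥ 1} Θ_i)_+^α` of the limit constant. -/
def clusterDiff {Ω' : Type*} {d : ℕ} (Θ : ℤ → Ω' → E d) (α : ℝ) (θ : E d) (ω : Ω') : ℝ :=
  (max (inner ℝ θ (∑' i : ℕ, Θ i ω)) 0) ^ α - (max (inner ℝ θ (∑' i : ℕ, Θ (i + 1) ω)) 0) ^ α

/-! ### The punctured compactified space `[-∞, ∞]^d ∖ {0}` and its Radon measures -/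

/-- `[-∞, ∞]^d ∖ {0}`, with the subspace topology of the product and its Borel σ-field. -/
abbrev PuncturedSpace (d : ℕ) : Type := {z : Fin d → EReal // z ≠ 0}

section Punctured

variable {d : ℕ}

/-- The embedding of `ℝ^d` into `[-∞, ∞]^d`. -/
def toExt (y : E d) : Fin d → EReal := fun i => (y i : EReal)

/-- The dilated set `c A`. -/
def dilate (c : ℝ) (A : Set (PuncturedSpace d)) : Set (PuncturedSpace d) :=
  {z | ∃ a ∈ A, ∀ i, z.1 i = (c : EReal) * a.1 i}

/-- A Radon measure on `[-∞, ∞]^d ∖ {0}` with `μ (t A) = t ^ (-α) μ A` for all `t > 0`. The space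
is locally compact, Hausdorff and second countable, so a Borel measure on it is Radon iff it is
finite on compact sets. -/
structure HomogeneousRadon (α : ℝ) (μ : Measure (PuncturedSpace d)) : Prop where
  finite_compact : ∀ K : Set (PuncturedSpace d), IsCompact K → μ K < ∞
  homogeneous : ∀ t : ℝ, 0 < t → ∀ A : Set (PuncturedSpace d), MeasurableSet A →
    μ (dilate t A) = ENNReal.ofReal (t ^ (-α)) * μ A

/-- A measure on `[-∞, ∞]^d ∖ {0}` which is invariant under `z ↦ -z`. -/
def SymmetricMeasure (μ : Measure (PuncturedSpace d)) : Prop :=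
  ∀ A : Set (PuncturedSpace d), MeasurableSet A → μ (dilate (-1) A) = μ A

/-- The half-space `{y ∈ ℝ^d : θ'y > 1}` as a subset of `[-∞, ∞]^d ∖ {0}`. -/
def halfSpace (θ : E d) : Set (PuncturedSpace d) :=
  {z | ∃ y : E d, z.1 = toExt y ∧ 1 < inner ℝ θ y}

/-- Two measures take the same values on all half-spaces `{y ∈ ℝ^d : θ'y > 1}`, `‖θ‖ = 1`. -/
def AgreeOnHalfSpaces (μ ν : Measure (PuncturedSpace d)) : Prop :=
  ∀ θ : E d, ‖θ‖ = 1 → μ (halfSpace θ) = ν (halfSpace θ)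

/-- Vague convergence: convergence of the integrals of all continuous functions with compact
support. -/
def VagueTendsto (ν : ℕ → Measure (PuncturedSpace d)) (μ : Measure (PuncturedSpace d)) : Prop :=
  ∀ f : PuncturedSpace d → ℝ, Continuous f → HasCompactSupport f →
    Tendsto (fun n => ∫ z, f z ∂(ν n)) atTop (𝓝 (∫ z, f z ∂μ))

/-- The measure `P(x⁻¹ S_n ∈ ·) / (n P(‖X_0‖ > x))` on `[-∞, ∞]^d ∖ {0}`. -/
def scaledLaw {Ω : Type*} [MeasurableSpace Ω] (P : Measure Ω) (X : ℤ → Ω → E d) (n : ℕ) (x : ℝ) :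
    Measure (PuncturedSpace d) :=
  ((n : ℝ≥0∞) * P {ω | x < ‖X 0 ω‖})⁻¹ •
    Measure.comap (Subtype.val : PuncturedSpace d → (Fin d → EReal))
      (P.map fun ω => toExt (x⁻¹ • partialSum X n ω))

/-- `μ` is an `α`-homogeneous Radon measure which is the vague limit of
`P(x_n⁻¹ S_n ∈ ·) / (n P(‖X_0‖ > x_n))` along every sequence with `x_n ∈ Λ_n`, `n ≥ 1`. -/
def IsLargeDeviationLimit {Ω : Type*} [MeasurableSpace Ω] (P : Measure Ω) (X : ℤ → Ω → E d)
    (Λ : ℕ → Set ℝ) (α : ℝ) (μ : Measure (PuncturedSpace d)) : Prop :=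
  HomogeneousRadon α μ ∧
    ∀ x : ℕ → ℝ, (∀ n, 1 ≤ n → x n ∈ Λ n) → VagueTendsto (fun n => scaledLaw P X n (x n)) μ

end Punctured

end HeavyTail

end

open HeavyTail

/-! Everything is computed under the tail measure ν (`tailMeasure`), the law of the path YΘ when Y
has the infinite law αy^(-α-1)dy. Regular variation says that E F(X/r) / P(‖X_0‖ > r) tends to ∫ F
dν for bounded continuous F that depend on finitely many times and vanish when ‖x_0‖ ≤ u
(`tendsto_tailMeasure`). Stationarity survives the limit: ν is shift invariant on paths that are
nonzero both at time 0 and at the time that is moved to 0 (`lintegral_shift`). Anti-clustering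
forces ν-almost every path to exceed each level only finitely often, so the path has a last maximum.
Splitting according to the position of this maximum and moving it to the origin gives the mass
transport identity `lintegral_eq_anchor`: ∫ D dν is the integral, over paths anchored at their last
maximum, of the sum of D over all shifts.

Sums are treated by telescoping. For bounded q vanishing near 0, stationarity gives E q(S_n) =
∑_{m<n} E[q(X_0+…+X_m) - q(X_1+…+X_m)] (`integral_sum_eq`). If values below the level εx are
truncated away, such an increment vanishes unless ‖X_0‖ > εx, and anti-clustering allows the horizon
m to be replaced by a fixed k. After division by nP(‖X_0‖ > x) there remains the ν-integral of the
increment of q at time 0. By mass transport it equals the integral over anchored paths of the sum of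
the increments at all times, which telescopes to q(∑_t x_t) (`integral_increment`,
`tendsto_truncated`). The limit measure is thus the law of the whole cluster sum under the anchored
part of ν (`clusterMeasure`). The values below εx are negligible by assumption if α ≥ 1, and by a
Karamata-type bound for the truncated mean if α < 1.

Two facts about ν carry the limit passages: paths are absolutely summable, and anchored paths with
∑‖x_t‖ > u have finite mass. The second is a crossing argument: such a path has a time at which its
forward sum drops from above u to at most u, and the mass of a crossing at time 0 is controlled by
E(∑_{i≥0}‖Θ_i‖)^{max(α-1,0)}. The first follows by scaling from the second.

For a half-space, q is the indicator of θ'z > 1. Integrating out Y turns its increment into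
(θ'∑_{i≥0}Θ_i)_+^α - (θ'∑_{i≥1}Θ_i)_+^α. Uniformity over Λ_n is convergence along every selection
x_n ∈ Λ_n.

For the determination by half-spaces, homogeneity excludes mass at infinity, so the question
concerns measures on ℝ^d, and half-spaces give all one-dimensional projections off 0. The
characteristic function need not be integrable near 0, so e^{ir} is replaced by its Taylor remainder
of order n = ⌈α⌉, which is integrable when n-1 < α < n. A finite difference of order 2n removes the
Taylor polynomial and leaves the Fourier transform of the finite measure (2-2cos⟨η,z⟩)^n m(dz), from
which m is recovered. For odd α the even part of the remainder is used instead; it is integrable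
because the term of degree α cancels, and on symmetric measures it loses nothing. -/

namespace HeavyTail

/-! ### The radial measure `α y^(-α-1) dy` -/

/-- The measure `α y ^ (-α - 1) dy` on `(0, ∞)`. -/
noncomputable def radialMeasure (α : ℝ) : Measure ℝ :=
  (volume.restrict (Set.Ioi 0)).withDensity fun y => ENNReal.ofReal (α * y ^ (-α - 1))

instance (α : ℝ) : SFinite (radialMeasure α) := by
  unfold radialMeasure; infer_instance

instance (α : ℝ) : NullSingletonClass (radialMeasure α) := by
  unfold radialMeasure
  exact ⟨fun x => withDensity_absolutelyContinuous _ _ (measure_singleton x)⟩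

theorem radialMeasure_Iic (α : ℝ) : radialMeasure α (Set.Iic 0) = 0 := by
  apply withDensity_absolutelyContinuous
  rw [Measure.restrict_apply measurableSet_Iic, Set.Iic_inter_Ioi, Set.Ioc_self, measure_empty]

theorem radialMeasure_ae_pos (α : ℝ) : ∀ᵐ y ∂radialMeasure α, 0 < y := by
  rw [ae_iff]
  convert radialMeasure_Iic α using 2
  ext; simp

theorem radialMeasure_restrict_Ioi (α : ℝ) :
    (radialMeasure α).restrict (Set.Ioi 0) = radialMeasure α :=
  Measure.restrict_eq_self_of_ae_mem (radialMeasure_ae_pos α)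

theorem radialMeasure_Ioi {α : ℝ} (hα : 0 < α) {r : ℝ} (hr : 0 < r) :
    radialMeasure α (Set.Ioi r) = ENNReal.ofReal (r ^ (-α)) := by
  unfold radialMeasure
  rw [withDensity_apply _ measurableSet_Ioi, Measure.restrict_restrict measurableSet_Ioi,
    Set.inter_eq_self_of_subset_left (Set.Ioi_subset_Ioi hr.le),
    ← ofReal_integral_eq_lintegral_ofReal]
  · rw [integral_const_mul, integral_Ioi_rpow_of_lt (by linarith) hr]
    congr 1
    have : -α - 1 + 1 = -α := by ring
    rw [this]; field_simp
  · exact (integrableOn_Ioi_rpow_of_lt (by linarith) hr).const_mul α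
  · refine (ae_restrict_mem measurableSet_Ioi).mono fun y hy => ?_
    have : 0 < y := hr.trans hy
    positivity

/-- Measures on the line with the same finite tails agree on `(0, ∞)`. -/
theorem restrict_Ioi_ext {m₁ m₂ : Measure ℝ} (h : ∀ r : ℝ, 0 < r → m₁ (Set.Ioi r) = m₂ (Set.Ioi r))
    (hfin : ∀ r : ℝ, 0 < r → m₁ (Set.Ioi r) ≠ ∞) :
    m₁.restrict (Set.Ioi 0) = m₂.restrict (Set.Ioi 0) := by
  have key : ∀ n : ℕ, m₁.restrict (Set.Ioi (1 / (n + 1 : ℝ))) =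
      m₂.restrict (Set.Ioi (1 / (n + 1 : ℝ))) := by
    intro n
    have hn : (0 : ℝ) < 1 / (n + 1 : ℝ) := by positivity
    have : IsFiniteMeasure (m₁.restrict (Set.Ioi (1 / (n + 1 : ℝ)))) :=
      ⟨by simpa using (hfin _ hn).lt_top⟩
    refine ext_of_generate_finite (Set.range Set.Ioi) (borel_eq_generateFrom_Ioi ℝ ▸
      BorelSpace.measurable_eq) isPiSystem_Ioi ?_ (by simpa using h _ hn)
    rintro _ ⟨a, rfl⟩
    rw [Measure.restrict_apply measurableSet_Ioi, Measure.restrict_apply measurableSet_Ioi,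
      Set.Ioi_inter_Ioi]
    exact h _ (lt_sup_of_lt_right hn)
  have hU : Set.Ioi (0 : ℝ) = ⋃ n : ℕ, Set.Ioi (1 / (n + 1 : ℝ)) := by
    ext x
    simp only [Set.mem_Ioi, Set.mem_iUnion]
    exact ⟨fun hx => exists_nat_one_div_lt hx,
      fun ⟨n, hn⟩ => lt_trans (by positivity) hn⟩
  rw [hU]
  exact Measure.restrict_iUnion_congr.2 key

/-- Homogeneity always appears as a power law for tails; this turns it into a density for the radial
part. -/
theorem restrict_Ioi_eq_radialMeasure {α : ℝ} (hα : 0 < α) {m : Measure ℝ} {c : ℝ≥0∞} (hc : c ≠ ∞)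
    (h : ∀ r : ℝ, 0 < r → m (Set.Ioi r) = c * ENNReal.ofReal (r ^ (-α))) :
    m.restrict (Set.Ioi 0) = c • radialMeasure α := by
  rw [restrict_Ioi_ext (m₂ := c • radialMeasure α), Measure.restrict_smul,
    radialMeasure_restrict_Ioi]
  · intro r hr
    rw [h r hr, Measure.smul_apply, radialMeasure_Ioi hα hr, smul_eq_mul]
  · intro r hr
    rw [h r hr]
    exact ENNReal.mul_ne_top hc ENNReal.ofReal_ne_top

theorem radialMeasure_map_mul {α : ℝ} (hα : 0 < α) {t : ℝ} (ht : 0 < t) :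
    (radialMeasure α).map (fun y => t * y) = ENNReal.ofReal (t ^ α) • radialMeasure α := by
  have hm : Measurable fun y : ℝ => t * y := by fun_prop
  have hpre : (fun y : ℝ => t * y) ⁻¹' Set.Ioi 0 = Set.Ioi 0 := by
    ext y; simp [ht]
  have : ((radialMeasure α).map (fun y => t * y)).restrict (Set.Ioi 0) =
      (radialMeasure α).map (fun y => t * y) := by
    rw [Measure.restrict_map hm measurableSet_Ioi, hpre, radialMeasure_restrict_Ioi]
  rw [← this]
  refine restrict_Ioi_eq_radialMeasure hα ENNReal.ofReal_ne_top fun r hr => ?_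
  rw [Measure.map_apply hm measurableSet_Ioi]
  have : (fun y : ℝ => t * y) ⁻¹' Set.Ioi r = Set.Ioi (r / t) := by
    ext y; simp [div_lt_iff₀' ht]
  rw [this, radialMeasure_Ioi hα (by positivity), ← ENNReal.ofReal_mul (by positivity)]
  congr 1
  rw [Real.div_rpow hr.le ht.le, Real.rpow_neg ht.le]
  field_simp

/-- Origin of the positive parts and of the exponent in the limit constant: for w > 0 the event is a
tail at u/w, and for w ≤ 0 no positive y satisfies it. -/
theorem radialMeasure_setOf_lt_mul {α : ℝ} (hα : 0 < α) {u : ℝ} (hu : 0 < u) (w : ℝ) :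
    radialMeasure α {y | u < y * w} = ENNReal.ofReal (u ^ (-α) * max w 0 ^ α) := by
  rw [← radialMeasure_restrict_Ioi, Measure.restrict_apply (measurableSet_lt (by fun_prop)
    (by fun_prop))]
  rcases le_or_gt w 0 with hw | hw
  · rw [max_eq_right hw, Real.zero_rpow hα.ne', mul_zero, ENNReal.ofReal_zero]
    convert measure_empty (μ := radialMeasure α)
    ext y
    simp only [Set.mem_inter_iff, Set.mem_ofPred_eq, Set.mem_Ioi, Set.mem_empty_iff_false, iff_false,
      not_and]
    intro h1 h2
    nlinarith
  · rw [max_eq_left hw.le]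
    have : {y | u < y * w} ∩ Set.Ioi 0 = Set.Ioi (u / w) := by
      ext y
      simp only [Set.mem_inter_iff, Set.mem_ofPred_eq, Set.mem_Ioi, div_lt_iff₀ hw]
      exact ⟨fun h => h.1, fun h => ⟨h, by by_contra hy; nlinarith⟩⟩
    rw [this, radialMeasure_Ioi hα (by positivity)]
    congr 1
    rw [Real.div_rpow hu.le hw.le, Real.rpow_neg hw.le]
    field_simp

theorem radialMeasure_setOf_mul_eq (α : ℝ) {u : ℝ} (hu : 0 < u) (w : ℝ) :
    radialMeasure α {y | y * w = u} = 0 := by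
  refine Set.Subsingleton.measure_zero ?_ _
  intro y hy z hz
  simp only [Set.mem_ofPred_eq] at hy hz
  have hw : w ≠ 0 := by rintro rfl; simp at hy; exact hu.ne hy
  exact mul_right_cancel₀ hw (hy.trans hz.symm)

/-! ### Limits through approximation -/

/-- Interchange of limits with no uniformity in ε: each ε may have its own approximating family and
its own limit. -/
theorem tendsto_of_approx {ι : Type*} {l : Filter ι} {g : ι → ℝ} {a : ℝ}
    (H : ∀ ε : ℝ, 0 < ε → ∃ (h : ι → ℝ) (b : ℝ), Tendsto h l (𝓝 b) ∧
      (∀ᶠ i in l, |g i - h i| ≤ ε) ∧ |a - b| ≤ ε) :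
    Tendsto g l (𝓝 a) := by
  rw [Metric.tendsto_nhds]
  intro ε hε
  obtain ⟨h, b, hb, hgh, hab⟩ := H (ε / 4) (by positivity)
  filter_upwards [hgh, Metric.tendsto_nhds.1 hb (ε / 4) (by positivity)] with i hi hi'
  rw [Real.dist_eq] at hi' ⊢
  have h1 := abs_le.1 hi
  have h2 := abs_lt.1 hi'
  have h3 := abs_le.1 hab
  rw [abs_lt]
  constructor <;> linarith [h1.1, h1.2, h2.1, h2.2, h3.1, h3.2]

end HeavyTail

namespace HeavyTail

/-! ### Joint convergence from convergence on slices -/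

section Slices

variable {W : Type*}

section Cutoff

variable [NormedAddCommGroup W]

/-- A continuous cutoff: `1` on the ball of radius `K`, `0` off the ball of radius `K + 1`. -/
noncomputable def cutoff (K : ℝ) (w : W) : ℝ := max 0 (min 1 (K + 1 - ‖w‖))

theorem cutoff_nonneg (K : ℝ) (w : W) : 0 ≤ cutoff K w := le_max_left _ _

theorem cutoff_le_one (K : ℝ) (w : W) : cutoff K w ≤ 1 := max_le zero_le_one (min_le_left _ _)

theorem continuous_cutoff (K : ℝ) : Continuous (cutoff (W := W) K) := by
  unfold cutoff; fun_prop

theorem cutoff_eq_one {K : ℝ} {w : W} (h : ‖w‖ ≤ K) : cutoff K w = 1 := by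
  unfold cutoff; rw [min_eq_left (by linarith), max_eq_right zero_le_one]

theorem cutoff_eq_zero {K : ℝ} {w : W} (h : K + 1 ≤ ‖w‖) : cutoff K w = 0 := by
  unfold cutoff
  exact max_eq_left ((min_le_right _ _).trans (by linarith))

theorem lipschitz_cutoff (K : ℝ) (w z : W) : |cutoff K w - cutoff K z| ≤ ‖w - z‖ := by
  unfold cutoff
  refine (abs_max_sub_max_le_max _ _ _ _).trans ?_
  refine max_le (by simp) ((abs_min_sub_min_le_max _ _ _ _).trans (max_le (by simp) ?_))
  have : K + 1 - ‖w‖ - (K + 1 - ‖z‖) = -(‖w‖ - ‖z‖) := by ring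
  rw [this, abs_neg]
  exact abs_norm_sub_norm_le _ _

/-- Tightness of one finite measure, phrased with continuous cutoffs so that it can be transferred
to a family whose integrals converge to it. -/
theorem tendsto_integral_one_sub_cutoff [MeasurableSpace W] [BorelSpace W] {α : Type*}
    [MeasurableSpace α] (m : Measure α) [IsFiniteMeasure m] {g : α → W} (hg : AEMeasurable g m) :
    Tendsto (fun K : ℕ => ∫ a, (1 - cutoff (K : ℝ) (g a)) ∂m) atTop (𝓝 0) := by
  have : (0 : ℝ) = ∫ _a, (0 : ℝ) ∂m := by simp
  rw [this]
  refine tendsto_integral_of_dominated_convergence (fun _ => 1) (fun K => ?_) (integrable_const _)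
    (fun K => ?_) ?_
  · have := (continuous_cutoff (W := W) (K : ℝ)).measurable.comp_aemeasurable hg
    exact (aemeasurable_const.sub this).aestronglyMeasurable
  · refine .of_forall fun a => ?_
    rw [Real.norm_eq_abs, abs_le]
    constructor <;> linarith [cutoff_nonneg (K : ℝ) (g a), cutoff_le_one (K : ℝ) (g a)]
  · refine .of_forall fun a => ?_
    obtain ⟨N, hN⟩ := exists_nat_ge ‖g a‖
    refine tendsto_const_nhds.congr' ?_
    filter_upwards [eventually_ge_atTop N] with K hK
    rw [cutoff_eq_one (hN.trans (by exact_mod_cast hK)), sub_self]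

end Cutoff

/-- Telescoping step approximation of a function of two variables on a grid. -/
theorem abs_sub_step_le {G : ℝ × W → ℝ} {χ : W → ℝ} (hχ0 : ∀ w, 0 ≤ χ w) (hχ1 : ∀ w, χ w ≤ 1)
    {B η u s : ℝ} (hB : ∀ p, |G p| ≤ B) (hη : 0 ≤ η) (hs : 0 ≤ s) {N : ℕ}
    (hG : ∀ y y' w, u ≤ y → y ≤ u + N * s → u ≤ y' → y' ≤ u + N * s → |y - y'| ≤ s →
      χ w ≠ 0 → |G (y, w) - G (y', w)| ≤ η) {y : ℝ} (hy : u < y) (w : W) :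
    |G (y, w) - ∑ j ∈ Finset.range N,
      ((Set.Ioi (u + j * s)).indicator (fun _ => G (u + j * s, w) * χ w) y -
        (Set.Ioi (u + (j + 1 : ℕ) * s)).indicator (fun _ => G (u + j * s, w) * χ w) y)| ≤
      η + B * (1 - χ w) + (Set.Ioi (u + N * s)).indicator (fun _ => B) y := by
  have hB0 : 0 ≤ B := (abs_nonneg _).trans (hB (y, w))
  have hmono : ∀ i j : ℕ, i ≤ j → u + i * s ≤ u + j * s := fun i j hij => by
    have : (i : ℝ) ≤ j := by exact_mod_cast hij
    nlinarith
  by_cases hyN : u + N * s < y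
  · rw [Finset.sum_eq_zero, sub_zero, Set.indicator_of_mem (Set.mem_Ioi.2 hyN)]
    · have := hB (y, w)
      have h2 : 0 ≤ B * (1 - χ w) := mul_nonneg hB0 (by linarith [hχ1 w])
      linarith
    · intro j hj
      rw [Finset.mem_range] at hj
      rw [Set.indicator_of_mem, Set.indicator_of_mem, sub_self]
      · exact (hmono (j + 1) N hj).trans_lt hyN
      · exact (hmono j N hj.le).trans_lt hyN
  · push Not at hyN
    classical
    have hex : ∃ k : ℕ, y ≤ u + k * s := ⟨N, hyN⟩
    -- The cell (u + js, u + (j+1)s] that contains y; the index found is not 0 because u < y. Only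
    -- the j-th difference of indicators is nonzero at y.
    obtain ⟨j, hj⟩ : ∃ j, Nat.find hex = j + 1 := by
      refine Nat.exists_eq_succ_of_ne_zero fun h0 => ?_
      have := Nat.find_spec hex
      rw [h0] at this
      simp at this
      linarith
    have h1 : y ≤ u + (j + 1 : ℕ) * s := hj ▸ Nat.find_spec hex
    have h2 : u + j * s < y := by
      have := Nat.find_min hex (m := j) (by omega)
      exact not_le.1 this
    have hjN : j < N := by
      have := Nat.find_min' hex hyN
      omega
    rw [Finset.sum_eq_single j]
    · rw [Set.indicator_of_mem (Set.mem_Ioi.2 h2), Set.indicator_of_notMem (by simpa using h1),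
        Set.indicator_of_notMem (by simpa using hyN), sub_zero, add_zero]
      -- Oscillation of G inside one cell where the cutoff is active, plus the part of G removed by
      -- the cutoff.
      have e : G (y, w) - G (u + j * s, w) * χ w =
        (G (y, w) - G (u + j * s, w)) * χ w + G (y, w) * (1 - χ w) := by ring
      rw [e]
      refine (abs_add_le _ _).trans (add_le_add ?_ ?_)
      · rw [abs_mul, abs_of_nonneg (hχ0 w)]
        by_cases hw : χ w = 0
        · rw [hw, mul_zero]; exact hη
        · have := hG y (u + j * s) w hy.le hyN (by simpa using hmono 0 j (by omega))
            (hmono j N hjN.le) (by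
              rw [abs_of_pos (by linarith)]
              push_cast at h1; linarith) hw
          calc _ ≤ η * 1 := mul_le_mul this (hχ1 w) (hχ0 w) hη
            _ = η := mul_one _
      · rw [abs_mul, abs_of_nonneg (a := 1 - χ w) (by linarith [hχ1 w])]
        exact mul_le_mul_of_nonneg_right (hB _) (by linarith [hχ1 w])
    · intro i _ hij
      rcases lt_or_gt_of_ne hij with h | h
      · rw [Set.indicator_of_mem, Set.indicator_of_mem, sub_self]
        · exact (hmono (i + 1) j h).trans_lt h2
        · exact (hmono i j h.le).trans_lt h2
      · rw [Set.indicator_of_notMem, Set.indicator_of_notMem, sub_self]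
        · exact not_lt.2 (h1.trans (hmono (j + 1) (i + 1) (by omega)))
        · exact not_lt.2 (h1.trans (hmono (j + 1) i h))
    · intro h; exact absurd (Finset.mem_range.2 hjN) h

variable [NormedAddCommGroup W] [MeasurableSpace W] [BorelSpace W] [SecondCountableTopology W]

/-- The pointwise step bound, integrated. The step function is a finite combination of functions of
w alone over slices {y > v}, which are exactly the integrals whose convergence is known. -/
theorem abs_integral_sub_step_le (m : Measure (ℝ × W)) {G : ℝ × W → ℝ} (hGc : Continuous G)
    {χ : W → ℝ} (hχc : Continuous χ) (hχ0 : ∀ w, 0 ≤ χ w) (hχ1 : ∀ w, χ w ≤ 1)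
    {B η u s : ℝ} (hB : ∀ p, |G p| ≤ B) (hη : 0 ≤ η) (hs : 0 ≤ s) {N : ℕ}
    (hG : ∀ y y' w, u ≤ y → y ≤ u + N * s → u ≤ y' → y' ≤ u + N * s → |y - y'| ≤ s →
      χ w ≠ 0 → |G (y, w) - G (y', w)| ≤ η) (hm : m {p | u < p.1} ≠ ∞) :
    |∫ p in {p | u < p.1}, G p ∂m - ∑ j ∈ Finset.range N,
      (∫ p in {p | u + j * s < p.1}, G (u + j * s, p.2) * χ p.2 ∂m -
        ∫ p in {p | u + (j + 1 : ℕ) * s < p.1}, G (u + j * s, p.2) * χ p.2 ∂m)| ≤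
      η * m.real {p | u < p.1} + B * ∫ p in {p | u < p.1}, (1 - χ p.2) ∂m +
        B * m.real {p | u + N * s < p.1} := by
  have hmeas : ∀ v : ℝ, MeasurableSet {p : ℝ × W | v < p.1} := fun v =>
    measurableSet_lt measurable_const measurable_fst
  have : IsFiniteMeasure (m.restrict {p | u < p.1}) := ⟨by simpa using hm.lt_top⟩
  have hle : ∀ k : ℕ, u ≤ u + k * s := fun k => by nlinarith [(Nat.cast_nonneg k : (0 : ℝ) ≤ k)]
  have hsub : ∀ k : ℕ, {p : ℝ × W | u + k * s < p.1} ∩ {p | u < p.1} = {p | u + k * s < p.1} :=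
    fun k => Set.inter_eq_self_of_subset_left fun p hp => (hle k).trans_lt hp
  have hbdd : ∀ j : ℕ, ∀ p : ℝ × W, |G (u + j * s, p.2) * χ p.2| ≤ B := fun j p => by
    rw [abs_mul, abs_of_nonneg (hχ0 p.2)]
    calc _ ≤ B * 1 := mul_le_mul (hB _) (hχ1 _) (hχ0 _) ((abs_nonneg _).trans (hB p))
      _ = B := mul_one _
  have hbint : ∀ {f : ℝ × W → ℝ} (C : ℝ), Measurable f → (∀ p, |f p| ≤ C) →
      Integrable f (m.restrict {p | u < p.1}) := fun C hf hC =>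
    Integrable.of_bound hf.aestronglyMeasurable C (.of_forall hC)
  have hjint : ∀ j : ℕ, Integrable (fun p : ℝ × W => G (u + j * s, p.2) * χ p.2)
      (m.restrict {p | u < p.1}) := fun j =>
    hbint B (Continuous.measurable (by fun_prop)) (hbdd j)
  have hind : ∀ j k : ℕ, ∫ p in {p | u + k * s < p.1}, G (u + j * s, p.2) * χ p.2 ∂m =
      ∫ p in {p | u < p.1}, (Set.Ioi (u + k * s)).indicator
        (fun _ => G (u + j * s, p.2) * χ p.2) p.1 ∂m := by
    intro j k
    have : (fun p : ℝ × W => (Set.Ioi (u + k * s)).indicator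
        (fun _ => G (u + j * s, p.2) * χ p.2) p.1) =
        ({p : ℝ × W | u + k * s < p.1}).indicator (fun p => G (u + j * s, p.2) * χ p.2) := by
      ext p; simp [Set.indicator_apply]
    rw [this, integral_indicator (hmeas _), Measure.restrict_restrict (hmeas _), hsub]
  have hindint : ∀ j k : ℕ, Integrable (fun p : ℝ × W => (Set.Ioi (u + k * s)).indicator
        (fun _ => G (u + j * s, p.2) * χ p.2) p.1) (m.restrict {p | u < p.1}) := by
    intro j k
    have : (fun p : ℝ × W => (Set.Ioi (u + k * s)).indicator
        (fun _ => G (u + j * s, p.2) * χ p.2) p.1) =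
        ({p : ℝ × W | u + k * s < p.1}).indicator (fun p => G (u + j * s, p.2) * χ p.2) := by
      ext p; simp [Set.indicator_apply]
    rw [this]
    exact (hjint j).indicator (hmeas _)
  simp only [hind]
  simp only [← integral_sub (hindint _ _) (hindint _ _)]
  have hdint : ∀ j : ℕ, Integrable (fun p : ℝ × W =>
      (Set.Ioi (u + j * s)).indicator (fun _ => G (u + j * s, p.2) * χ p.2) p.1 -
        (Set.Ioi (u + (j + 1 : ℕ) * s)).indicator (fun _ => G (u + j * s, p.2) * χ p.2) p.1)
      (m.restrict {p | u < p.1}) := fun j => (hindint _ _).sub (hindint _ _)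
  have hsint := integrable_finsetSum (Finset.range N) fun j _ => hdint j
  rw [← integral_finsetSum _ fun j _ => hdint j, ← integral_sub (hbint B hGc.measurable hB) hsint]
  have hχint : Integrable (fun p : ℝ × W => 1 - χ p.2) (m.restrict {p | u < p.1}) :=
    hbint 1 (Continuous.measurable (by fun_prop)) fun p => by
      rw [abs_le]; constructor <;> linarith [hχ0 p.2, hχ1 p.2]
  have hlast : Integrable (fun p : ℝ × W => (Set.Ioi (u + N * s)).indicator (fun _ => B) p.1)
      (m.restrict {p | u < p.1}) := by
    have : (fun p : ℝ × W => (Set.Ioi (u + N * s)).indicator (fun _ => B) p.1) =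
        ({p : ℝ × W | u + N * s < p.1}).indicator (fun p => B) := by
      ext p; simp [Set.indicator_apply]
    rw [this]
    exact (integrable_const B).indicator (hmeas _)
  have hlast' : ∫ p in {p | u < p.1}, (Set.Ioi (u + N * s)).indicator (fun _ => B) p.1 ∂m =
      B * m.real {p | u + N * s < p.1} := by
    have : (fun p : ℝ × W => (Set.Ioi (u + N * s)).indicator (fun _ => B) p.1) =
        ({p : ℝ × W | u + N * s < p.1}).indicator (fun p => B) := by
      ext p; simp [Set.indicator_apply]
    rw [this, integral_indicator (hmeas _), Measure.restrict_restrict (hmeas _), hsub]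
    simp [mul_comm]
  have hbound : ∫ p in {p | u < p.1}, (η + B * (1 - χ p.2) +
        (Set.Ioi (u + N * s)).indicator (fun _ => B) p.1) ∂m =
      η * m.real {p | u < p.1} + B * ∫ p in {p | u < p.1}, (1 - χ p.2) ∂m +
        B * m.real {p | u + N * s < p.1} := by
    have hηχ : Integrable (fun p : ℝ × W => η + B * (1 - χ p.2)) (m.restrict {p | u < p.1}) :=
      (integrable_const _).add (hχint.const_mul B)
    rw [integral_add hηχ hlast,
      integral_add (integrable_const _) (hχint.const_mul B), integral_const_mul, hlast']
    simp [mul_comm]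
  rw [← hbound]
  refine abs_integral_le_integral_abs.trans (integral_mono_ae ?_ ?_ ?_)
  · exact ((hbint B hGc.measurable hB).sub hsint).abs
  · exact ((integrable_const _).add (hχint.const_mul B)).add hlast
  · filter_upwards [ae_restrict_mem (hmeas u)] with p hp
    exact abs_sub_step_le hχ0 hχ1 hB hη hs hG hp p.2

/-- Convergence of the integrals over all slices `{y > v}` of functions of the second variable
implies convergence of the integrals over slices of all bounded continuous functions. -/
theorem tendsto_integral_slice [ProperSpace W] {ι : Type*} {l : Filter ι} {m : ι → Measure (ℝ × W)}
    {m₀ : Measure (ℝ × W)} (hm : ∀ i v, 0 < v → m i {p | v < p.1} ≠ ∞)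
    (hm₀ : ∀ v, 0 < v → m₀ {p | v < p.1} ≠ ∞)
    (hslice : ∀ v : ℝ, 0 < v → ∀ f : W →ᵇ ℝ,
      Tendsto (fun i => ∫ p in {p | v < p.1}, f p.2 ∂(m i)) l
        (𝓝 (∫ p in {p | v < p.1}, f p.2 ∂m₀)))
    {G : ℝ × W → ℝ} (hG : Continuous G) {B : ℝ} (hB : ∀ p, |G p| ≤ B) {u : ℝ} (hu : 0 < u) :
    Tendsto (fun i => ∫ p in {p | u < p.1}, G p ∂(m i)) l
      (𝓝 (∫ p in {p | u < p.1}, G p ∂m₀)) := by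
  have hmeas : ∀ v : ℝ, MeasurableSet {p : ℝ × W | v < p.1} := fun v =>
    measurableSet_lt measurable_const measurable_fst
  have hB0 : 0 ≤ B := (abs_nonneg _).trans (hB 0)
  have hreal : ∀ v, 0 < v → Tendsto (fun i => (m i).real {p | v < p.1}) l
      (𝓝 (m₀.real {p | v < p.1})) := by
    intro v hv
    have := hslice v hv (BoundedContinuousFunction.const W 1)
    simpa using this
  refine tendsto_of_approx fun ε hε => ?_
  have : IsFiniteMeasure (m₀.restrict {p | u < p.1}) := ⟨by simpa using (hm₀ u hu).lt_top⟩
  -- Three errors under m₀, each below ε/4: the mass outside a ball in W, the tail beyond Y, and the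
  -- oscillation η on the cells. Their sum is strictly below ε, so the bound persists for `m i`
  -- eventually.
  obtain ⟨K, hK⟩ : ∃ K : ℕ, B * ∫ p in {p : ℝ × W | u < p.1}, (1 - cutoff (K : ℝ) p.2) ∂m₀ <
      ε / 4 := by
    have h := (tendsto_integral_one_sub_cutoff (m₀.restrict {p : ℝ × W | u < p.1})
      (g := fun p => p.2) measurable_snd.aemeasurable).const_mul B
    rw [mul_zero] at h
    exact (h.eventually (gt_mem_nhds (by positivity))).exists
  obtain ⟨Y, hYu, hY⟩ : ∃ Y : ℝ, u < Y ∧ B * m₀.real {p | Y < p.1} < ε / 4 := by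
    have h : Tendsto (fun Y : ℝ => m₀ {p | Y < p.1}) atTop (𝓝 (m₀ (⋂ Y : ℝ, {p | Y < p.1}))) :=
      tendsto_measure_iInter_atTop (fun _ => (hmeas _).nullMeasurableSet)
        (fun a b hab p hp => lt_of_le_of_lt hab hp) ⟨u, hm₀ u hu⟩
    have he : (⋂ Y : ℝ, {p : ℝ × W | Y < p.1}) = ∅ := by
      ext p
      simp only [Set.mem_iInter, Set.mem_ofPred_eq, Set.mem_empty_iff_false, iff_false, not_forall]
      exact ⟨p.1, lt_irrefl _⟩
    rw [he, measure_empty] at h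
    have h' := ((ENNReal.tendsto_toReal ENNReal.zero_ne_top).comp h).const_mul B
    rw [ENNReal.toReal_zero, mul_zero] at h'
    exact ((eventually_gt_atTop u).and (h'.eventually (gt_mem_nhds
      (show (0 : ℝ) < ε / 4 by positivity)))).exists
  obtain ⟨η, hη, hηM⟩ : ∃ η > 0, η * m₀.real {p | u < p.1} < ε / 4 := by
    have : 0 ≤ m₀.real {p | u < p.1} := measureReal_nonneg
    refine ⟨ε / (4 * (m₀.real {p | u < p.1} + 1)), by positivity, ?_⟩
    rw [div_mul_eq_mul_div, div_lt_div_iff₀ (by positivity) (by norm_num)]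
    nlinarith
  have hcomp : IsCompact (Set.Icc u Y ×ˢ Metric.closedBall (0 : W) (K + 1)) :=
    isCompact_Icc.prod (isCompact_closedBall _ _)
  have huc := Metric.uniformContinuousOn_iff.1
    (hcomp.uniformContinuousOn_of_continuous hG.continuousOn) η hη
  obtain ⟨δ, hδ, hGδ⟩ := huc
  obtain ⟨N, hN⟩ := exists_nat_gt ((Y - u) / δ)
  have hN0 : (0 : ℝ) < N := lt_of_le_of_lt (by have := sub_pos.2 hYu; positivity) hN
  set s := (Y - u) / N with hs
  have hs0 : 0 ≤ s := by have := sub_pos.2 hYu; positivity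
  have hsδ : s < δ := by
    rw [hs, div_lt_iff₀ hN0]
    rw [div_lt_iff₀ hδ] at hN
    linarith
  have hYN : u + N * s = Y := by rw [hs]; field_simp; ring
  have hGη : ∀ y y' (w : W), u ≤ y → y ≤ u + N * s → u ≤ y' → y' ≤ u + N * s → |y - y'| ≤ s →
      cutoff (K : ℝ) w ≠ 0 → |G (y, w) - G (y', w)| ≤ η := by
    intro y y' w h1 h2 h3 h4 h5 h6
    rw [hYN] at h2 h4
    have hw : ‖w‖ ≤ K + 1 := by
      by_contra hc
      exact h6 (cutoff_eq_zero (not_le.1 hc).le)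
    have := hGδ (y, w) ⟨⟨h1, h2⟩, by simpa using hw⟩ (y', w) ⟨⟨h3, h4⟩, by simpa using hw⟩
      (by rw [Prod.dist_eq, dist_self, Real.dist_eq]
          exact max_lt (h5.trans_lt hsδ) hδ)
    exact this.le
  have hc := continuous_cutoff (W := W) (K : ℝ)
  have h0 := cutoff_nonneg (W := W) (K : ℝ)
  have h1 := cutoff_le_one (W := W) (K : ℝ)
  have hstep : ∀ (m : Measure (ℝ × W)), m {p | u < p.1} ≠ ∞ → _ := fun m hm' =>
    abs_integral_sub_step_le m hG hc h0 h1 hB hη.le hs0 hGη hm'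
  have hgj : ∀ (j : ℕ) (v : ℝ), 0 < v → Tendsto
      (fun i => ∫ p in {p : ℝ × W | v < p.1}, G (u + j * s, p.2) * cutoff (K : ℝ) p.2 ∂(m i)) l
      (𝓝 (∫ p in {p | v < p.1}, G (u + j * s, p.2) * cutoff (K : ℝ) p.2 ∂m₀)) := by
    intro j v hv
    refine hslice v hv (BoundedContinuousFunction.ofNormedAddCommGroup
      (fun w => G (u + j * s, w) * cutoff (K : ℝ) w) (by fun_prop) B fun w => ?_)
    rw [Real.norm_eq_abs, abs_mul, abs_of_nonneg (h0 w)]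
    calc _ ≤ B * 1 := mul_le_mul (hB _) (h1 _) (h0 _) hB0
      _ = B := mul_one _
  have hpos : ∀ k : ℕ, 0 < u + k * s := fun k => by
    have : 0 ≤ (k : ℝ) * s := by positivity
    linarith
  refine ⟨fun i => ∑ j ∈ Finset.range N,
      (∫ p in {p | u + j * s < p.1}, G (u + j * s, p.2) * cutoff (K : ℝ) p.2 ∂(m i) -
        ∫ p in {p | u + (j + 1 : ℕ) * s < p.1}, G (u + j * s, p.2) * cutoff (K : ℝ) p.2 ∂(m i)),
      _, tendsto_finsetSum _ fun j _ => (hgj j _ (hpos j)).sub (hgj j _ (hpos (j + 1))), ?_, ?_⟩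
  -- The error bound is itself built from slice integrals, so it converges to its value under m₀.
  · have hE : Tendsto (fun i => η * (m i).real {p | u < p.1} +
        B * ∫ p in {p : ℝ × W | u < p.1}, (1 - cutoff (K : ℝ) p.2) ∂(m i) +
        B * (m i).real {p | u + N * s < p.1}) l (𝓝 (η * m₀.real {p | u < p.1} +
        B * ∫ p in {p : ℝ × W | u < p.1}, (1 - cutoff (K : ℝ) p.2) ∂m₀ +
        B * m₀.real {p | u + N * s < p.1})) := by
      refine (((hreal u hu).const_mul η).add (Tendsto.const_mul B ?_)).add
        ((hreal _ (hpos N)).const_mul B)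
      refine hslice u hu (BoundedContinuousFunction.ofNormedAddCommGroup
        (fun w => 1 - cutoff (K : ℝ) w) (by fun_prop) 1 fun w => ?_)
      rw [Real.norm_eq_abs, abs_le]
      constructor <;> linarith [h0 w, h1 w]
    rw [hYN] at hE
    filter_upwards [hE.eventually (gt_mem_nhds (show _ < ε by linarith))] with i hi
    refine (hstep (m i) (hm i u hu)).trans ?_
    rw [hYN]
    exact hi.le
  · refine (hstep m₀ (hm₀ u hu)).trans ?_
    rw [hYN]
    linarith

end Slices

end HeavyTail

namespace HeavyTail

set_option linter.unusedSectionVars false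

/-! ### The tail measure -/

/-- The hypotheses on the sequence and its spectral tail process. -/
structure SpectralSetup {Ω Ω' : Type*} [MeasurableSpace Ω] [MeasurableSpace Ω'] (P : Measure Ω)
    (P' : Measure Ω') {d : ℕ} (X : ℤ → Ω → E d) (Θ : ℤ → Ω' → E d) (α : ℝ) : Prop where
  measurable_X : ∀ t, Measurable (X t)
  measurable_Θ : ∀ t, Measurable (Θ t)
  index_pos : 0 < α
  stationary : StrictlyStationary P X
  regVar : RegVarSequence P X α
  spectral : IsSpectralTailProcess P X P' Θ

/-- The law of `Y Θ` where `Y` has the infinite law `α y ^ (-α - 1) dy`. -/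
noncomputable def tailMeasure {Ω' : Type*} [MeasurableSpace Ω'] (P' : Measure Ω') {d : ℕ}
    (Θ : ℤ → Ω' → E d) (α : ℝ) : Measure (ℤ → E d) :=
  ((radialMeasure α).prod P').map fun p t => p.1 • Θ t p.2

section Setup

variable {Ω Ω' : Type*} [MeasurableSpace Ω] [MeasurableSpace Ω'] {P : Measure Ω} {P' : Measure Ω'}
  {d : ℕ} {X : ℤ → Ω → E d} {Θ : ℤ → Ω' → E d} {α : ℝ}

theorem lintegral_tailMeasure [SFinite P'] (hΘ : ∀ t, Measurable (Θ t)) {F : (ℤ → E d) → ℝ≥0∞}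
    (hF : Measurable F) :
    ∫⁻ x, F x ∂tailMeasure P' Θ α =
      ∫⁻ ω, ∫⁻ y, F (fun t => y • Θ t ω) ∂radialMeasure α ∂P' := by
  have hm : Measurable fun (p : ℝ × Ω') (t : ℤ) => p.1 • Θ t p.2 := by fun_prop
  unfold tailMeasure
  rw [lintegral_map hF hm]
  exact lintegral_prod_symm _ (hF.comp hm).aemeasurable

theorem tailMeasure_apply [SFinite P'] (hΘ : ∀ t, Measurable (Θ t)) {A : Set (ℤ → E d)}
    (hA : MeasurableSet A) :
    tailMeasure P' Θ α A = ∫⁻ ω, radialMeasure α {y | (fun t => y • Θ t ω) ∈ A} ∂P' := by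
  have h := lintegral_tailMeasure (P' := P') (α := α) hΘ (measurable_one.indicator hA)
  rw [lintegral_indicator_one hA] at h
  rw [h]
  refine lintegral_congr fun ω => ?_
  have hm : Measurable fun (y : ℝ) (t : ℤ) => y • Θ t ω := by fun_prop
  exact lintegral_indicator_one (hm hA)

/-- Scaling of the tail measure. -/
theorem tailMeasure_smul [SFinite P'] (hΘ : ∀ t, Measurable (Θ t)) (hα : 0 < α) {c : ℝ}
    (hc : 0 < c) {F : (ℤ → E d) → ℝ≥0∞} (hF : Measurable F) :
    ∫⁻ x, F (fun t => c • x t) ∂tailMeasure P' Θ α =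
      ENNReal.ofReal (c ^ α) * ∫⁻ x, F x ∂tailMeasure P' Θ α := by
  have hmc : Measurable fun (x : ℤ → E d) (t : ℤ) => c • x t := by fun_prop
  refine (lintegral_tailMeasure hΘ (hF.comp hmc)).trans ?_
  rw [lintegral_tailMeasure hΘ hF, ← lintegral_const_mul' _ _ ENNReal.ofReal_ne_top]
  refine lintegral_congr fun ω => ?_
  have hm : Measurable fun (y : ℝ) => F fun t : ℤ => y • Θ t ω := hF.comp (by fun_prop)
  have h := lintegral_map (μ := radialMeasure α) hm (g := fun y => c * y) (by fun_prop)
  rw [radialMeasure_map_mul hα hc, lintegral_smul_measure, smul_eq_mul] at h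
  simp only [Function.comp, smul_smul]
  exact h.symm

theorem tailMeasure_smul_set [SFinite P'] (hΘ : ∀ t, Measurable (Θ t)) (hα : 0 < α) {c : ℝ}
    (hc : 0 < c) {A : Set (ℤ → E d)} (hA : MeasurableSet A) :
    tailMeasure P' Θ α {x | (fun t => c • x t) ∈ A} =
      ENNReal.ofReal (c ^ α) * tailMeasure P' Θ α A := by
  have hmc : Measurable fun (x : ℤ → E d) (t : ℤ) => c • x t := by fun_prop
  have h := tailMeasure_smul (P' := P') hΘ hα hc (measurable_one.indicator hA)
  rw [lintegral_indicator_one hA] at h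
  rw [← h]
  exact (lintegral_indicator_one (hmc hA)).symm

namespace SpectralSetup

variable [IsProbabilityMeasure P] [IsProbabilityMeasure P'] (S : SpectralSetup P P' X Θ α)
include S

theorem measurable_path : Measurable fun ω (t : ℤ) => X t ω :=
  measurable_pi_lambda _ S.measurable_X

theorem integral_shift {F : (ℤ → E d) → ℝ} (hF : Measurable F) (h : ℤ) :
    ∫ ω, F (fun t => X (t + h) ω) ∂P = ∫ ω, F (fun t => X t ω) ∂P := by
  have hm : Measurable fun ω (t : ℤ) => X (t + h) ω :=
    measurable_pi_lambda _ fun t => S.measurable_X (t + h)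
  rw [← integral_map hm.aemeasurable hF.aestronglyMeasurable (f := F), S.stationary h,
    integral_map S.measurable_path.aemeasurable hF.aestronglyMeasurable]

theorem measure_shift {A : Set (ℤ → E d)} (hA : MeasurableSet A) (h : ℤ) :
    P {ω | (fun t => X (t + h) ω) ∈ A} = P {ω | (fun t => X t ω) ∈ A} := by
  have hm : Measurable fun ω (t : ℤ) => X (t + h) ω :=
    measurable_pi_lambda _ fun t => S.measurable_X (t + h)
  have := congrArg (fun μ => μ A) (S.stationary h)
  simp only [Measure.map_apply hm hA, Measure.map_apply S.measurable_path hA] at this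
  exact this

theorem measure_norm_shift (x : ℝ) (h : ℤ) : P {ω | x < ‖X h ω‖} = P {ω | x < ‖X 0 ω‖} := by
  have := S.measure_shift (A := {y | x < ‖y 0‖})
    (measurableSet_lt measurable_const (by fun_prop)) h
  simpa using this

theorem measurableSet_norm (x : ℝ) (h : ℤ) : MeasurableSet {ω | x < ‖X h ω‖} :=
  measurableSet_lt measurable_const (S.measurable_X h).norm

/-- Regular variation of the lagged vector of length one, tested on the constant 1; stationarity
moves time 1 to time 0. -/
theorem tendsto_tail_ratio {u : ℝ} (hu : 0 < u) :
    Tendsto (fun x : ℝ => P.real {ω | u * x < ‖X 0 ω‖} / P.real {ω | x < ‖X 0 ω‖}) atTop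
      (𝓝 (u ^ (-α))) := by
  obtain ⟨σ, hσ, -, h⟩ := S.regVar 1 le_rfl
  have h1 := h u hu (BoundedContinuousFunction.const _ 1)
  have hnorm : ∀ ω, ‖laggedVector X 1 ω‖ = ‖X 1 ω‖ := fun ω => by
    rw [PiLp.norm_eq_of_L2]
    simp [laggedVector]
  simp only [hnorm, BoundedContinuousFunction.const_apply, integral_const, smul_eq_mul, mul_one,
    measureReal_restrict_apply_univ, probReal_univ] at h1
  simpa only [measureReal_def, S.measure_norm_shift _ 1] using h1

/-- At u = 1 the ratio tends to 1, whereas a vanishing tail would make it 0/0 = 0. -/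
theorem tail_pos (x : ℝ) : 0 < P.real {ω | x < ‖X 0 ω‖} := by
  have h := S.tendsto_tail_ratio one_pos
  rw [Real.one_rpow] at h
  obtain ⟨y, hy, hxy⟩ := ((h.eventually (lt_mem_nhds one_half_lt_one)).and
    (eventually_ge_atTop x)).exists
  have hpos : 0 < P.real {ω | y < ‖X 0 ω‖} := by
    by_contra hc
    have h0 : P.real {ω | y < ‖X 0 ω‖} = 0 := le_antisymm (not_lt.1 hc) measureReal_nonneg
    rw [h0, div_zero] at hy
    norm_num at hy
  exact hpos.trans_le (measureReal_mono fun ω hω => lt_of_le_of_lt hxy hω)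

/-- Before the limit, X_0/‖X_0‖ has norm one exactly, so the bounded continuous function min(1,
|‖w_0‖ - 1|) has integral 0 at every level x ≥ 0, hence also in the limit. -/
theorem ae_norm_zero : ∀ᵐ ω ∂P', ‖Θ 0 ω‖ = 1 := by
  let f : (Finset.Icc (-((0 : ℕ) : ℤ)) (0 : ℕ) → E d) →ᵇ ℝ :=
    BoundedContinuousFunction.ofNormedAddCommGroup
      (fun w => min 1 |‖w ⟨0, by simp⟩‖ - 1|) (by fun_prop) 1 fun w => by
        rw [Real.norm_eq_abs, abs_of_nonneg (le_min zero_le_one (abs_nonneg _))]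
        exact min_le_left _ _
  have h := S.spectral 0 f
  have hz : ∀ x : ℝ, 0 ≤ x → ∫ ω, f (fun t => ‖X 0 ω‖⁻¹ • X t ω)
      ∂(ProbabilityTheory.cond P {ω | x < ‖X 0 ω‖}) = 0 := by
    intro x hx
    refine integral_eq_zero_of_ae ?_
    have : ∀ᵐ ω ∂(ProbabilityTheory.cond P {ω | x < ‖X 0 ω‖}), x < ‖X 0 ω‖ :=
      ProbabilityTheory.ae_cond_mem (S.measurableSet_norm x 0)
    filter_upwards [this] with ω hω
    have hne : ‖X 0 ω‖ ≠ 0 := (hx.trans_lt hω).ne'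
    change min 1 |‖‖X 0 ω‖⁻¹ • X 0 ω‖ - 1| = 0
    rw [norm_smul, norm_inv, norm_norm, inv_mul_cancel₀ hne]
    simp
  have h0 : ∫ ω, f (fun t => Θ t ω) ∂P' = 0 := by
    refine tendsto_nhds_unique h (tendsto_const_nhds.congr' ?_)
    filter_upwards [eventually_ge_atTop 0] with x hx using (hz x hx).symm
  have hfm : Measurable fun ω => f (fun t => Θ t ω) :=
    f.continuous.measurable.comp (measurable_pi_lambda _ fun t => S.measurable_Θ t)
  have hnn : ∀ w, 0 ≤ f w := fun w => le_min zero_le_one (abs_nonneg _)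
  rw [integral_eq_zero_iff_of_nonneg (fun _ => hnn _)
    (Integrable.of_bound hfm.aestronglyMeasurable ‖f‖ (.of_forall fun _ => f.norm_coe_le_norm _))]
    at h0
  filter_upwards [h0] with ω hω
  have hω' : min 1 |‖Θ 0 ω‖ - 1| = 0 := hω
  rcases min_choice 1 |‖Θ 0 ω‖ - 1| with h | h
  · rw [h] at hω'; norm_num at hω'
  · rw [h, abs_eq_zero] at hω'; linarith

/-- Asymptotic independence of size and shape: the conditional expectation given ‖X_0‖ > vr has a
limit free of v, and the probability of the condition contributes the factor v^(-α). -/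
theorem tendsto_slice {v : ℝ} (hv : 0 < v) {k : ℕ}
    (f : (Finset.Icc (-(k : ℤ)) k → E d) →ᵇ ℝ) :
    Tendsto (fun r : ℝ => (∫ ω in {ω | v * r < ‖X 0 ω‖}, f (fun t => ‖X 0 ω‖⁻¹ • X t ω) ∂P) /
      P.real {ω | r < ‖X 0 ω‖}) atTop (𝓝 (v ^ (-α) * ∫ ω, f (fun t => Θ t ω) ∂P')) := by
  have h1 := (S.spectral k f).comp (tendsto_id.const_mul_atTop hv)
  refine ((S.tendsto_tail_ratio hv).mul h1).congr fun r => ?_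
  simp only [Function.comp, id, ProbabilityTheory.cond, integral_smul_measure, ENNReal.toReal_inv,
    smul_eq_mul]
  have := (S.tail_pos (v * r)).ne'
  simp only [measureReal_def] at this ⊢
  field_simp

/-- Regular variation towards the tail measure. -/
theorem tendsto_tailMeasure {F : (ℤ → E d) → ℝ} (hF : Continuous F) {B : ℝ} (hB : ∀ x, |F x| ≤ B)
    {k : ℕ} (hk : DependsOn F (Set.Icc (-(k : ℤ)) k)) {u : ℝ} (hu : 0 < u) :
    Tendsto (fun r : ℝ => (∫ ω in {ω | u * r < ‖X 0 ω‖}, F (fun t => r⁻¹ • X t ω) ∂P) /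
      P.real {ω | r < ‖X 0 ω‖}) atTop
      (𝓝 (∫ x in {x | u < ‖x 0‖}, F x ∂tailMeasure P' Θ α)) := by
  -- F only sees the coordinates in I, so it can be read on the finite-dimensional, hence proper,
  -- space of paths on I, extended by 0.
  set I := Finset.Icc (-(k : ℤ)) k
  let ext : (I → E d) → ℤ → E d := fun w t => if h : t ∈ I then w ⟨t, h⟩ else 0
  have hext : Continuous ext := by
    refine continuous_pi fun t => ?_
    by_cases h : t ∈ I
    · simp only [ext, h, dif_pos]; fun_prop
    · simp only [ext, h, dif_neg, not_false_eq_true]; fun_prop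
  have hFext : ∀ (x : ℤ → E d), F (ext fun t => x t) = F x := fun x => hk fun t ht => by
    have : t ∈ I := by simpa [I] using ht
    simp only [ext, this, dif_pos]
  let G : ℝ × (I → E d) → ℝ := fun p => F (ext (p.1 • p.2))
  have hG : Continuous G := hF.comp (hext.comp (by fun_prop))
  have hGF : ∀ (y : ℝ) (x : ℤ → E d), G (y, fun t => x t) = F (fun t => y • x t) := fun y x =>
    hFext fun t => y • x t
  -- Polar decomposition of X/r into the radius ‖X_0‖/r and the shape X/‖X_0‖; F becomes the
  -- function G of both, and slices in the radius are governed by `tendsto_slice`.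
  let Z : ℝ → Ω → ℝ × (I → E d) := fun r ω => (‖X 0 ω‖ / r, fun t => ‖X 0 ω‖⁻¹ • X t ω)
  have hXm := S.measurable_X
  have hΘm := S.measurable_Θ
  have hZ : ∀ r, Measurable (Z r) := fun r => by
    refine Measurable.prodMk (by fun_prop) ?_
    exact measurable_pi_lambda _ fun t => by fun_prop
  let T : ℝ × Ω' → ℝ × (I → E d) := Prod.map id fun ω t => Θ t ω
  have hTm : Measurable fun (ω : Ω') (t : I) => Θ t ω := measurable_pi_lambda _ fun t => hΘm t
  have hT : Measurable T := measurable_id.prodMap hTm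
  have hset : ∀ v : ℝ, MeasurableSet {p : ℝ × (I → E d) | v < p.1} := fun v =>
    measurableSet_lt measurable_const measurable_fst
  let m : ℝ → Measure (ℝ × (I → E d)) := fun r =>
    ENNReal.ofReal (P.real {ω | r < ‖X 0 ω‖})⁻¹ • P.map (Z r)
  have hm : ∀ (f : ℝ × (I → E d) → ℝ), Measurable f → ∀ v r : ℝ, 0 < r →
      ∫ p in {p | v < p.1}, f p ∂(m r) =
        (∫ ω in {ω | v * r < ‖X 0 ω‖}, f (Z r ω) ∂P) / P.real {ω | r < ‖X 0 ω‖} := by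
    intro f hf v r hr
    simp only [m]
    rw [Measure.restrict_smul, integral_smul_measure, Measure.restrict_map (hZ r) (hset v),
      integral_map (hZ r).aemeasurable hf.aestronglyMeasurable, smul_eq_mul, ENNReal.toReal_ofReal
      (inv_nonneg.2 measureReal_nonneg), div_eq_inv_mul]
    have : Z r ⁻¹' {p | v < p.1} = {ω | v * r < ‖X 0 ω‖} := by
      ext ω; simp [Z, lt_div_iff₀ hr]
    rw [this]
  have hprod : ((radialMeasure α).prod P').map T =
      (radialMeasure α).prod (P'.map fun ω (t : I) => Θ t ω) := by
    simp only [T]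
    rw [← Measure.map_prod_map _ _ measurable_id hTm, Measure.map_id]
  have : IsProbabilityMeasure (P'.map fun ω (t : I) => Θ t ω) :=
    Measure.isProbabilityMeasure_map hTm.aemeasurable
  have hsets : ∀ v : ℝ, {p : ℝ × (I → E d) | v < p.1} = Set.Ioi v ×ˢ Set.univ := fun v => by
    ext p; simp
  have hmfin : ∀ r, IsFiniteMeasure (m r) := fun r =>
    ⟨by simp only [m, Measure.smul_apply, smul_eq_mul]
        exact ENNReal.mul_lt_top ENNReal.ofReal_lt_top (measure_lt_top _ _)⟩
  have key := tendsto_integral_slice (l := atTop) (m := m) (m₀ := ((radialMeasure α).prod P').map T)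
    (fun r v hv => measure_ne_top _ _)
    (fun v hv => by
      rw [hprod, hsets, Measure.prod_prod, radialMeasure_Ioi S.index_pos hv]
      simp)
    (fun v hv f => ?_) hG (B := B) (fun p => hB _) hu
  · have e1 : ∫ p in {p | u < p.1}, G p ∂((radialMeasure α).prod P').map T =
        ∫ x in {x | u < ‖x 0‖}, F x ∂tailMeasure P' Θ α := by
      have hm' : Measurable fun (p : ℝ × Ω') (t : ℤ) => p.1 • Θ t p.2 := by fun_prop
      unfold tailMeasure
      rw [Measure.restrict_map hT (hset u), integral_map hT.aemeasurable
        hG.measurable.aestronglyMeasurable, Measure.restrict_map hm' (measurableSet_lt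
        measurable_const (by fun_prop)), integral_map hm'.aemeasurable
        hF.measurable.aestronglyMeasurable]
      -- Since ‖Θ_0‖ = 1 almost surely, the radius y is the norm of the path yΘ at time 0.
      have hs : (T ⁻¹' {p | u < p.1}) =ᵐ[(radialMeasure α).prod P']
          (fun (p : ℝ × Ω') (t : ℤ) => p.1 • Θ t p.2) ⁻¹' {x | u < ‖x 0‖} := by
        have h1 : ∀ᵐ p ∂(radialMeasure α).prod P', ‖Θ 0 p.2‖ = 1 :=
          Measure.quasiMeasurePreserving_snd.ae S.ae_norm_zero
        have h2 : ∀ᵐ p ∂(radialMeasure α).prod P', 0 < p.1 :=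
          Measure.quasiMeasurePreserving_fst.ae (radialMeasure_ae_pos α)
        filter_upwards [h1, h2] with p hp1 hp2
        refine propext ?_
        change u < p.1 ↔ u < ‖p.1 • Θ 0 p.2‖
        rw [norm_smul, hp1, mul_one, Real.norm_of_nonneg hp2.le]
      rw [Measure.restrict_congr_set hs]
      exact integral_congr_ae (.of_forall fun p => hGF p.1 fun t => Θ t p.2)
    rw [e1] at key
    refine key.congr' ?_
    filter_upwards [eventually_gt_atTop 0] with r hr
    rw [hm G hG.measurable u r hr]
    congr 1
    refine setIntegral_congr_fun (S.measurableSet_norm _ 0) fun ω hω => ?_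
    have hpos : 0 < ‖X 0 ω‖ := lt_trans (by positivity) hω
    change G (‖X 0 ω‖ / r, fun t : I => ‖X 0 ω‖⁻¹ • X t ω) = _
    rw [hGF _ fun t => ‖X 0 ω‖⁻¹ • X t ω]
    congr 1
    ext1 t
    rw [smul_smul]
    congr 1
    field_simp
  · have e2 : ∫ p in {p : ℝ × (I → E d) | v < p.1}, f p.2 ∂((radialMeasure α).prod P').map T =
        v ^ (-α) * ∫ ω, f (fun t => Θ t ω) ∂P' := by
      rw [hprod, hsets, ← Measure.prod_restrict, Measure.restrict_univ, integral_fun_snd,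
        integral_map hTm.aemeasurable f.continuous.measurable.aestronglyMeasurable,
        measureReal_restrict_apply_univ, measureReal_def, radialMeasure_Ioi S.index_pos hv,
        ENNReal.toReal_ofReal (by positivity), smul_eq_mul]
    rw [e2]
    refine (S.tendsto_slice hv f).congr' ?_
    filter_upwards [eventually_gt_atTop 0] with r hr
    exact (hm _ (f.continuous.measurable.comp measurable_snd) v r hr).symm

theorem tailMeasure_norm_zero {u : ℝ} (hu : 0 < u) :
    tailMeasure P' Θ α {x | u < ‖x 0‖} = ENNReal.ofReal (u ^ (-α)) := by
  rw [tailMeasure_apply S.measurable_Θ (measurableSet_lt measurable_const (by fun_prop))]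
  have : ∀ᵐ ω ∂P', radialMeasure α {y | (fun t => y • Θ t ω) ∈ {x : ℤ → E d | u < ‖x 0‖}} =
      ENNReal.ofReal (u ^ (-α)) := by
    filter_upwards [S.ae_norm_zero] with ω hω
    rw [← radialMeasure_Ioi S.index_pos hu]
    refine measure_congr ?_
    filter_upwards [radialMeasure_ae_pos α] with y hy
    refine propext ?_
    change u < ‖y • Θ 0 ω‖ ↔ u < y
    rw [norm_smul, hω, mul_one, Real.norm_of_nonneg hy.le]
  rw [lintegral_congr_ae this]
  simp

theorem ae_zero_ne : ∀ᵐ x ∂tailMeasure P' Θ α, x 0 ≠ 0 := by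
  have hm : Measurable fun (p : ℝ × Ω') (t : ℤ) => p.1 • Θ t p.2 := by
    have := S.measurable_Θ; fun_prop
  unfold tailMeasure
  refine (ae_map_iff hm.aemeasurable (p := fun x : ℤ → E d => x 0 ≠ 0)
    (measurableSet_eq_fun (by fun_prop) measurable_const).compl).2 ?_
  have h1 : ∀ᵐ p ∂(radialMeasure α).prod P', ‖Θ 0 p.2‖ = 1 :=
    Measure.quasiMeasurePreserving_snd.ae S.ae_norm_zero
  have h2 : ∀ᵐ p ∂(radialMeasure α).prod P', 0 < p.1 :=
    Measure.quasiMeasurePreserving_fst.ae (radialMeasure_ae_pos α)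
  filter_upwards [h1, h2] with p hp1 hp2
  exact smul_ne_zero hp2.ne' fun h => by rw [h, norm_zero] at hp1; exact zero_ne_one hp1

end SpectralSetup

end Setup

end HeavyTail

namespace HeavyTail

/-! ### Shift invariance of the tail measure -/

/-- The shifted path. -/
def shift {d : ℕ} (t : ℤ) (x : ℤ → E d) : ℤ → E d := fun s => x (s + t)

@[simp] theorem shift_apply {d : ℕ} (t : ℤ) (x : ℤ → E d) (s : ℤ) : shift t x s = x (s + t) := rfl

@[fun_prop] theorem measurable_shift {d : ℕ} (t : ℤ) : Measurable (shift (d := d) t) :=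
  measurable_pi_lambda _ fun s => measurable_pi_apply (s + t)

theorem continuous_shift {d : ℕ} (t : ℤ) : Continuous (shift (d := d) t) :=
  continuous_pi fun s => continuous_apply (s + t)

theorem shift_shift {d : ℕ} (s t : ℤ) (x : ℤ → E d) : shift s (shift t x) = shift (s + t) x := by
  ext1 r; simp [add_assoc]

theorem shift_zero {d : ℕ} (x : ℤ → E d) : shift 0 x = x := by
  ext1 r; simp

/-- The piecewise linear ramp from `0` at `a` to `1` at `b`. -/
noncomputable def ramp (a b s : ℝ) : ℝ := max 0 (min 1 ((s - a) / (b - a)))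

theorem ramp_nonneg (a b s : ℝ) : 0 ≤ ramp a b s := le_max_left _ _

theorem ramp_le_one (a b s : ℝ) : ramp a b s ≤ 1 := max_le zero_le_one (min_le_left _ _)

theorem ramp_eq_zero {a b s : ℝ} (hab : a < b) (h : s ≤ a) : ramp a b s = 0 :=
  max_eq_left ((min_le_right _ _).trans (div_nonpos_of_nonpos_of_nonneg (by linarith)
    (by linarith)))

theorem ramp_eq_one {a b s : ℝ} (hab : a < b) (h : b ≤ s) : ramp a b s = 1 := by
  unfold ramp
  rw [min_eq_left ((one_le_div (by linarith)).2 (by linarith)), max_eq_right zero_le_one]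

@[fun_prop] theorem continuous_ramp (a b : ℝ) : Continuous (ramp a b) := by
  unfold ramp; fun_prop

@[fun_prop] theorem measurable_ramp (a b : ℝ) : Measurable (ramp a b) :=
  (continuous_ramp a b).measurable

namespace SpectralSetup

set_option linter.unusedSectionVars false

variable {Ω Ω' : Type*} [MeasurableSpace Ω] [MeasurableSpace Ω'] {P : Measure Ω} {P' : Measure Ω'}
  {d : ℕ} {X : ℤ → Ω → E d} {Θ : ℤ → Ω' → E d} {α : ℝ}
  [IsProbabilityMeasure P] [IsProbabilityMeasure P'] (S : SpectralSetup P P' X Θ α)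
include S

theorem tendsto_tailMeasure_of_vanish {F : (ℤ → E d) → ℝ} (hF : Continuous F) {B : ℝ}
    (hB : ∀ x, |F x| ≤ B) {k : ℕ} (hk : DependsOn F (Set.Icc (-(k : ℤ)) k)) {u : ℝ} (hu : 0 < u)
    (hF0 : ∀ x, ‖x 0‖ ≤ u → F x = 0) :
    Tendsto (fun r : ℝ => (∫ ω, F (fun t => r⁻¹ • X t ω) ∂P) / P.real {ω | r < ‖X 0 ω‖}) atTop
      (𝓝 (∫ x, F x ∂tailMeasure P' Θ α)) := by
  have h := S.tendsto_tailMeasure hF hB hk hu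
  rw [setIntegral_eq_integral_of_forall_compl_eq_zero (s := {x : ℤ → E d | u < ‖x 0‖})
    fun x hx => hF0 x (not_lt.1 hx)] at h
  refine h.congr' ?_
  filter_upwards [eventually_gt_atTop 0] with r hr
  rw [setIntegral_eq_integral_of_forall_compl_eq_zero (s := {ω | u * r < ‖X 0 ω‖})]
  intro ω hω
  refine hF0 _ ?_
  rw [norm_smul, norm_inv, Real.norm_of_nonneg hr.le, inv_mul_le_iff₀ hr, mul_comm]
  exact not_lt.1 hω

/-- The product of ramps used as a density, living on paths that are large at times `s` and `t`. -/
theorem map_shift_withDensity (t : ℤ) {u : ℝ} (hu : 0 < u) :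
    ((tailMeasure P' Θ α).withDensity fun x =>
        ENNReal.ofReal (ramp u (2 * u) ‖x 0‖ * ramp u (2 * u) ‖x t‖)).map (shift t) =
      (tailMeasure P' Θ α).withDensity fun x =>
        ENNReal.ofReal (ramp u (2 * u) ‖x (-t)‖ * ramp u (2 * u) ‖x 0‖) := by
  set ν := tailMeasure P' Θ α
  have hu2 : u < 2 * u := by linarith
  have hprod0 : ∀ a b : ℝ, 0 ≤ ramp u (2 * u) a * ramp u (2 * u) b := fun a b =>
    mul_nonneg (ramp_nonneg _ _ _) (ramp_nonneg _ _ _)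
  have hprod1 : ∀ a b : ℝ, ramp u (2 * u) a * ramp u (2 * u) b ≤ 1 := fun a b =>
    mul_le_one₀ (ramp_le_one _ _ _) (ramp_nonneg _ _ _) (ramp_le_one _ _ _)
  have hmA : Measurable fun x : ℤ → E d =>
      ENNReal.ofReal (ramp u (2 * u) ‖x 0‖ * ramp u (2 * u) ‖x t‖) := by fun_prop
  have hmB : Measurable fun x : ℤ → E d =>
      ENNReal.ofReal (ramp u (2 * u) ‖x (-t)‖ * ramp u (2 * u) ‖x 0‖) := by fun_prop
  have hfin : ∀ w : (ℤ → E d) → ℝ, (∀ x, w x ≤ 1) → (∀ x, ‖x 0‖ ≤ u → w x = 0) →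
      IsFiniteMeasure (ν.withDensity fun x => ENNReal.ofReal (w x)) := by
    intro w h1 h0
    refine isFiniteMeasure_withDensity (ne_top_of_le_ne_top ?_ (lintegral_mono
      (g := ({x | u < ‖x 0‖} : Set (ℤ → E d)).indicator 1) fun x => ?_))
    · rw [lintegral_indicator_one (measurableSet_lt measurable_const (by fun_prop)),
        S.tailMeasure_norm_zero hu]
      exact ENNReal.ofReal_ne_top
    · by_cases hx : u < ‖x 0‖
      · rw [Set.indicator_of_mem (s := {x : ℤ → E d | u < ‖x 0‖}) hx]
        simpa using ENNReal.ofReal_le_ofReal (h1 x)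
      · rw [h0 x (not_lt.1 hx)]
        simp
  have hfA := hfin (fun x => ramp u (2 * u) ‖x 0‖ * ramp u (2 * u) ‖x t‖)
    (fun x => hprod1 _ _) fun x hx => by rw [ramp_eq_zero hu2 hx, zero_mul]
  have hfB := hfin (fun x => ramp u (2 * u) ‖x (-t)‖ * ramp u (2 * u) ‖x 0‖)
    (fun x => hprod1 _ _) fun x hx => by rw [ramp_eq_zero hu2 hx, mul_zero]
  -- Both sides are finite measures on a product space, so it suffices to compare finite-dimensional
  -- marginals, and these through bounded continuous functions.
  refine IsProjectiveLimit.unique (P := fun I : Finset ℤ => (ν.withDensity fun x =>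
        ENNReal.ofReal (ramp u (2 * u) ‖x (-t)‖ * ramp u (2 * u) ‖x 0‖)).map I.restrict)
        (fun I => ?_) fun I => rfl
  refine ext_of_forall_integral_eq_of_IsFiniteMeasure fun f => ?_
  have hr : Measurable (I.restrict : (ℤ → E d) → I → E d) := by
    exact measurable_pi_lambda _ fun i => measurable_pi_apply (i : ℤ)
  have hrc : Continuous (I.restrict : (ℤ → E d) → I → E d) :=
    continuous_pi fun i => continuous_apply (i : ℤ)
  rw [Measure.map_map hr (measurable_shift t),
    integral_map (hr.comp (measurable_shift t)).aemeasurable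
      f.continuous.measurable.aestronglyMeasurable,
    integral_map hr.aemeasurable f.continuous.measurable.aestronglyMeasurable,
    integral_withDensity_eq_integral_toReal_smul hmA (.of_forall fun _ => ENNReal.ofReal_lt_top),
    integral_withDensity_eq_integral_toReal_smul hmB (.of_forall fun _ => ENNReal.ofReal_lt_top)]
  simp only [ENNReal.toReal_ofReal (hprod0 _ _), smul_eq_mul]
  obtain ⟨K, hK⟩ : ∃ K : ℕ, ∀ i ∈ I, i.natAbs ≤ K := ⟨I.sup Int.natAbs, fun i hi =>
    Finset.le_sup (f := Int.natAbs) hi⟩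
  set G : (ℤ → E d) → ℝ := fun x =>
    ramp u (2 * u) ‖x (-t)‖ * ramp u (2 * u) ‖x 0‖ * f (I.restrict x)
  have hG : Continuous G := by
    have := f.continuous
    fun_prop
  have hGB : ∀ x, |G x| ≤ ‖f‖ := fun x => by
    simp only [G]
    rw [abs_mul, abs_of_nonneg (hprod0 _ _)]
    calc _ ≤ 1 * ‖f‖ := mul_le_mul (hprod1 _ _) (f.norm_coe_le_norm _) (abs_nonneg _) zero_le_one
      _ = _ := one_mul _
  have hGshift : ∀ x : ℤ → E d, ramp u (2 * u) ‖x 0‖ * ramp u (2 * u) ‖x t‖ *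
      f ((I.restrict ∘ shift t) x) = G (shift t x) := fun x => by
    simp [G]
  simp only [hGshift]
  have hdep : DependsOn G (Set.Icc (-((K + t.natAbs : ℕ) : ℤ)) (K + t.natAbs : ℕ)) := by
    intro x y hxy
    have hI : I.restrict x = I.restrict y := by
      ext1 i
      exact hxy i (by have := hK i i.2; constructor <;> omega)
    simp only [G, hI, hxy (-t) (by constructor <;> omega), hxy 0 (by constructor <;> omega)]
  have hdep' : DependsOn (fun x => G (shift t x))
      (Set.Icc (-((K + t.natAbs : ℕ) : ℤ)) (K + t.natAbs : ℕ)) := by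
    intro x y hxy
    have hI : I.restrict (shift t x) = I.restrict (shift t y) := by
      ext1 i
      exact hxy _ (by have := hK i i.2; constructor <;> omega)
    simp only [← hGshift, Function.comp, hI, hxy t (by constructor <;> omega),
      hxy 0 (by constructor <;> omega)]
  -- The two ramps make both G and its shift vanish when ‖x_0‖ ≤ u, so regular variation towards ν
  -- applies to each of them.
  have l1 := S.tendsto_tailMeasure_of_vanish hG hGB hdep hu fun x hx => by
    simp only [G]; rw [ramp_eq_zero hu2 hx]; simp
  have l2 := S.tendsto_tailMeasure_of_vanish (hG.comp (continuous_shift t)) (fun x => hGB _) hdep'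
    hu fun x hx => by simp [G, ramp_eq_zero hu2 hx]
  clear_value G
  -- By stationarity the two expectations agree at every level r, so the limits agree.
  have e : ∀ r : ℝ, ∫ ω, G (fun s => r⁻¹ • X s ω) ∂P =
      ∫ ω, (G ∘ shift t) (fun s => r⁻¹ • X s ω) ∂P := fun r => by
    have hm : Measurable fun x : ℤ → E d => G fun s => r⁻¹ • x s :=
      hG.measurable.comp (by fun_prop)
    have h := S.integral_shift hm t
    exact h.symm
  simp only [e] at l1
  exact tendsto_nhds_unique l2 l1

/-- The mass transport formula. -/
theorem lintegral_shift (t : ℤ) {F : (ℤ → E d) → ℝ≥0∞} (hF : Measurable F) :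
    ∫⁻ x in {x | x t ≠ 0}, F (shift t x) ∂tailMeasure P' Θ α =
      ∫⁻ x in {x | x (-t) ≠ 0}, F x ∂tailMeasure P' Θ α := by
  set ν := tailMeasure P' Θ α
  have hnz : ∀ s : ℤ, MeasurableSet {x : ℤ → E d | x s ≠ 0} := fun s =>
    (measurableSet_eq_fun (by fun_prop) measurable_const).compl
  -- Both ramps equal 1 on paths larger than 2u at the two times, so the density disappears after
  -- restriction to them.
  have key : ∀ u : ℝ, 0 < u → ∫⁻ x in {x | 2 * u < ‖x 0‖ ∧ 2 * u < ‖x t‖}, F (shift t x) ∂ν =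
      ∫⁻ x in {x | 2 * u < ‖x 0‖ ∧ 2 * u < ‖x (-t)‖}, F x ∂ν := by
    intro u hu
    have hu2 : u < 2 * u := by linarith
    have hs1 : ∀ t : ℤ, MeasurableSet {x : ℤ → E d | 2 * u < ‖x t‖} := fun t =>
      measurableSet_lt measurable_const (by fun_prop)
    have hs : ∀ t : ℤ, MeasurableSet {x : ℤ → E d | 2 * u < ‖x 0‖ ∧ 2 * u < ‖x t‖} := fun t =>
      (hs1 0).inter (hs1 t)
    have h := congrArg (fun m => ∫⁻ x in {x | 2 * u < ‖x 0‖ ∧ 2 * u < ‖x (-t)‖}, F x ∂m)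
      (S.map_shift_withDensity t hu)
    rw [← lintegral_indicator (hs _), ← lintegral_indicator (hs _),
      lintegral_map (hF.indicator (hs _)) (measurable_shift t)] at h
    have hA := lintegral_withDensity_eq_lintegral_mul ν (f := fun x : ℤ → E d =>
      ENNReal.ofReal (ramp u (2 * u) ‖x 0‖ * ramp u (2 * u) ‖x t‖)) (by fun_prop)
      ((hF.indicator (hs (-t))).comp (measurable_shift t))
    have hB := lintegral_withDensity_eq_lintegral_mul ν (f := fun x : ℤ → E d =>
      ENNReal.ofReal (ramp u (2 * u) ‖x (-t)‖ * ramp u (2 * u) ‖x 0‖)) (by fun_prop)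
      (hF.indicator (hs (-t)))
    have h := hA.symm.trans (h.trans hB)
    rw [← lintegral_indicator (hs _), ← lintegral_indicator (hs _)]
    refine Eq.trans (lintegral_congr fun x => ?_) (h.trans (lintegral_congr fun x => ?_))
    · simp only [Pi.mul_apply, Function.comp, Set.indicator_apply, Set.mem_ofPred_eq, shift_apply,
        zero_add, neg_add_cancel]
      by_cases hx : 2 * u < ‖x 0‖ ∧ 2 * u < ‖x t‖
      · rw [if_pos hx, if_pos hx.symm, ramp_eq_one hu2 hx.1.le, ramp_eq_one hu2 hx.2.le]
        simp
      · rw [if_neg hx, if_neg (fun h => hx h.symm), mul_zero]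
    · simp only [Pi.mul_apply, Set.indicator_apply, Set.mem_ofPred_eq]
      by_cases hx : 2 * u < ‖x 0‖ ∧ 2 * u < ‖x (-t)‖
      · rw [if_pos hx, ramp_eq_one hu2 hx.1.le, ramp_eq_one hu2 hx.2.le]
        simp
      · rw [if_neg hx, mul_zero]
  -- Because x_0 ≠ 0 almost everywhere, letting u decrease to 0 exhausts the paths with x_s ≠ 0.
  have hsets : ∀ s : ℤ, {x : ℤ → E d | x s ≠ 0} =ᵐ[ν] ⋃ n : ℕ,
      {x | 2 * (1 / (n + 1 : ℝ)) < ‖x 0‖ ∧ 2 * (1 / (n + 1 : ℝ)) < ‖x s‖} := by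
    intro s
    filter_upwards [S.ae_zero_ne] with x hx
    refine propext ?_
    change x s ≠ 0 ↔ x ∈ ⋃ n : ℕ, {x | 2 * (1 / (n + 1 : ℝ)) < ‖x 0‖ ∧
      2 * (1 / (n + 1 : ℝ)) < ‖x s‖}
    simp only [Set.mem_iUnion, Set.mem_ofPred_eq]
    constructor
    · intro hs
      have h0 : 0 < min ‖x 0‖ ‖x s‖ / 2 := half_pos (lt_min (norm_pos_iff.2 hx) (norm_pos_iff.2 hs))
      obtain ⟨n, hn⟩ := exists_nat_one_div_lt h0
      exact ⟨n, by linarith [min_le_left ‖x 0‖ ‖x s‖], by linarith [min_le_right ‖x 0‖ ‖x s‖]⟩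
    · rintro ⟨n, -, h2⟩
      exact norm_pos_iff.1 (lt_trans (by positivity) h2)
  have hdir : ∀ s : ℤ, Directed (· ⊆ ·) fun n : ℕ => {x : ℤ → E d |
      2 * (1 / (n + 1 : ℝ)) < ‖x 0‖ ∧ 2 * (1 / (n + 1 : ℝ)) < ‖x s‖} := by
    intro s
    refine Monotone.directed_le fun n m hnm x hx => ?_
    have : 1 / (m + 1 : ℝ) ≤ 1 / (n + 1 : ℝ) := one_div_le_one_div_of_le (by positivity)
      (by have : (n : ℝ) ≤ m := by exact_mod_cast hnm
          linarith)
    exact ⟨by linarith [hx.1], by linarith [hx.2]⟩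
  rw [Measure.restrict_congr_set (hsets t), Measure.restrict_congr_set (hsets (-t)),
    setLIntegral_iUnion_of_directed _ (hdir t), setLIntegral_iUnion_of_directed _ (hdir (-t))]
  exact iSup_congr fun n => key _ (by positivity)

theorem measure_shift_set (t : ℤ) {A : Set (ℤ → E d)} (hA : MeasurableSet A) :
    tailMeasure P' Θ α {x | x t ≠ 0 ∧ shift t x ∈ A} =
      tailMeasure P' Θ α {x | x (-t) ≠ 0 ∧ x ∈ A} := by
  have h := S.lintegral_shift t (measurable_one.indicator hA)
  have hm : MeasurableSet {x : ℤ → E d | shift t x ∈ A} := measurable_shift t hA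
  have e1 : (fun x : ℤ → E d => A.indicator (1 : (ℤ → E d) → ℝ≥0∞) (shift t x)) =
    ({x | shift t x ∈ A} : Set _).indicator 1 := rfl
  rw [e1, lintegral_indicator_one hm, lintegral_indicator_one hA, Measure.restrict_apply hm,
    Measure.restrict_apply hA] at h
  rw [Set.inter_comm, Set.inter_comm A] at h
  exact h

end SpectralSetup

end HeavyTail

namespace HeavyTail

/-! ### Decay of the paths under the anti-clustering condition -/

/-- Anti-clustering along one sequence of levels, in quantified form. -/
def ClusterBound {Ω : Type*} [MeasurableSpace Ω] {d : ℕ} (P : Measure Ω) (X : ℤ → Ω → E d)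
    (xs : ℕ → ℝ) : Prop :=
  ∀ v : ℝ, 0 < v → ∀ η : ℝ, 0 < η → ∀ᶠ k : ℕ in atTop, ∀ᶠ n : ℕ in atTop,
    P.real {ω | v * xs n < ‖X 0 ω‖ ∧ ∃ i ∈ Finset.Icc (k : ℤ) n, v * xs n < ‖X i ω‖} ≤
      η * P.real {ω | xs n < ‖X 0 ω‖}

theorem measurableSet_forall {α ι : Type*} [MeasurableSpace α] [Countable ι] {p : ι → α → Prop}
    (h : ∀ i, MeasurableSet {a | p i a}) : MeasurableSet {a | ∀ i, p i a} := by
  have : {a | ∀ i, p i a} = ⋂ i, {a | p i a} := by ext; simp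
  rw [this]
  exact MeasurableSet.iInter h

theorem measurableSet_exists {α ι : Type*} [MeasurableSpace α] [Countable ι] {p : ι → α → Prop}
    (h : ∀ i, MeasurableSet {a | p i a}) : MeasurableSet {a | ∃ i, p i a} := by
  have : {a | ∃ i, p i a} = ⋃ i, {a | p i a} := by ext; simp
  rw [this]
  exact MeasurableSet.iUnion h

theorem measurableSet_lt_norm {d : ℕ} (v : ℝ) (t : ℤ) :
    MeasurableSet {x : ℤ → E d | v < ‖x t‖} :=
  measurableSet_lt measurable_const (by fun_prop)

/-- The paths whose last maximum (in norm) is attained at time `0`. -/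
def anchor (d : ℕ) : Set (ℤ → E d) :=
  {x | x 0 ≠ 0 ∧ (∀ t : ℤ, ‖x t‖ ≤ ‖x 0‖) ∧ ∀ t : ℤ, 0 < t → ‖x t‖ < ‖x 0‖}

theorem measurableSet_anchor (d : ℕ) : MeasurableSet (anchor d) := by
  refine (measurableSet_eq_fun (by fun_prop) measurable_const).compl.inter
    (MeasurableSet.inter ?_ ?_)
  · exact measurableSet_forall fun t => measurableSet_le (by fun_prop) (by fun_prop)
  · refine measurableSet_forall fun t => ?_
    by_cases ht : 0 < t
    · simp only [ht, true_imp_iff]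
      exact measurableSet_lt (by fun_prop) (by fun_prop)
    · simp only [ht, false_imp_iff]
      exact MeasurableSet.univ

theorem smul_mem_anchor {d : ℕ} {x : ℤ → E d} {c : ℝ} (hc : 0 < c) :
    (fun t => c • x t) ∈ anchor d ↔ x ∈ anchor d := by
  simp only [anchor, Set.mem_ofPred_eq, norm_smul, Real.norm_of_nonneg hc.le, ne_eq, smul_eq_zero,
    hc.ne', false_or, mul_le_mul_iff_right₀ hc, mul_lt_mul_iff_right₀ hc]

/-- Of two distinct last maxima the later one would strictly dominate itself: the earlier exceeds it
strictly and is at most as large. -/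
theorem anchor_unique {d : ℕ} {x : ℤ → E d} {s t : ℤ} (hs : shift s x ∈ anchor d)
    (ht : shift t x ∈ anchor d) : s = t := by
  obtain ⟨-, hs1, hs2⟩ := hs
  obtain ⟨-, ht1, ht2⟩ := ht
  rcases lt_trichotomy s t with h | h | h
  · have h1 := hs2 (t - s) (by omega)
    have h2 := ht1 (s - t)
    simp only [shift_apply, sub_add_cancel, zero_add] at h1 h2
    linarith
  · exact h
  · have h1 := ht2 (s - t) (by omega)
    have h2 := hs1 (t - s)
    simp only [shift_apply, sub_add_cancel, zero_add] at h1 h2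
    linarith

/-- Only finitely many times exceed half of ‖x_0‖, so the supremum is attained; it is attained
finitely often for the same reason, so there is a last time. -/
theorem exists_shift_mem_anchor {d : ℕ} {x : ℤ → E d} (h0 : x 0 ≠ 0)
    (hx : ∀ v : ℝ, 0 < v → {t : ℤ | v < ‖x t‖}.Finite) : ∃ t, shift t x ∈ anchor d := by
  have hpos : 0 < ‖x 0‖ := norm_pos_iff.2 h0
  have hfin := hx (‖x 0‖ / 2) (by positivity)
  obtain ⟨s, hs, hmax⟩ := Set.exists_max_image _ (fun t => ‖x t‖) hfin
    ⟨0, by simp only [Set.mem_ofPred_eq]; linarith⟩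
  have hle : ∀ t, ‖x t‖ ≤ ‖x s‖ := fun t => by
    by_cases ht : ‖x 0‖ / 2 < ‖x t‖
    · exact hmax t ht
    · exact (not_lt.1 ht).trans (le_of_lt hs)
  have hspos : 0 < ‖x s‖ := hpos.trans_le (hle 0)
  have hfin2 : {t : ℤ | ‖x t‖ = ‖x s‖}.Finite :=
    (hx (‖x s‖ / 2) (by positivity)).subset fun t ht => by
      simp only [Set.mem_ofPred_eq] at ht ⊢; linarith
  obtain ⟨m, hm, hmm⟩ := Set.exists_max_image _ id hfin2 ⟨s, rfl⟩
  simp only [Set.mem_ofPred_eq, id] at hm hmm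
  refine ⟨m, ?_, fun t => ?_, fun t ht => ?_⟩
  · simp only [shift_apply, zero_add]
    exact norm_pos_iff.1 (hm ▸ hspos)
  · simp only [shift_apply, zero_add, hm]
    exact hle _
  · simp only [shift_apply, zero_add, hm]
    refine lt_of_le_of_ne (hle _) fun h => ?_
    have := hmm _ h
    omega

namespace SpectralSetup

set_option linter.unusedSectionVars false

variable {Ω Ω' : Type*} [MeasurableSpace Ω] [MeasurableSpace Ω'] {P : Measure Ω} {P' : Measure Ω'}
  {d : ℕ} {X : ℤ → Ω → E d} {Θ : ℤ → Ω' → E d} {α : ℝ}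
  [IsProbabilityMeasure P] [IsProbabilityMeasure P'] (S : SpectralSetup P P' X Θ α)
include S

/-- Only one selection of levels matters from here on. The conditional probability becomes a joint
one, normalised by the tail at the level itself instead of at v times the level. -/
theorem clusterBound {Λ : ℕ → Set ℝ} (hAC : AntiClustering P X Λ) {xs : ℕ → ℝ}
    (hxs : ∀ n, 1 ≤ n → xs n ∈ Λ n) (hlim : Tendsto xs atTop atTop) : ClusterBound P X xs := by
  intro v hv η hη
  have hvα : 0 < v ^ (-α) + 1 := by positivity
  -- The tail ratio at v tends to v^(-α) and is therefore eventually below v^(-α) + 1.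
  set η' := η / (v ^ (-α) + 1)
  have hη' : 0 < η' := by positivity
  have h1 := (hAC v hv).eventually (gt_mem_nhds (ENNReal.ofReal_pos.2 hη'))
  filter_upwards [h1] with k hk
  have h2 := eventually_lt_of_limsup_lt hk
  have h3 := ((S.tendsto_tail_ratio hv).comp hlim).eventually
    (gt_mem_nhds (show v ^ (-α) < v ^ (-α) + 1 by linarith))
  filter_upwards [h2, h3, eventually_ge_atTop 1] with n hn hn3 hn1
  have hc : ProbabilityTheory.cond P {ω | xs n * v < ‖X 0 ω‖}
      {ω | ∃ i ∈ Finset.Icc (k : ℤ) n, xs n * v < ‖X i ω‖} ≤ ENNReal.ofReal η' :=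
    le_of_lt (lt_of_le_of_lt (le_iSup₂ (f := fun x (_ : x ∈ Λ n) =>
      ProbabilityTheory.cond P {ω | x * v < ‖X 0 ω‖}
        {ω | ∃ i ∈ Finset.Icc (k : ℤ) n, x * v < ‖X i ω‖}) (xs n) (hxs n hn1)) hn)
  have he := cond_mul_eq_inter (S.measurableSet_norm (xs n * v) 0)
    {ω | ∃ i ∈ Finset.Icc (k : ℤ) n, xs n * v < ‖X i ω‖} P
  have hle : P.real {ω | v * xs n < ‖X 0 ω‖ ∧ ∃ i ∈ Finset.Icc (k : ℤ) n, v * xs n < ‖X i ω‖} ≤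
      η' * P.real {ω | v * xs n < ‖X 0 ω‖} := by
    rw [mul_comm v]
    refine (ENNReal.toReal_mono (ENNReal.mul_ne_top ENNReal.ofReal_ne_top (measure_ne_top P _))
      (he.symm.le.trans (mul_le_mul_left hc _))).trans ?_
    rw [ENNReal.toReal_mul, ENNReal.toReal_ofReal hη'.le]
    exact le_rfl
  simp only [Function.comp] at hn3
  rw [div_lt_iff₀ (S.tail_pos _)] at hn3
  refine hle.trans ((mul_le_mul_of_nonneg_left hn3.le hη'.le).trans (le_of_eq ?_))
  simp only [η']
  field_simp

/-- Anti-clustering passed to the limit. Ramps from v to 2v replace the indicators, which costs a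
factor 2 in the level. The bound is uniform in m because the window [k, m] lies in [k, n] once n ≥
m. -/
theorem measure_forward_le {xs : ℕ → ℝ} (hlim : Tendsto xs atTop atTop) (hC : ClusterBound P X xs)
    {v η : ℝ} (hv : 0 < v) (hη : 0 < η) : ∃ k : ℕ, ∀ m : ℕ,
      tailMeasure P' Θ α {x | 2 * v < ‖x 0‖ ∧ ∃ i ∈ Finset.Icc (k : ℤ) m, 2 * v < ‖x i‖} ≤
        ENNReal.ofReal η := by
  obtain ⟨k, hk⟩ := (hC v hv η hη).exists
  refine ⟨k, fun m => ?_⟩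
  set ν := tailMeasure P' Θ α
  have hv2 : v < 2 * v := by linarith
  -- A continuous substitute for the indicator that the path is large at time 0 and at some time in
  -- the window.
  set F : (ℤ → E d) → ℝ := fun x => ramp v (2 * v) ‖x 0‖ *
    (1 - ∏ i ∈ Finset.Icc (k : ℤ) m, (1 - ramp v (2 * v) ‖x i‖)) with hFdef
  have hp0 : ∀ x : ℤ → E d, 0 ≤ ∏ i ∈ Finset.Icc (k : ℤ) m, (1 - ramp v (2 * v) ‖x i‖) := fun x =>
    Finset.prod_nonneg fun i _ => sub_nonneg.2 (ramp_le_one _ _ _)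
  have hp1 : ∀ x : ℤ → E d, ∏ i ∈ Finset.Icc (k : ℤ) m, (1 - ramp v (2 * v) ‖x i‖) ≤ 1 := fun x =>
    Finset.prod_le_one (fun i _ => sub_nonneg.2 (ramp_le_one _ _ _))
      fun i _ => sub_le_self _ (ramp_nonneg _ _ _)
  have hF0 : ∀ x, 0 ≤ F x := fun x => mul_nonneg (ramp_nonneg _ _ _) (sub_nonneg.2 (hp1 x))
  have hF1 : ∀ x, F x ≤ 1 := fun x =>
    mul_le_one₀ (ramp_le_one _ _ _) (sub_nonneg.2 (hp1 x)) (sub_le_self _ (hp0 x))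
  have hFc : Continuous F := by simp only [hFdef]; fun_prop
  have hFz : ∀ x, ¬ (v < ‖x 0‖ ∧ ∃ i ∈ Finset.Icc (k : ℤ) m, v < ‖x i‖) → F x = 0 := by
    intro x hx
    simp only [hFdef]
    by_cases h0 : v < ‖x 0‖
    · rw [Finset.prod_eq_one, sub_self, mul_zero]
      intro i hi
      rw [ramp_eq_zero hv2, sub_zero]
      by_contra hc
      exact hx ⟨h0, i, hi, not_le.1 hc⟩
    · rw [ramp_eq_zero hv2 (not_lt.1 h0), zero_mul]
  have hFo : ∀ x, 2 * v < ‖x 0‖ ∧ (∃ i ∈ Finset.Icc (k : ℤ) m, 2 * v < ‖x i‖) → F x = 1 := by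
    rintro x ⟨h0, i, hi, hxi⟩
    simp only [hFdef]
    rw [Finset.prod_eq_zero hi (by rw [ramp_eq_one hv2 hxi.le, sub_self]), ramp_eq_one hv2 h0.le]
    norm_num
  have hdep : DependsOn F (Set.Icc (-(m : ℤ)) m) := by
    intro x y hxy
    have h0 : ‖x 0‖ = ‖y 0‖ := by rw [hxy 0 (by constructor <;> omega)]
    have hprod : ∏ i ∈ Finset.Icc (k : ℤ) m, (1 - ramp v (2 * v) ‖x i‖) =
        ∏ i ∈ Finset.Icc (k : ℤ) m, (1 - ramp v (2 * v) ‖y i‖) :=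
      Finset.prod_congr rfl fun i hi => by
        rw [Finset.mem_Icc] at hi
        rw [show x i = y i from hxy i (by constructor <;> omega)]
    simp only [hFdef]
    rw [h0, hprod]
  clear_value F
  have hl := (S.tendsto_tailMeasure_of_vanish hFc (B := 1) (fun x => by
    rw [abs_of_nonneg (hF0 x)]; exact hF1 x) hdep hv fun x hx => hFz x fun h =>
      not_lt.2 hx h.1).comp hlim
  have hbound : ∫ x, F x ∂ν ≤ η := by
    refine le_of_tendsto hl ?_
    filter_upwards [hk, hlim.eventually_gt_atTop 0, eventually_ge_atTop m] with n hn hn0 hnm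
    simp only [Function.comp]
    rw [div_le_iff₀ (S.tail_pos _)]
    refine le_trans ?_ hn
    have hset : MeasurableSet {ω | v * xs n < ‖X 0 ω‖ ∧
        ∃ i ∈ Finset.Icc (k : ℤ) n, v * xs n < ‖X i ω‖} := by
      refine (S.measurableSet_norm _ 0).inter (measurableSet_exists fun i => ?_)
      by_cases hi : i ∈ Finset.Icc (k : ℤ) n
      · simp only [hi, true_and]; exact S.measurableSet_norm _ i
      · simp only [hi, false_and]; exact MeasurableSet.empty
    rw [← integral_indicator_one hset]
    refine integral_mono_of_nonneg (.of_forall fun ω => hF0 _)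
      ((integrable_const 1).indicator hset) (.of_forall fun ω => ?_)
    by_cases hω : ω ∈ {ω | v * xs n < ‖X 0 ω‖ ∧ ∃ i ∈ Finset.Icc (k : ℤ) n, v * xs n < ‖X i ω‖}
    · simp only [Set.indicator_of_mem hω]
      exact hF1 _
    · simp only [Set.indicator_of_notMem hω]
      refine (hFz _ fun h => hω ?_).le
      have hsc : ∀ i : ℤ, v < ‖(xs n)⁻¹ • X i ω‖ → v * xs n < ‖X i ω‖ := fun i hi => by
        rw [norm_smul, norm_inv, Real.norm_of_nonneg hn0.le, lt_inv_mul_iff₀ hn0] at hi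
        linarith
      obtain ⟨h0, i, hi, hxi⟩ := h
      rw [Finset.mem_Icc] at hi
      exact ⟨hsc 0 h0, i, Finset.mem_Icc.2 ⟨hi.1, hi.2.trans (by exact_mod_cast hnm)⟩, hsc i hxi⟩
  have hset : MeasurableSet {x : ℤ → E d | 2 * v < ‖x 0‖ ∧
      ∃ i ∈ Finset.Icc (k : ℤ) m, 2 * v < ‖x i‖} := by
    refine (measurableSet_lt_norm _ 0).inter (measurableSet_exists fun i => ?_)
    by_cases hi : i ∈ Finset.Icc (k : ℤ) m
    · simp only [hi, true_and]; exact measurableSet_lt_norm _ i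
    · simp only [hi, false_and]; exact MeasurableSet.empty
  have hint : Integrable F ν := by
    refine (integrable_indicator_iff (f := fun _ => (1 : ℝ)) (measurableSet_lt_norm v 0)).2
      (integrableOn_const (s := {x : ℤ → E d | v < ‖x 0‖}) (by
        rw [S.tailMeasure_norm_zero hv]; exact ENNReal.ofReal_ne_top)) |>.mono
      hFc.measurable.aestronglyMeasurable (.of_forall fun x => ?_)
    rw [Real.norm_of_nonneg (hF0 x)]
    by_cases hx : v < ‖x 0‖
    · rw [Set.indicator_of_mem (s := {x : ℤ → E d | v < ‖x 0‖}) hx]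
      simpa using hF1 x
    · rw [hFz x fun h => hx h.1]
      exact norm_nonneg _
  calc ν {x | 2 * v < ‖x 0‖ ∧ ∃ i ∈ Finset.Icc (k : ℤ) m, 2 * v < ‖x i‖}
      = ∫⁻ x, ({x : ℤ → E d | 2 * v < ‖x 0‖ ∧
          ∃ i ∈ Finset.Icc (k : ℤ) m, 2 * v < ‖x i‖}).indicator 1 x ∂ν :=
        (lintegral_indicator_one hset).symm
    _ ≤ ∫⁻ x, ENNReal.ofReal (F x) ∂ν := lintegral_mono fun x => by
        by_cases hx : x ∈ {x : ℤ → E d | 2 * v < ‖x 0‖ ∧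
          ∃ i ∈ Finset.Icc (k : ℤ) m, 2 * v < ‖x i‖}
        · rw [Set.indicator_of_mem hx, hFo x hx]; simp
        · rw [Set.indicator_of_notMem hx]; exact zero_le
    _ = ENNReal.ofReal (∫ x, F x ∂ν) :=
        (ofReal_integral_eq_lintegral_ofReal hint (.of_forall hF0)).symm
    _ ≤ _ := ENNReal.ofReal_le_ofReal hbound

/-- Infinitely many forward exceedances give one in [k, m] for some m, whatever k is; choosing k for
a given η bounds the mass by η. -/
theorem measure_forward_frequently {xs : ℕ → ℝ} (hlim : Tendsto xs atTop atTop)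
    (hC : ClusterBound P X xs) {v : ℝ} (hv : 0 < v) :
    tailMeasure P' Θ α {x | v < ‖x 0‖ ∧ ∃ᶠ i : ℕ in atTop, v < ‖x i‖} = 0 := by
  refine nonpos_iff_eq_zero.1 (ENNReal.le_of_forall_pos_le_add fun η hη _ => ?_)
  obtain ⟨k, hk⟩ := S.measure_forward_le hlim hC (half_pos hv) (NNReal.coe_pos.2 hη)
  have h2 : 2 * (v / 2) = v := by ring
  rw [h2] at hk
  rw [zero_add, ← ENNReal.ofReal_coe_nnreal]
  calc _ ≤ tailMeasure P' Θ α (⋃ m : ℕ, {x | v < ‖x 0‖ ∧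
        ∃ i ∈ Finset.Icc (k : ℤ) m, v < ‖x i‖}) := by
        refine measure_mono fun x hx => ?_
        obtain ⟨i, hi, hxi⟩ := (frequently_atTop.1 hx.2) k
        exact Set.mem_iUnion.2 ⟨i, hx.1, i, Finset.mem_Icc.2 ⟨by exact_mod_cast hi, le_rfl⟩, hxi⟩
    _ = ⨆ m : ℕ, tailMeasure P' Θ α {x | v < ‖x 0‖ ∧
        ∃ i ∈ Finset.Icc (k : ℤ) m, v < ‖x i‖} := by
        refine Monotone.measure_iUnion fun m m' hm x hx => ?_
        obtain ⟨h0, i, hi, hxi⟩ := hx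
        rw [Finset.mem_Icc] at hi
        exact ⟨h0, i, Finset.mem_Icc.2 ⟨hi.1, hi.2.trans (by exact_mod_cast hm)⟩, hxi⟩
    _ ≤ _ := iSup_le hk

/-- Anti-clustering only looks forward; the past is reached by mass transport. Let A be the paths
with last exceedance of v at time 0 and infinitely many earlier ones. The events that the shift by j
lies in A and ‖x_0‖ > v are disjoint in j, because the last exceedance is unique, so their masses
have a finite sum. Transport turns these masses into those of A with an exceedance at -j, and
Borel–Cantelli gives A mass 0. -/
theorem measure_backward_frequently {xs : ℕ → ℝ} (hlim : Tendsto xs atTop atTop)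
    (hC : ClusterBound P X xs) {v : ℝ} (hv : 0 < v) :
    tailMeasure P' Θ α {x | v < ‖x 0‖ ∧ ∃ᶠ i : ℕ in atTop, v < ‖x (-i)‖} = 0 := by
  set ν := tailMeasure P' Θ α
  set A : Set (ℤ → E d) := {x | v < ‖x 0‖ ∧ (∀ t : ℕ, ‖x (t + 1)‖ ≤ v) ∧
    ∃ᶠ i : ℕ in atTop, v < ‖x (-i)‖}
  have hA : MeasurableSet A := by
    have h1 : MeasurableSet {x : ℤ → E d | ∃ᶠ i : ℕ in atTop, v < ‖x (-i)‖} := by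
      simp only [frequently_atTop]
      refine measurableSet_forall fun a => measurableSet_exists fun b => ?_
      by_cases hb : a ≤ b
      · simp only [hb, true_and]; exact measurableSet_lt_norm _ _
      · simp only [hb, false_and]; exact MeasurableSet.empty
    have h2 : MeasurableSet {x : ℤ → E d | ∀ t : ℕ, ‖x (t + 1)‖ ≤ v} :=
      measurableSet_forall fun t => measurableSet_le (by fun_prop) measurable_const
    exact (measurableSet_lt_norm v 0).inter (h2.inter h1)
  have hB : ∀ j : ℕ, MeasurableSet {x : ℤ → E d | shift j x ∈ A ∧ v < ‖x 0‖} := fun j =>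
    (measurable_shift j hA).inter (measurableSet_lt_norm v 0)
  have hswap : ∀ j : ℕ, ν {x | shift j x ∈ A ∧ v < ‖x 0‖} = ν {x | x ∈ A ∧ v < ‖x (-j)‖} := by
    intro j
    have h := S.measure_shift_set j (hA.inter (measurableSet_lt_norm v (-j)))
    refine Eq.trans (congrArg _ ?_) (h.trans (congrArg _ ?_))
    · ext x
      simp only [Set.mem_ofPred_eq, Set.mem_inter_iff, shift_apply, neg_add_cancel]
      refine ⟨fun hx => ⟨?_, hx⟩, fun hx => hx.2⟩
      have := hx.1.1
      simp only [shift_apply, zero_add] at this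
      exact norm_pos_iff.1 (hv.trans this)
    · ext x
      simp only [Set.mem_ofPred_eq, Set.mem_inter_iff]
      exact ⟨fun hx => hx.2, fun hx => ⟨norm_pos_iff.1 (hv.trans hx.2), hx⟩⟩
  have hdisj : Pairwise (Function.onFun Disjoint
      fun j : ℕ => {x : ℤ → E d | shift j x ∈ A ∧ v < ‖x 0‖}) := by
    have key : ∀ (x : ℤ → E d) (i j : ℕ), i < j → shift i x ∈ A → shift j x ∈ A → False := by
      intro x i j hij hi hj
      have h1 := hi.2.1 (j - i - 1)
      have h2 := hj.1
      simp only [shift_apply] at h1 h2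
      have e : ((j - i - 1 : ℕ) : ℤ) + 1 + i = 0 + j := by omega
      rw [e] at h1
      linarith
    intro i j hij
    refine Set.disjoint_left.2 fun x hi hj => ?_
    rcases lt_or_gt_of_ne hij with h | h
    · exact key x i j h hi.1 hj.1
    · exact key x j i h hj.1 hi.1
  have hsum : ∑' j : ℕ, ν {x | x ∈ A ∧ v < ‖x (-j)‖} ≠ ∞ := by
    simp only [← hswap]
    rw [← measure_iUnion hdisj hB]
    refine ne_top_of_le_ne_top (b := ν {x | v < ‖x 0‖}) ?_ (measure_mono fun x hx => ?_)
    · rw [S.tailMeasure_norm_zero hv]; exact ENNReal.ofReal_ne_top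
    · obtain ⟨j, hj⟩ := Set.mem_iUnion.1 hx
      exact hj.2
  have hA0 : ν A = 0 := by
    refine measure_mono_null (fun x hx => ?_) (measure_setOfPred_frequently_eq_zero hsum)
    exact hx.2.2.mono fun i hi => ⟨hx, hi⟩
  have hB0 : ∀ j : ℕ, ν {x | shift j x ∈ A ∧ v < ‖x 0‖} = 0 := fun j => by
    rw [hswap]
    exact measure_mono_null (fun x hx => hx.1) hA0
  refine measure_mono_null (fun x hx => ?_) (measure_union_null
    (S.measure_forward_frequently hlim hC hv) (measure_iUnion_null hB0))
  by_cases hf : ∃ᶠ i : ℕ in atTop, v < ‖x i‖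
  · exact Or.inl ⟨hx.1, hf⟩
  -- With finitely many forward exceedances there is a last one, at time j, and the shift by j lies
  -- in A.
  · refine Or.inr (Set.mem_iUnion.2 ?_)
    rw [not_frequently, eventually_atTop] at hf
    obtain ⟨N, hN⟩ := hf
    have hex : ∃ j : ℕ, j ≤ N ∧ v < ‖x j‖ := ⟨0, N.zero_le, by simpa using hx.1⟩
    classical
    set j := Nat.findGreatest (fun j => v < ‖x j‖) N
    have hj : v < ‖x j‖ := by
      have := Nat.findGreatest_spec (P := fun j : ℕ => v < ‖x j‖) N.zero_le (by simpa using hx.1)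
      exact this
    refine ⟨j, ⟨by simpa using hj, fun t => ?_, ?_⟩, hx.1⟩
    · have hjt : ‖x ((j + t + 1 : ℕ) : ℤ)‖ ≤ v := by
        by_cases h : j + t + 1 ≤ N
        · exact not_lt.1 (Nat.findGreatest_is_greatest (P := fun j : ℕ => v < ‖x j‖)
            (show j < j + t + 1 by omega) h)
        · exact not_lt.1 (hN _ (by omega))
      simp only [shift_apply]
      convert hjt using 3
      push_cast; ring
    · rw [frequently_atTop] at *
      intro a
      obtain ⟨b, hb, hxb⟩ := frequently_atTop.1 hx.2 a
      refine ⟨b + j, by omega, ?_⟩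
      simp only [shift_apply]
      convert hxb using 3
      push_cast; ring

theorem ae_finite_exceedances {xs : ℕ → ℝ} (hlim : Tendsto xs atTop atTop)
    (hC : ClusterBound P X xs) :
    ∀ᵐ x ∂tailMeasure P' Θ α, ∀ v : ℝ, 0 < v → {t : ℤ | v < ‖x t‖}.Finite := by
  have h : ∀ᵐ x ∂tailMeasure P' Θ α, ∀ n : ℕ,
      ¬ (1 / (n + 1 : ℝ) < ‖x 0‖ ∧ ∃ᶠ i : ℕ in atTop, 1 / (n + 1 : ℝ) < ‖x i‖) ∧
      ¬ (1 / (n + 1 : ℝ) < ‖x 0‖ ∧ ∃ᶠ i : ℕ in atTop, 1 / (n + 1 : ℝ) < ‖x (-i)‖) := by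
    refine ae_all_iff.2 fun n => ?_
    have hn : (0 : ℝ) < 1 / (n + 1 : ℝ) := by positivity
    exact (measure_eq_zero_iff_ae_notMem.1 (S.measure_forward_frequently hlim hC hn)).and
      (measure_eq_zero_iff_ae_notMem.1 (S.measure_backward_frequently hlim hC hn))
  filter_upwards [h, S.ae_zero_ne] with x hx h0 v hv
  obtain ⟨n, hn⟩ := exists_nat_one_div_lt (lt_min hv (norm_pos_iff.2 h0))
  obtain ⟨h1, h2⟩ := hx n
  have hn0 := hn.trans_le (min_le_right _ _)
  have hnv := hn.trans_le (min_le_left _ _)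
  replace h1 := fun h => h1 ⟨hn0, h⟩
  replace h2 := fun h => h2 ⟨hn0, h⟩
  change ¬ _ at h1
  change ¬ _ at h2
  rw [not_frequently, eventually_atTop] at h1 h2
  obtain ⟨N1, hN1⟩ := h1
  obtain ⟨N2, hN2⟩ := h2
  refine (Set.finite_Icc (-(N2 : ℤ)) N1).subset fun t ht => ?_
  have htn := hnv.trans ht
  constructor
  · by_contra hc
    have := hN2 t.natAbs (by omega)
    rw [show -(t.natAbs : ℤ) = t by omega] at this
    exact this htn
  · by_contra hc
    have := hN1 t.natAbs (by omega)
    rw [show (t.natAbs : ℤ) = t by omega] at this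
    exact this htn

/-- Mass transport towards the anchored paths. -/
theorem lintegral_eq_anchor {xs : ℕ → ℝ} (hlim : Tendsto xs atTop atTop)
    (hC : ClusterBound P X xs) {D : (ℤ → E d) → ℝ≥0∞} (hD : Measurable D)
    (hD0 : ∀ x, x 0 = 0 → D x = 0) :
    ∫⁻ x, D x ∂tailMeasure P' Θ α =
      ∫⁻ x in anchor d, ∑' m : ℤ, D (shift m x) ∂tailMeasure P' Θ α := by
  set ν := tailMeasure P' Θ α
  have hM := measurableSet_anchor d
  have hms : ∀ m : ℤ, MeasurableSet {x : ℤ → E d | shift m x ∈ anchor d} := fun m =>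
    measurable_shift m hM
  have hnz : ∀ s : ℤ, MeasurableSet {x : ℤ → E d | x s ≠ 0} := fun s =>
    (measurableSet_eq_fun (by fun_prop) measurable_const).compl
  -- Almost every path has exactly one anchored shift, so D splits according to its position m.
  have h1 : ∫⁻ x, D x ∂ν =
      ∫⁻ x, ∑' m : ℤ, ({x | shift m x ∈ anchor d} : Set (ℤ → E d)).indicator D x ∂ν := by
    refine lintegral_congr_ae ?_
    filter_upwards [S.ae_finite_exceedances hlim hC, S.ae_zero_ne] with x hx h0
    obtain ⟨t, ht⟩ := exists_shift_mem_anchor h0 hx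
    refine Eq.symm ((tsum_eq_single t fun s hs => ?_).trans ?_)
    · exact Set.indicator_of_notMem (s := {x : ℤ → E d | shift s x ∈ anchor d})
        (fun h => hs (anchor_unique h ht)) _
    · exact Set.indicator_of_mem (s := {x : ℤ → E d | shift t x ∈ anchor d}) ht _
  rw [h1, lintegral_tsum fun m => (hD.indicator (hms m)).aemeasurable]
  have h2 : ∀ m : ℤ, ∫⁻ x, ({x | shift m x ∈ anchor d} : Set (ℤ → E d)).indicator D x ∂ν =
      ∫⁻ x in anchor d, D (shift (-m) x) ∂ν := by
    intro m
    -- Transport by m moves the anchor to the origin. Neither restriction in the formula loses mass: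
    -- an anchored path is nonzero at the anchor, and `hD0` kills the paths with x_{-m} = 0.
    have h := S.lintegral_shift m (F := (anchor d).indicator fun x => D (shift (-m) x))
      ((hD.comp (measurable_shift (-m))).indicator hM)
    rw [← lintegral_indicator (hnz m), ← lintegral_indicator (hnz (-m))] at h
    rw [← lintegral_indicator hM]
    refine Eq.trans (lintegral_congr fun x => ?_) (h.trans (lintegral_congr fun x => ?_))
    · simp only [Set.indicator_apply, Set.mem_ofPred_eq]
      have e : shift (-m) (shift m x) = x := by rw [shift_shift, neg_add_cancel, shift_zero]
      by_cases hx : shift m x ∈ anchor d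
      · have : x m ≠ 0 := by simpa using hx.1
        simp [hx, this, e]
      · simp [hx]
    · simp only [Set.indicator_apply, Set.mem_ofPred_eq]
      by_cases hx : x (-m) = 0
      · have hz := hD0 (shift (-m) x) (by simpa using hx)
        rw [if_neg (not_not.2 hx)]
        exact (Set.indicator_apply_eq_zero (s := anchor d) (f := fun x => D (shift (-m) x))
          (a := x).2 fun _ => hz).symm
      · simp [hx]
  simp only [h2]
  rw [← lintegral_tsum (f := fun m x => D (shift (-m) x)) fun m => (hD.comp (measurable_shift (-m))).aemeasurable]
  refine lintegral_congr fun x => ?_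
  exact (Equiv.neg ℤ).tsum_eq fun m => D (shift m x)

end SpectralSetup

end HeavyTail

namespace HeavyTail

/-! ### Summability and cluster sums -/

/-- Subadditivity of the power if α ≤ 1, Bernoulli's inequality for b/a if α ≥ 1. The exponent α - 1
in this bound is the reason for the moment condition on the spectral tail process. -/
theorem rpow_sub_rpow_le {α a b c : ℝ} (hα : 0 < α) (hb : 0 ≤ b) (hba : b ≤ a) (hab : a - b ≤ 1)
    (hac : a ≤ c) (hc : 1 ≤ c) : a ^ α - b ^ α ≤ max 1 α * c ^ max (α - 1) 0 := by
  rcases le_total α 1 with h | h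
  · rw [max_eq_left h, max_eq_right (by linarith), Real.rpow_zero, mul_one]
    have h1 : a ^ α ≤ (b + 1) ^ α := Real.rpow_le_rpow (hb.trans hba) (by linarith) hα.le
    have h2 : (b + 1) ^ α ≤ b ^ α + 1 ^ α := Real.rpow_add_le_add_rpow hb zero_le_one hα.le h
    rw [Real.one_rpow] at h2
    linarith
  · rw [max_eq_right h, max_eq_left (by linarith)]
    rcases eq_or_lt_of_le (hb.trans hba) with ha | ha
    · have : b = 0 := le_antisymm (ha ▸ hba) hb
      rw [this, ← ha, sub_self]
      positivity
    · have h1 := one_add_mul_self_le_rpow_one_add (s := (b - a) / a) (by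
        rw [le_div_iff₀ ha]; linarith) h
      have h2 : 1 + (b - a) / a = b / a := by field_simp; ring
      rw [h2, Real.div_rpow hb ha.le, le_div_iff₀ (by positivity)] at h1
      have h3 : a ^ α = a * a ^ (α - 1) := by
        rw [Real.rpow_sub_one ha.ne']; field_simp
      have h4 : (1 + α * ((b - a) / a)) * a ^ α = a ^ α - α * (a - b) * a ^ (α - 1) := by
        rw [h3]; field_simp; ring
      have h5 : a ^ (α - 1) ≤ c ^ (α - 1) := Real.rpow_le_rpow ha.le hac (by linarith)
      have h6 : 0 ≤ a ^ (α - 1) := by positivity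
      have h7 : α * (a - b) * a ^ (α - 1) ≤ α * 1 * a ^ (α - 1) := by gcongr
      nlinarith

/-- The sum of the norms of a path from time `m` on. -/
noncomputable def forwardSum {d : ℕ} (m : ℤ) (x : ℤ → E d) : ℝ≥0∞ := ∑' i : ℕ, ‖x (i + m)‖ₑ

/-- The sum of the norms of a path. -/
noncomputable def totalSum {d : ℕ} (x : ℤ → E d) : ℝ≥0∞ := ∑' t : ℤ, ‖x t‖ₑ

@[fun_prop] theorem measurable_forwardSum {d : ℕ} (m : ℤ) : Measurable (forwardSum (d := d) m) := by
  unfold forwardSum; fun_prop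

@[fun_prop] theorem measurable_totalSum {d : ℕ} : Measurable (totalSum (d := d)) := by
  unfold totalSum; fun_prop

theorem forwardSum_shift {d : ℕ} (m s : ℤ) (x : ℤ → E d) :
    forwardSum m (shift s x) = forwardSum (m + s) x := by
  simp [forwardSum, add_assoc]

theorem totalSum_shift {d : ℕ} (s : ℤ) (x : ℤ → E d) : totalSum (shift s x) = totalSum x :=
  (Equiv.addRight s).tsum_eq fun t => ‖x t‖ₑ

theorem totalSum_smul {d : ℕ} (c : ℝ) (x : ℤ → E d) :
    totalSum (fun t => c • x t) = ‖c‖ₑ * totalSum x := by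
  simp only [totalSum, enorm_smul, ENNReal.tsum_mul_left]

theorem forwardSum_smul {d : ℕ} (m : ℤ) (c : ℝ) (x : ℤ → E d) :
    forwardSum m (fun t => c • x t) = ‖c‖ₑ * forwardSum m x := by
  simp only [forwardSum, enorm_smul, ENNReal.tsum_mul_left]

theorem forwardSum_le_totalSum {d : ℕ} (m : ℤ) (x : ℤ → E d) : forwardSum m x ≤ totalSum x :=
  ENNReal.tsum_comp_le_tsum_of_injective (f := fun i : ℕ => (i : ℤ) + m)
    (fun i j h => by simpa using h) fun t => ‖x t‖ₑ

theorem forwardSum_eq_add {d : ℕ} (m : ℤ) (x : ℤ → E d) :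
    forwardSum m x = ‖x m‖ₑ + forwardSum (m + 1) x := by
  unfold forwardSum
  rw [tsum_eq_zero_add' ENNReal.summable]
  simp only [Nat.cast_zero, zero_add, Nat.cast_add, Nat.cast_one]
  congr 1
  refine tsum_congr fun i => ?_
  rw [show (i : ℤ) + 1 + m = i + (m + 1) by ring]

/-- A path with finite forward sums and large total sum crosses the level `u` at some time. -/
theorem exists_crossing {d : ℕ} {x : ℤ → E d} (hx : forwardSum 0 x ≠ ∞) {u : ℝ≥0∞} (hu : 0 < u)
    (hux : u < totalSum x) :
    ∃ m : ℤ, u < forwardSum m x ∧ forwardSum (m + 1) x ≤ u := by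
  obtain ⟨s, hs⟩ : ∃ s : Finset ℤ, u < ∑ t ∈ s, ‖x t‖ₑ := by
    rw [totalSum, ENNReal.tsum_eq_iSup_sum] at hux
    exact lt_iSup_iff.1 hux
  obtain ⟨N, hN⟩ : ∃ N : ℕ, ∀ t ∈ s, -(N : ℤ) ≤ t := ⟨s.sup Int.natAbs, fun t ht => by
    have := Finset.le_sup (f := Int.natAbs) ht
    omega⟩
  have h1 : u < forwardSum (-(N : ℤ)) x := by
    refine hs.trans_le ?_
    have hinj : Set.InjOn (fun t : ℤ => (t + N).toNat) s := by
      intro a ha b hb hab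
      have := hN a ha
      have := hN b hb
      simp only at hab
      omega
    calc ∑ t ∈ s, ‖x t‖ₑ = ∑ t ∈ s, ‖x (((t + N).toNat : ℤ) + -(N : ℤ))‖ₑ :=
          Finset.sum_congr rfl fun t ht => by
            have := hN t ht
            rw [show (((t + N).toNat : ℤ) + -(N : ℤ)) = t by omega]
      _ = ∑ i ∈ s.image fun t : ℤ => (t + N).toNat, ‖x ((i : ℤ) + -(N : ℤ))‖ₑ :=
          (Finset.sum_image (f := fun i : ℕ => ‖x ((i : ℤ) + -(N : ℤ))‖ₑ) hinj).symm
      _ ≤ _ := ENNReal.sum_le_tsum _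
  have h2 : ∃ n : ℕ, forwardSum (-(N : ℤ) + n) x ≤ u := by
    have h := ENNReal.tendsto_sum_nat_add (fun i : ℕ => ‖x (i + 0)‖ₑ) hx
    obtain ⟨k, hk⟩ := (h.eventually (gt_mem_nhds hu)).exists
    refine ⟨N + k, le_trans (le_of_eq ?_) hk.le⟩
    unfold forwardSum
    refine tsum_congr fun i => ?_
    rw [show (i : ℤ) + (-(N : ℤ) + ((N + k : ℕ) : ℤ)) = ((i + k : ℕ) : ℤ) + 0 by push_cast; ring]
  classical
  -- The forward sum exceeds u from time -N on and tends to 0 later, so it first drops to at most u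
  -- after a positive number of steps; the crossing is at the step before.
  obtain ⟨n, hn⟩ : ∃ n, Nat.find h2 = n + 1 := by
    refine Nat.exists_eq_succ_of_ne_zero fun h0 => ?_
    have := Nat.find_spec h2
    rw [h0] at this
    simp only [Nat.cast_zero, add_zero] at this
    exact absurd this (not_le.2 h1)
  refine ⟨-(N : ℤ) + n, not_le.1 (Nat.find_min h2 (m := n) (by omega)), ?_⟩
  have := Nat.find_spec h2
  rw [hn] at this
  push_cast at this
  rwa [← add_assoc] at this

namespace SpectralSetup

set_option linter.unusedSectionVars false

variable {Ω Ω' : Type*} [MeasurableSpace Ω] [MeasurableSpace Ω'] {P : Measure Ω} {P' : Measure Ω'}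
  {d : ℕ} {X : ℤ → Ω → E d} {Θ : ℤ → Ω' → E d} {α : ℝ}
  [IsProbabilityMeasure P] [IsProbabilityMeasure P'] (S : SpectralSetup P P' X Θ α)
include S

theorem measurable_spectral : Measurable fun ω (t : ℤ) => Θ t ω :=
  measurable_pi_lambda _ S.measurable_Θ

/-- Scale invariant properties pass from the spectral process to the tail measure. -/
theorem ae_tailMeasure_of_ae {p : (ℤ → E d) → Prop} (hm : MeasurableSet {x | p x})
    (hp : ∀ (c : ℝ) (x : ℤ → E d), 0 < c → p x → p fun t => c • x t)
    (h : ∀ᵐ ω ∂P', p fun t => Θ t ω) : ∀ᵐ x ∂tailMeasure P' Θ α, p x := by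
  have hmeas : Measurable fun (q : ℝ × Ω') (t : ℤ) => q.1 • Θ t q.2 := by
    have := S.measurable_Θ; fun_prop
  unfold tailMeasure
  refine (ae_map_iff hmeas.aemeasurable hm).2 ?_
  filter_upwards [Measure.quasiMeasurePreserving_snd.ae h,
    Measure.quasiMeasurePreserving_fst.ae (radialMeasure_ae_pos α)] with q h1 h2
  exact hp _ _ h2 h1

/-- Scale invariant properties pass from the tail measure to the spectral process. -/
theorem ae_of_ae_tailMeasure {p : (ℤ → E d) → Prop} (hm : MeasurableSet {x | p x})
    (hp : ∀ (c : ℝ) (x : ℤ → E d), 0 < c → p (fun t => c • x t) → p x)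
    (h : ∀ᵐ x ∂tailMeasure P' Θ α, p x) : ∀ᵐ ω ∂P', p fun t => Θ t ω := by
  have h0 : tailMeasure P' Θ α {x | ¬ p x} = 0 := h
  rw [tailMeasure_apply S.measurable_Θ (A := {x | ¬ p x}) hm.compl,
    lintegral_eq_zero_iff' (AEMeasurable.congr (f := fun ω => ∫⁻ y,
      ({x | ¬ p x} : Set (ℤ → E d)).indicator 1 (fun t => y • Θ t ω) ∂radialMeasure α) ?_ ?_)] at h0
  · filter_upwards [h0] with ω hω
    by_contra hc
    -- If p fails for a path it fails for all its positive multiples, and the radii above 1 already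
    -- have mass 1.
    have hsub : Set.Ioi (1 : ℝ) ⊆ {y | (fun t => y • Θ t ω) ∈ {x : ℤ → E d | ¬ p x}} :=
      fun y hy hpy => hc (hp y _ (lt_trans one_pos hy) hpy)
    have h1 := measure_mono (μ := radialMeasure α) hsub
    rw [radialMeasure_Ioi S.index_pos one_pos, Real.one_rpow, ENNReal.ofReal_one] at h1
    have h2 : radialMeasure α {y | (fun t => y • Θ t ω) ∈ {x : ℤ → E d | ¬ p x}} = 0 := hω
    rw [h2] at h1
    exact absurd h1 (by simp)
  · have hmeas : Measurable fun (q : Ω' × ℝ) => ({x | ¬ p x} : Set (ℤ → E d)).indicator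
        (1 : (ℤ → E d) → ℝ≥0∞) (fun t => q.2 • Θ t q.1) := by
      have := S.measurable_Θ
      exact (measurable_one.indicator hm.compl).comp (by fun_prop)
    exact hmeas.lintegral_prod_right'.aemeasurable
  · refine .of_forall fun ω => ?_
    have hmy : Measurable fun (y : ℝ) (t : ℤ) => y • Θ t ω := by fun_prop
    exact lintegral_indicator_one (hmy hm.compl)

/-- The total sum is shift invariant, so mass transport of the event that it is infinite only
involves anchored paths. -/
theorem ae_totalSum_of_anchor {xs : ℕ → ℝ} (hlim : Tendsto xs atTop atTop)
    (hC : ClusterBound P X xs)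
    (h : ∀ᵐ x ∂(tailMeasure P' Θ α).restrict (anchor d), totalSum x ≠ ∞) :
    ∀ᵐ x ∂tailMeasure P' Θ α, totalSum x ≠ ∞ := by
  have hm : MeasurableSet {x : ℤ → E d | x 0 ≠ 0 ∧ totalSum x = ∞} :=
    ((measurableSet_eq_fun (by fun_prop) measurable_const).compl).inter
      (measurableSet_eq_fun measurable_totalSum measurable_const)
  have key := S.lintegral_eq_anchor hlim hC (measurable_one.indicator hm)
    fun x hx => Set.indicator_of_notMem (fun hc => hc.1 hx) _
  rw [lintegral_indicator_one hm] at key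
  have hz : ∫⁻ x in anchor d, ∑' m : ℤ, ({x : ℤ → E d | x 0 ≠ 0 ∧ totalSum x = ∞}).indicator
      (1 : (ℤ → E d) → ℝ≥0∞) (shift m x) ∂tailMeasure P' Θ α = 0 := by
    rw [lintegral_congr_ae (g := fun _ => 0), lintegral_zero]
    filter_upwards [h] with x hx
    refine ENNReal.tsum_eq_zero.2 fun m => Set.indicator_of_notMem (fun hc => hx ?_) _
    rw [← totalSum_shift m]
    exact hc.2
  rw [hz] at key
  filter_upwards [measure_eq_zero_iff_ae_notMem.1 key, S.ae_zero_ne] with x h1 h2 h3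
  exact h1 ⟨h2, h3⟩

/-- The `α`-th powers are summable along anchored paths. -/
theorem lintegral_anchor_rpow {xs : ℕ → ℝ} (hlim : Tendsto xs atTop atTop)
    (hC : ClusterBound P X xs) :
    ∫⁻ ω, ({ω | (fun t => Θ t ω) ∈ anchor d} : Set Ω').indicator
      (fun ω => ∑' m : ℤ, ENNReal.ofReal (‖Θ m ω‖ ^ α)) ω ∂P' = 1 := by
  have hm := measurableSet_lt_norm (d := d) 1 0
  -- Mass transport of the event ‖x_0‖ > 1, which has mass 1. On the anchored side, integrating the
  -- indicator of y‖Θ_m‖ > 1 over the radius gives ‖Θ_m‖^α.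
  have key := S.lintegral_eq_anchor hlim hC (measurable_one.indicator hm)
    fun x hx => Set.indicator_of_notMem (fun hc => by
      simp only [Set.mem_ofPred_eq, hx, norm_zero] at hc; linarith) _
  rw [lintegral_indicator_one hm, S.tailMeasure_norm_zero one_pos, Real.one_rpow,
    ENNReal.ofReal_one, ← lintegral_indicator (measurableSet_anchor d), lintegral_tailMeasure
    S.measurable_Θ] at key
  · rw [key]
    refine lintegral_congr fun ω => ?_
    by_cases hω : (fun t => Θ t ω) ∈ anchor d
    · rw [Set.indicator_of_mem (s := {ω | (fun t => Θ t ω) ∈ anchor d}) hω]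
      have h1 : ∀ m : ℤ, ENNReal.ofReal (‖Θ m ω‖ ^ α) = ∫⁻ y,
          ({x : ℤ → E d | 1 < ‖x 0‖}).indicator (1 : (ℤ → E d) → ℝ≥0∞)
            (shift m fun t => y • Θ t ω) ∂radialMeasure α := by
        intro m
        have h2 := radialMeasure_setOf_lt_mul S.index_pos one_pos ‖Θ m ω‖
        rw [Real.one_rpow, one_mul, max_eq_left (norm_nonneg _)] at h2
        rw [← h2, ← lintegral_indicator_one (measurableSet_lt (by fun_prop) (by fun_prop))]
        refine lintegral_congr_ae ?_
        filter_upwards [radialMeasure_ae_pos α] with y hy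
        simp only [Set.indicator_apply, Set.mem_ofPred_eq, shift_apply, zero_add, norm_smul,
          Real.norm_of_nonneg hy.le, Pi.one_apply]
      simp only [h1]
      rw [← lintegral_tsum]
      · refine lintegral_congr_ae ?_
        filter_upwards [radialMeasure_ae_pos α] with y hy
        rw [Set.indicator_of_mem ((smul_mem_anchor hy).2 hω)]
      · intro m
        refine Measurable.aemeasurable ((measurable_one.indicator hm).comp ?_)
        exact (measurable_shift m).comp (by fun_prop)
    · rw [Set.indicator_of_notMem (s := {ω | (fun t => Θ t ω) ∈ anchor d}) hω]
      rw [lintegral_congr_ae (g := fun _ => 0), lintegral_zero]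
      filter_upwards [radialMeasure_ae_pos α] with y hy
      exact Set.indicator_of_notMem (fun h => hω ((smul_mem_anchor hy).1 h)) _
  · exact (Measurable.tsum fun m => (measurable_one.indicator hm).comp
      (measurable_shift m)).indicator (measurableSet_anchor d)

/-- For α ≤ 1 summability comes for free: on anchored paths ∑‖Θ_t‖^α is finite, and all but finitely
many terms are below 1, where ‖Θ_t‖ ≤ ‖Θ_t‖^α. Scale invariance carries this to anchored paths under
ν, mass transport to all paths, and scale invariance back to Θ. For α > 1 it follows from the finite
moment of positive order α - 1. -/
theorem ae_forwardSum {xs : ℕ → ℝ} (hlim : Tendsto xs atTop atTop) (hC : ClusterBound P X xs)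
    (hmom : 1 < α → ∫⁻ ω, (∑' i : ℕ, ‖Θ (i + 1) ω‖ₑ) ^ (α - 1) ∂P' < ∞) :
    ∀ᵐ ω ∂P', forwardSum 0 (fun t => Θ t ω) ≠ ∞ := by
  have hpath := S.measurable_spectral
  rcases le_or_gt α 1 with h | h
  · have h1 : ∀ᵐ ω ∂P', ({ω | (fun t => Θ t ω) ∈ anchor d} : Set Ω').indicator
        (fun ω => ∑' m : ℤ, ENNReal.ofReal (‖Θ m ω‖ ^ α)) ω < ∞ := by
      refine ae_lt_top' (Measurable.aemeasurable ?_) (by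
        rw [S.lintegral_anchor_rpow hlim hC]; exact ENNReal.one_ne_top)
      exact (Measurable.tsum fun m => ((S.measurable_Θ m).norm.pow_const α).ennreal_ofReal).indicator
        (hpath (measurableSet_anchor d))
    have h2 : ∀ᵐ ω ∂P', (fun t => Θ t ω) ∈ anchor d → totalSum (fun t => Θ t ω) ≠ ∞ := by
      filter_upwards [h1] with ω hω hmem
      rw [Set.indicator_of_mem (s := {ω | (fun t => Θ t ω) ∈ anchor d}) hmem] at hω
      have hsum : ∀ t, ‖Θ t ω‖ₑ ≤ ENNReal.ofReal (‖Θ t ω‖ ^ α) ∨ 1 < ‖Θ t ω‖ := by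
        intro t
        by_cases ht : 1 < ‖Θ t ω‖
        · exact Or.inr ht
        · left
          rw [← ofReal_norm]
          exact ENNReal.ofReal_le_ofReal (Real.self_le_rpow_of_le_one (norm_nonneg _)
            (not_lt.1 ht) h)
      have hs : Summable fun t => ‖Θ t ω‖ ^ α := by
        have := ENNReal.summable_toReal hω.ne
        refine this.congr fun t => ?_
        rw [ENNReal.toReal_ofReal (by positivity)]
      have hs' : Summable fun t => ‖Θ t ω‖ := by
        refine summable_of_isBigO hs (Asymptotics.IsBigO.of_bound 1 ?_)
        have hev := hs.tendsto_cofinite_zero.eventually (gt_mem_nhds one_pos)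
        filter_upwards [hev] with t ht
        rw [one_mul, norm_norm, Real.norm_of_nonneg (by positivity)]
        refine Real.self_le_rpow_of_le_one (norm_nonneg _) ?_ h
        by_contra hc
        exact absurd ht (not_lt.2 (Real.one_le_rpow (not_le.1 hc).le S.index_pos.le))
      unfold totalSum
      simp only [← ofReal_norm]
      rw [← ENNReal.ofReal_tsum_of_nonneg (fun _ => norm_nonneg _) hs']
      exact ENNReal.ofReal_ne_top
    have hms : MeasurableSet {x : ℤ → E d | x ∈ anchor d → totalSum x ≠ ∞} := by
      have h1 := measurableSet_eq_fun (measurable_totalSum (d := d)) (measurable_const (a := ∞))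
      have : {x : ℤ → E d | x ∈ anchor d → totalSum x ≠ ∞} =
        (anchor d)ᶜ ∪ {x | totalSum x = ∞}ᶜ := by
        ext x
        simp only [Set.mem_ofPred_eq, Set.mem_union, Set.mem_compl_iff, imp_iff_not_or, ne_eq]
      rw [this]
      exact (measurableSet_anchor d).compl.union h1.compl
    have h3 := S.ae_tailMeasure_of_ae hms (fun c x hc hx hmem => by
      rw [totalSum_smul]
      exact ENNReal.mul_ne_top enorm_ne_top (hx ((smul_mem_anchor hc).1 hmem))) h2
    have h4 := S.ae_totalSum_of_anchor hlim hC ((ae_restrict_iff' (measurableSet_anchor d)).2 h3)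
    have h5 := S.ae_of_ae_tailMeasure (p := fun x => totalSum x ≠ ∞)
      (measurableSet_eq_fun measurable_totalSum measurable_const).compl
      (fun c x hc hx hx' => hx (by
        rw [totalSum_smul, hx', ENNReal.mul_top]
        simpa using hc.ne')) h4
    filter_upwards [h5] with ω hω
    exact ne_top_of_le_ne_top hω (forwardSum_le_totalSum 0 _)
  · have hm : Measurable fun ω => (∑' i : ℕ, ‖Θ (i + 1) ω‖ₑ) ^ (α - 1) := by
      have := S.measurable_Θ; fun_prop
    filter_upwards [ae_lt_top hm (hmom h).ne] with ω hω
    rw [forwardSum_eq_add]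
    refine ENNReal.add_ne_top.2 ⟨enorm_ne_top, fun hc => ?_⟩
    have : (∑' i : ℕ, ‖Θ (i + 1) ω‖ₑ) = ∞ := hc
    rw [this, ENNReal.top_rpow_of_pos (by linarith)] at hω
    exact lt_irrefl _ hω

theorem lintegral_forwardSum_rpow
    (hmom : 1 < α → ∫⁻ ω, (∑' i : ℕ, ‖Θ (i + 1) ω‖ₑ) ^ (α - 1) ∂P' < ∞) :
    ∫⁻ ω, forwardSum 0 (fun t => Θ t ω) ^ max (α - 1) 0 ∂P' ≠ ∞ := by
  rcases le_or_gt α 1 with h | h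
  · rw [max_eq_right (by linarith)]
    simp
  · rw [max_eq_left (by linarith)]
    have hp : 0 ≤ α - 1 := by linarith
    have hΘ := S.measurable_Θ
    have hle : ∀ᵐ ω ∂P', forwardSum 0 (fun t => Θ t ω) ^ (α - 1) ≤
        2 ^ (α - 1) * (1 + (∑' i : ℕ, ‖Θ (i + 1) ω‖ₑ) ^ (α - 1)) := by
      filter_upwards [S.ae_norm_zero] with ω hω
      have e : forwardSum 0 (fun t => Θ t ω) = 1 + ∑' i : ℕ, ‖Θ (i + 1) ω‖ₑ := by
        rw [forwardSum_eq_add, ← ofReal_norm, hω, ENNReal.ofReal_one]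
        rfl
      rw [e]
      set T := ∑' i : ℕ, ‖Θ (i + 1) ω‖ₑ
      have h1 : 1 + T ≤ 2 * max 1 T := by
        rw [two_mul]; exact add_le_add (le_max_left _ _) (le_max_right _ _)
      refine (ENNReal.rpow_le_rpow h1 hp).trans ?_
      rw [ENNReal.mul_rpow_of_nonneg _ _ hp]
      gcongr
      rcases max_choice 1 T with h2 | h2
      · rw [h2, ENNReal.one_rpow]; exact le_self_add
      · rw [h2]; exact le_add_self
    refine ne_top_of_le_ne_top ?_ (lintegral_mono_ae hle)
    rw [lintegral_const_mul _ (by fun_prop), lintegral_add_left (by fun_prop)]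
    refine ENNReal.mul_ne_top (ENNReal.rpow_ne_top_of_nonneg hp (by simp)) ?_
    simpa using (hmom h).ne

/-- Let a = 1 + b be the forward sums of ‖Θ_i‖ from times 0 and 1, with ‖Θ_0‖ = 1. The radii with yb
≤ u < ya have mass u^(-α)(a^α - b^α), which is at most a constant times a^{max(α-1,0)}. -/
theorem tailMeasure_crossing_ne_top {xs : ℕ → ℝ} (hlim : Tendsto xs atTop atTop)
    (hC : ClusterBound P X xs)
    (hmom : 1 < α → ∫⁻ ω, (∑' i : ℕ, ‖Θ (i + 1) ω‖ₑ) ^ (α - 1) ∂P' < ∞) {u : ℝ} (hu : 0 < u) :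
    tailMeasure P' Θ α {x | ENNReal.ofReal u < forwardSum 0 x ∧
      forwardSum 1 x ≤ ENNReal.ofReal u} ≠ ∞ := by
  have hm : MeasurableSet {x : ℤ → E d | ENNReal.ofReal u < forwardSum 0 x ∧
      forwardSum 1 x ≤ ENNReal.ofReal u} :=
    (measurableSet_lt measurable_const (measurable_forwardSum 0)).inter
      (measurableSet_le (measurable_forwardSum 1) measurable_const)
  rw [tailMeasure_apply S.measurable_Θ hm]
  have hle : ∀ᵐ ω ∂P', radialMeasure α {y | (fun t => y • Θ t ω) ∈ {x : ℤ → E d |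
      ENNReal.ofReal u < forwardSum 0 x ∧ forwardSum 1 x ≤ ENNReal.ofReal u}} ≤
      ENNReal.ofReal (u ^ (-α) * max 1 α) * forwardSum 0 (fun t => Θ t ω) ^ max (α - 1) 0 := by
    filter_upwards [S.ae_forwardSum hlim hC hmom, S.ae_norm_zero] with ω h1 h2
    have e : forwardSum 0 (fun t => Θ t ω) = 1 + forwardSum 1 (fun t => Θ t ω) := by
      rw [forwardSum_eq_add, ← ofReal_norm, h2, ENNReal.ofReal_one, zero_add]
    have h1' : forwardSum 1 (fun t => Θ t ω) ≠ ∞ := by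
      rw [e] at h1; exact (ENNReal.add_ne_top.1 h1).2
    set a := (forwardSum 0 (fun t => Θ t ω)).toReal
    set b := (forwardSum 1 (fun t => Θ t ω)).toReal
    have hab : a = 1 + b := by
      simp only [a, b]
      rw [e, ENNReal.toReal_add ENNReal.one_ne_top h1', ENNReal.toReal_one]
    have hb : 0 ≤ b := ENNReal.toReal_nonneg
    have hea : forwardSum 0 (fun t => Θ t ω) = ENNReal.ofReal a := (ENNReal.ofReal_toReal h1).symm
    have heb : forwardSum 1 (fun t => Θ t ω) = ENNReal.ofReal b := (ENNReal.ofReal_toReal h1').symm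
    have hset : radialMeasure α {y | (fun t => y • Θ t ω) ∈ {x : ℤ → E d |
        ENNReal.ofReal u < forwardSum 0 x ∧ forwardSum 1 x ≤ ENNReal.ofReal u}} ≤
        radialMeasure α ({y | u < y * a} \ {y | u < y * b}) := by
      refine measure_mono_ae ?_
      filter_upwards [radialMeasure_ae_pos α] with y hy hmem
      obtain ⟨hm1, hm2⟩ := hmem
      rw [forwardSum_smul, hea, ← ofReal_norm, Real.norm_of_nonneg hy.le,
        ← ENNReal.ofReal_mul hy.le, ENNReal.ofReal_lt_ofReal_iff_of_nonneg hu.le] at hm1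
      rw [forwardSum_smul, heb, ← ofReal_norm, Real.norm_of_nonneg hy.le,
        ← ENNReal.ofReal_mul hy.le, ENNReal.ofReal_le_ofReal_iff hu.le] at hm2
      exact ⟨hm1, not_lt.2 hm2⟩
    refine hset.trans ?_
    have hmb : MeasurableSet {y : ℝ | u < y * b} := measurableSet_lt (by fun_prop) (by fun_prop)
    have hsub : {y : ℝ | u < y * b} ≤ᵐ[radialMeasure α] {y | u < y * a} := by
      filter_upwards [radialMeasure_ae_pos α] with y hy hmem
      have h3 : u < y * b := hmem
      change u < y * a
      nlinarith
    have hd : radialMeasure α ({y | u < y * a} \ {y | u < y * b}) =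
        radialMeasure α {y | u < y * a} - radialMeasure α {y | u < y * b} := by
      rw [← measure_sdiff_add_inter {y | u < y * a} hmb (μ := radialMeasure α)]
      have : radialMeasure α ({y | u < y * a} ∩ {y | u < y * b}) =
          radialMeasure α {y | u < y * b} := by
        refine measure_congr ?_
        filter_upwards [hsub] with y hy
        exact propext ⟨fun h => h.2, fun h => ⟨hy h, h⟩⟩
      rw [this, ENNReal.add_sub_cancel_right]
      rw [radialMeasure_setOf_lt_mul S.index_pos hu]
      exact ENNReal.ofReal_ne_top
    rw [hd, radialMeasure_setOf_lt_mul S.index_pos hu, radialMeasure_setOf_lt_mul S.index_pos hu,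
      max_eq_left hb, max_eq_left (by linarith), ← ENNReal.ofReal_sub _ (by positivity), hea,
      ENNReal.ofReal_rpow_of_nonneg (by linarith) (le_max_right _ _),
      ← ENNReal.ofReal_mul (by positivity)]
    refine ENNReal.ofReal_le_ofReal ?_
    have := rpow_sub_rpow_le S.index_pos hb (by linarith) (by linarith) (le_refl a) (by linarith)
    have hu' : 0 ≤ u ^ (-α) := by positivity
    nlinarith
  refine ne_top_of_le_ne_top ?_ (lintegral_mono_ae hle)
  rw [lintegral_const_mul' _ _ ENNReal.ofReal_ne_top]
  exact ENNReal.mul_ne_top ENNReal.ofReal_ne_top (S.lintegral_forwardSum_rpow hmom)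

/-- Mass transport of a crossing of u at time 0 counts all crossings along an anchored path. A path
with total sum above u has at least one, so the crossing mass dominates. This finiteness supplies
the dominating functions for the later limits. -/
theorem tailMeasure_anchor_totalSum_ne_top {xs : ℕ → ℝ} (hlim : Tendsto xs atTop atTop)
    (hC : ClusterBound P X xs)
    (hmom : 1 < α → ∫⁻ ω, (∑' i : ℕ, ‖Θ (i + 1) ω‖ₑ) ^ (α - 1) ∂P' < ∞) {u : ℝ} (hu : 0 < u) :
    (tailMeasure P' Θ α).restrict (anchor d) {x | ENNReal.ofReal u < totalSum x} ≠ ∞ := by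
  have hm : MeasurableSet {x : ℤ → E d | ENNReal.ofReal u < forwardSum 0 x ∧
      forwardSum 1 x ≤ ENNReal.ofReal u} :=
    (measurableSet_lt measurable_const (measurable_forwardSum 0)).inter
      (measurableSet_le (measurable_forwardSum 1) measurable_const)
  have hmt : MeasurableSet {x : ℤ → E d | ENNReal.ofReal u < totalSum x} :=
    measurableSet_lt measurable_const measurable_totalSum
  have key := S.lintegral_eq_anchor hlim hC (measurable_one.indicator hm)
    fun x hx => Set.indicator_of_notMem (fun hc => by
      have h1 := hc.1
      rw [forwardSum_eq_add, hx, enorm_zero, zero_add, zero_add] at h1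
      exact absurd hc.2 (not_le.2 h1)) _
  rw [lintegral_indicator_one hm] at key
  refine ne_top_of_le_ne_top (S.tailMeasure_crossing_ne_top hlim hC hmom hu) ?_
  rw [key, ← lintegral_indicator_one hmt]
  have hf : ∀ᵐ x ∂tailMeasure P' Θ α, forwardSum 0 x ≠ ∞ :=
    S.ae_tailMeasure_of_ae (p := fun x => forwardSum 0 x ≠ ∞)
      (measurableSet_eq_fun (measurable_forwardSum 0) measurable_const).compl
      (fun c x _ hx => by
        rw [forwardSum_smul]; exact ENNReal.mul_ne_top enorm_ne_top hx)
      (S.ae_forwardSum hlim hC hmom)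
  refine lintegral_mono_ae ?_
  filter_upwards [ae_restrict_of_ae hf] with x hx
  by_cases hxu : ENNReal.ofReal u < totalSum x
  · rw [Set.indicator_of_mem (s := {x : ℤ → E d | ENNReal.ofReal u < totalSum x}) hxu]
    obtain ⟨m, hm1, hm2⟩ := exists_crossing hx (ENNReal.ofReal_pos.2 hu) hxu
    refine le_trans ?_ (ENNReal.le_tsum m)
    have hmem : shift m x ∈ {x : ℤ → E d | ENNReal.ofReal u < forwardSum 0 x ∧
        forwardSum 1 x ≤ ENNReal.ofReal u} := by
      change ENNReal.ofReal u < forwardSum 0 (shift m x) ∧ forwardSum 1 (shift m x) ≤ _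
      rw [forwardSum_shift, forwardSum_shift, zero_add, add_comm 1 m]
      exact ⟨hm1, hm2⟩
    rw [Set.indicator_of_mem hmem]
    exact le_rfl
  · rw [Set.indicator_of_notMem (s := {x : ℤ → E d | ENNReal.ofReal u < totalSum x}) hxu]
    exact zero_le

/-- The anchored paths with infinite total sum form a set of finite mass that is invariant under
multiplication by 2. Scaling multiplies the mass by 2^α > 1, so it is 0. -/
theorem ae_totalSum {xs : ℕ → ℝ} (hlim : Tendsto xs atTop atTop) (hC : ClusterBound P X xs)
    (hmom : 1 < α → ∫⁻ ω, (∑' i : ℕ, ‖Θ (i + 1) ω‖ₑ) ^ (α - 1) ∂P' < ∞) :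
    ∀ᵐ x ∂tailMeasure P' Θ α, totalSum x ≠ ∞ := by
  refine S.ae_totalSum_of_anchor hlim hC ?_
  have hmt : MeasurableSet {x : ℤ → E d | totalSum x = ∞} :=
    measurableSet_eq_fun measurable_totalSum measurable_const
  set A : Set (ℤ → E d) := {x | totalSum x = ∞} ∩ anchor d
  have hA : MeasurableSet A := hmt.inter (measurableSet_anchor d)
  have hfin : tailMeasure P' Θ α A ≠ ∞ := by
    have h := S.tailMeasure_anchor_totalSum_ne_top hlim hC hmom one_pos
    rw [Measure.restrict_apply (measurableSet_lt measurable_const measurable_totalSum)] at h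
    refine ne_top_of_le_ne_top h (measure_mono fun x hx => ⟨?_, hx.2⟩)
    have : totalSum x = ∞ := hx.1
    change _ < totalSum x
    rw [this]
    exact ENNReal.ofReal_lt_top
  have hs := tailMeasure_smul_set (P' := P') S.measurable_Θ S.index_pos two_pos hA
  have hAA : {x : ℤ → E d | (fun t => (2 : ℝ) • x t) ∈ A} = A := by
    ext x
    simp only [A, Set.mem_ofPred_eq, Set.mem_inter_iff, smul_mem_anchor two_pos, totalSum_smul]
    refine and_congr_left fun _ => ?_
    rw [ENNReal.mul_eq_top]
    simp
  rw [hAA] at hs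
  have h0 : tailMeasure P' Θ α A = 0 := by
    by_contra hne
    have h2 : (1 : ℝ) < 2 ^ α := Real.one_lt_rpow one_lt_two S.index_pos
    have h3 : ENNReal.ofReal (2 ^ α) = 1 := by
      have := (ENNReal.mul_left_inj hne hfin).1 ((one_mul _).trans hs)
      exact this.symm
    rw [← ENNReal.ofReal_one, ENNReal.ofReal_eq_ofReal_iff (by positivity) zero_le_one] at h3
    linarith
  rw [ae_restrict_iff' (measurableSet_anchor d)]
  filter_upwards [measure_eq_zero_iff_ae_notMem.1 h0] with x hx hmem htop
  exact hx ⟨htop, hmem⟩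

end SpectralSetup

end HeavyTail

/-! ### Telescoping of increments along a cluster -/

namespace HeavyTail

theorem summable_norm_of_totalSum {d : ℕ} {x : ℤ → E d} (h : totalSum x ≠ ∞) :
    Summable fun t => ‖x t‖ := by
  refine (ENNReal.summable_toReal h).congr fun t => ?_
  simp

theorem tsum_nat_add_eq {d : ℕ} (f : ℤ → E d) (m : ℤ) :
    ∑' i : ℕ, f (i + m) = ∑' t : ℤ, (Set.Ici m).indicator f t := by
  have hinj : Function.Injective fun i : ℕ => (i : ℤ) + m := fun i j h => by simpa using h
  rw [← hinj.tsum_eq (f := (Set.Ici m).indicator f)]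
  · refine tsum_congr fun i => ?_
    rw [Set.indicator_of_mem]
    simp
  · intro t ht
    have : t ∈ Set.Ici m := Set.mem_of_indicator_ne_zero ht
    exact ⟨(t - m).toNat, by have := Set.mem_Ici.1 this; simp only; omega⟩

theorem tendsto_tsum_nat_sub {d : ℕ} {f : ℤ → E d} (hf : Summable fun t => ‖f t‖) :
    Tendsto (fun N : ℕ => ∑' i : ℕ, f (i + -(N : ℤ))) atTop (𝓝 (∑' t, f t)) := by
  simp only [tsum_nat_add_eq]
  refine tendsto_tsum_of_dominated_convergence hf (fun t => ?_) (.of_forall fun N t => ?_)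
  · refine tendsto_const_nhds.congr' ?_
    filter_upwards [eventually_ge_atTop t.natAbs] with N hN
    rw [Set.indicator_of_mem]
    simp only [Set.mem_Ici]; omega
  · exact norm_indicator_le_norm_self _ _

theorem tendsto_tsum_nat_add_zero {d : ℕ} {f : ℤ → E d} (hf : Summable fun t => ‖f t‖) :
    Tendsto (fun N : ℕ => ∑' i : ℕ, f (i + (N : ℤ))) atTop (𝓝 0) := by
  simp only [tsum_nat_add_eq]
  rw [← tsum_zero (α := E d) (β := ℤ)]
  refine tendsto_tsum_of_dominated_convergence hf (fun t => ?_) (.of_forall fun N t => ?_)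
  · refine tendsto_const_nhds.congr' ?_
    filter_upwards [eventually_gt_atTop t.natAbs] with N hN
    rw [Set.indicator_of_notMem]
    simp only [Set.mem_Ici]; omega
  · exact norm_indicator_le_norm_self _ _

theorem sum_Ico_neg_telescope (h : ℤ → ℝ) (N : ℕ) :
    ∑ m ∈ Finset.Ico (-(N : ℤ)) N, (h m - h (m + 1)) = h (-N) - h N := by
  induction N with
  | zero => simp
  | succ N ih =>
    have e : Finset.Ico (-((N + 1 : ℕ) : ℤ)) (N + 1 : ℕ) =
        insert (-((N + 1 : ℕ) : ℤ)) (insert (N : ℤ) (Finset.Ico (-(N : ℤ)) N)) := by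
      ext t; simp only [Finset.mem_Ico, Finset.mem_insert]; omega
    rw [e, Finset.sum_insert, Finset.sum_insert, ih]
    · have : -((N + 1 : ℕ) : ℤ) + 1 = -(N : ℤ) := by push_cast; ring
      rw [this]
      push_cast
      ring
    · simp
    · simp only [Finset.mem_insert, Finset.mem_Ico]; omega

/-- The increment of `q` of the forward sum of `τ` along a path when the time `0` is added. -/
noncomputable def increment {d : ℕ} (q : E d → ℝ) (τ : E d → E d) (x : ℤ → E d) : ℝ :=
  q (∑' i : ℕ, τ (x i)) - q (∑' i : ℕ, τ (x (i + 1)))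

theorem measurable_increment {d : ℕ} {q : E d → ℝ} {τ : E d → E d} (hq : Measurable q)
    (hτ : Measurable τ) : Measurable (increment q τ) := by
  unfold increment
  fun_prop

theorem increment_eq_zero {d : ℕ} {q : E d → ℝ} {τ : E d → E d} (hτ : ∀ z, ‖τ z‖ ≤ ‖z‖)
    {x : ℤ → E d} (hx : Summable fun t => ‖x t‖) (h0 : τ (x 0) = 0) : increment q τ x = 0 := by
  have hs : Summable fun i : ℕ => τ (x i) :=
    .of_norm (.of_nonneg_of_le (fun _ => norm_nonneg _) (fun i => hτ _)
      (hx.comp_injective Nat.cast_injective))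
  unfold increment
  rw [hs.tsum_eq_zero_add]
  simp [h0]

/-- With h(m) the value of q at the forward sum from m, the increment at m is h(m) - h(m+1). Far in
the past h tends to q of the total sum, by continuity there; far in the future the forward sums are
near 0, where q vanishes. -/
theorem hasSum_increment {d : ℕ} {q : E d → ℝ} {τ : E d → E d} (hτ : ∀ z, ‖τ z‖ ≤ ‖z‖)
    (hq0 : ∀ᶠ z in 𝓝 0, q z = 0) {x : ℤ → E d} (hx : Summable fun t => ‖x t‖)
    (hqc : ContinuousAt q (∑' t, τ (x t))) (hs : Summable fun m : ℤ => increment q τ (shift m x)) :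
    ∑' m : ℤ, increment q τ (shift m x) = q (∑' t, τ (x t)) := by
  have hsτ : Summable fun t => ‖τ (x t)‖ :=
    .of_nonneg_of_le (fun _ => norm_nonneg _) (fun t => hτ _) hx
  set h : ℤ → ℝ := fun m => q (∑' i : ℕ, τ (x (i + m))) with hh
  have hinc : ∀ m, increment q τ (shift m x) = h m - h (m + 1) := fun m => by
    simp only [increment, shift_apply, hh]
    congr 4
    ext1 i
    rw [show (i : ℤ) + 1 + m = i + (m + 1) by ring]
  have hq00 : q 0 = 0 := hq0.self_of_nhds
  have l1 : Tendsto (fun N : ℕ => h (-(N : ℤ))) atTop (𝓝 (q (∑' t, τ (x t)))) :=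
    hqc.tendsto.comp (tendsto_tsum_nat_sub hsτ)
  have l2 : Tendsto (fun N : ℕ => h N) atTop (𝓝 0) := by
    refine tendsto_const_nhds.congr' ?_
    filter_upwards [(tendsto_tsum_nat_add_zero hsτ).eventually hq0] with N hN using hN.symm
  -- Summability is given, so the sum may be evaluated along the windows [-N, N), where it
  -- telescopes.
  refine tendsto_nhds_unique (hs.hasSum.comp (Finset.tendsto_Ico_neg (R := ℤ))) ?_
  have l3 := l1.sub l2
  rw [sub_zero] at l3
  refine l3.congr fun N => ?_
  simp only [Function.comp, hinc]
  exact (sum_Ico_neg_telescope h N).symm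

namespace SpectralSetup

set_option linter.unusedSectionVars false

variable {Ω Ω' : Type*} [MeasurableSpace Ω] [MeasurableSpace Ω'] {P : Measure Ω} {P' : Measure Ω'}
  {d : ℕ} {X : ℤ → Ω → E d} {Θ : ℤ → Ω' → E d} {α : ℝ}
  [IsProbabilityMeasure P] [IsProbabilityMeasure P'] (S : SpectralSetup P P' X Θ α)
include S

/-- The one-sided increments integrate to the functional of the whole cluster. -/
theorem integral_increment {xs : ℕ → ℝ} (hlim : Tendsto xs atTop atTop)
    (hC : ClusterBound P X xs)
    (hmom : 1 < α → ∫⁻ ω, (∑' i : ℕ, ‖Θ (i + 1) ω‖ₑ) ^ (α - 1) ∂P' < ∞)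
    {q : E d → ℝ} {τ : E d → E d} (hq : Measurable q) (hτm : Measurable τ)
    (hτ : ∀ z, ‖τ z‖ ≤ ‖z‖) (hq0 : ∀ᶠ z in 𝓝 0, q z = 0)
    (hqc : ∀ᵐ x ∂(tailMeasure P' Θ α).restrict (anchor d), ContinuousAt q (∑' t, τ (x t)))
    (hint : Integrable (increment q τ) (tailMeasure P' Θ α)) :
    ∫ x, increment q τ x ∂tailMeasure P' Θ α =
      ∫ x in anchor d, q (∑' t, τ (x t)) ∂tailMeasure P' Θ α := by
  set ν := tailMeasure P' Θ α
  have hsum := S.ae_totalSum hlim hC hmom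
  have hM := measurableSet_anchor d
  -- Mass transport holds for nonnegative functions, so positive and negative parts are transported
  -- separately. Setting the function to 0 off paths of finite total sum makes it vanish whenever
  -- x_0 = 0.
  have key : ∀ f : (ℤ → E d) → ℝ, Measurable f →
      (∀ x, (Summable fun t => ‖x t‖) → τ (x 0) = 0 → f x = 0) → Integrable f ν →
      ∫⁻ x, ENNReal.ofReal (f x) ∂ν =
        ∫⁻ x in anchor d, ∑' m : ℤ, ENNReal.ofReal (f (shift m x)) ∂ν := by
    intro f hf hf0 _
    have hms : MeasurableSet {x : ℤ → E d | totalSum x ≠ ∞} :=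
      (measurableSet_eq_fun measurable_totalSum measurable_const).compl
    have h := S.lintegral_eq_anchor hlim hC
      (D := ({x | totalSum x ≠ ∞} : Set (ℤ → E d)).indicator fun x => ENNReal.ofReal (f x))
      (hf.ennreal_ofReal.indicator hms) fun x hx => by
        by_cases hx' : totalSum x ≠ ∞
        · refine (Set.indicator_of_mem (s := {x : ℤ → E d | totalSum x ≠ ∞}) hx' _).trans ?_
          have h0 : τ (x 0) = 0 := by
            have := hτ (x 0)
            rw [hx, norm_zero] at this
            rw [hx]
            exact norm_le_zero_iff.1 this
          rw [hf0 x (summable_norm_of_totalSum hx') h0, ENNReal.ofReal_zero]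
        · exact Set.indicator_of_notMem (s := {x : ℤ → E d | totalSum x ≠ ∞}) hx' _
    refine Eq.trans (lintegral_congr_ae ?_) (h.trans (lintegral_congr_ae ?_))
    · filter_upwards [hsum] with x hx
      exact (Set.indicator_of_mem (s := {x : ℤ → E d | totalSum x ≠ ∞}) hx
        fun x => ENNReal.ofReal (f x)).symm
    · filter_upwards [ae_restrict_of_ae hsum] with x hx
      refine tsum_congr fun m => ?_
      exact Set.indicator_of_mem (s := {x : ℤ → E d | totalSum x ≠ ∞})
        (show totalSum (shift m x) ≠ ∞ by rwa [totalSum_shift])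
        fun x => ENNReal.ofReal (f x)
  have hDm := measurable_increment hq hτm
  have hpos := key _ hDm (fun x hx h0 => increment_eq_zero hτ hx h0) hint
  have hneg := key _ hDm.neg (fun x hx h0 => by
    simp only [Pi.neg_apply]; rw [increment_eq_zero hτ hx h0, neg_zero]) hint.neg
  simp only [Pi.neg_apply] at hneg
  have hm1 : Measurable fun x : ℤ → E d => ∑' m : ℤ,
      ENNReal.ofReal (increment q τ (shift m x)) :=
    Measurable.tsum fun m => (hDm.comp (measurable_shift m)).ennreal_ofReal
  have hm2 : Measurable fun x : ℤ → E d => ∑' m : ℤ,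
      ENNReal.ofReal (-increment q τ (shift m x)) :=
    Measurable.tsum fun m => (hDm.comp (measurable_shift m)).neg.ennreal_ofReal
  have hf1 : ∫⁻ x in anchor d, ∑' m : ℤ, ENNReal.ofReal (increment q τ (shift m x)) ∂ν ≠ ∞ := by
    rw [← hpos]; exact hint.lintegral_lt_top.ne
  have hf2 : ∫⁻ x in anchor d, ∑' m : ℤ, ENNReal.ofReal (-increment q τ (shift m x)) ∂ν ≠ ∞ := by
    rw [← hneg]; exact hint.neg.lintegral_lt_top.ne
  have ha1 := ae_lt_top hm1 hf1
  have ha2 := ae_lt_top hm2 hf2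
  rw [integral_eq_lintegral_pos_part_sub_lintegral_neg_part hint, hpos, hneg,
    ← integral_toReal hm1.aemeasurable ha1, ← integral_toReal hm2.aemeasurable ha2,
    ← integral_sub (integrable_toReal_of_lintegral_ne_top hm1.aemeasurable hf1)
      (integrable_toReal_of_lintegral_ne_top hm2.aemeasurable hf2)]
  refine integral_congr_ae ?_
  filter_upwards [ha1, ha2, hqc, ae_restrict_of_ae hsum] with x h1 h2 h3 h4
  have s1 := ENNReal.hasSum_toReal h1.ne
  have s2 := ENNReal.hasSum_toReal h2.ne
  have e : ∀ m : ℤ, (ENNReal.ofReal (increment q τ (shift m x))).toReal -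
      (ENNReal.ofReal (-increment q τ (shift m x))).toReal = increment q τ (shift m x) := by
    intro m
    rw [ENNReal.toReal_ofReal', ENNReal.toReal_ofReal']
    rcases le_total 0 (increment q τ (shift m x)) with h | h
    · rw [max_eq_left h, max_eq_right (by linarith), sub_zero]
    · rw [max_eq_right h, max_eq_left (by linarith)]; ring
  have s3 := s1.sub s2
  simp only [e] at s3
  rw [← ENNReal.tsum_toReal_eq fun m => ENNReal.ne_top_of_tsum_ne_top h1.ne m,
    ← ENNReal.tsum_toReal_eq fun m => ENNReal.ne_top_of_tsum_ne_top h2.ne m] at s3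
  rw [← s3.tsum_eq]
  exact hasSum_increment hτ hq0 (summable_norm_of_totalSum h4) h3 s3.summable

end SpectralSetup

end HeavyTail

namespace HeavyTail

/-! ### Large deviations of sums of truncated variables -/

/-- The finite horizon version of `increment`. -/
noncomputable def partialIncrement {d : ℕ} (q : E d → ℝ) (τ : E d → E d) (k : ℕ) (x : ℤ → E d) :
    ℝ :=
  q (∑ i ∈ Finset.range (k + 1), τ (x i)) - q (∑ i ∈ Finset.range k, τ (x (i + 1)))

section

variable {d : ℕ} {q : E d → ℝ} {τ : E d → E d} {B ε : ℝ}

theorem measurable_partialIncrement (hq : Measurable q) (hτ : Measurable τ) (k : ℕ) :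
    Measurable (partialIncrement q τ k) := by
  unfold partialIncrement
  fun_prop

theorem continuous_partialIncrement (hq : Continuous q) (hτ : Continuous τ) (k : ℕ) :
    Continuous (partialIncrement q τ k) := by
  unfold partialIncrement
  fun_prop

theorem abs_partialIncrement_le (hB : ∀ z, |q z| ≤ B) (k : ℕ) (x : ℤ → E d) :
    |partialIncrement q τ k x| ≤ 2 * B := by
  refine (abs_sub _ _).trans ?_
  linarith [hB (∑ i ∈ Finset.range (k + 1), τ (x i)), hB (∑ i ∈ Finset.range k, τ (x (i + 1)))]

theorem partialIncrement_eq_zero (hτ0 : ∀ z, ‖z‖ ≤ ε → τ z = 0) {x : ℤ → E d} (hx : ‖x 0‖ ≤ ε)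
    (k : ℕ) : partialIncrement q τ k x = 0 := by
  unfold partialIncrement
  rw [Finset.sum_range_succ']
  simp [hτ0 _ hx]

theorem partialIncrement_congr (hτ0 : ∀ z, ‖z‖ ≤ ε → τ z = 0) {k m : ℕ} (hkm : k ≤ m)
    {x : ℤ → E d} (hx : ∀ i : ℤ, k ≤ i → i ≤ m → ‖x i‖ ≤ ε) :
    partialIncrement q τ m x = partialIncrement q τ k x := by
  have h1 : ∑ i ∈ Finset.range (m + 1), τ (x i) = ∑ i ∈ Finset.range (k + 1), τ (x i) := by
    symm
    refine Finset.sum_subset (fun i hi => by simp only [Finset.mem_range] at *; omega) ?_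
    intro i hi hi'
    simp only [Finset.mem_range] at hi hi'
    exact hτ0 _ (hx _ (by omega) (by omega))
  have h2 : ∑ i ∈ Finset.range m, τ (x (i + 1)) = ∑ i ∈ Finset.range k, τ (x (i + 1)) := by
    symm
    refine Finset.sum_subset (fun i hi => by simp only [Finset.mem_range] at *; omega) ?_
    intro i hi hi'
    simp only [Finset.mem_range] at hi hi'
    exact hτ0 _ (hx _ (by omega) (by omega))
  rw [partialIncrement, h1, h2, partialIncrement]

theorem dependsOn_partialIncrement (k : ℕ) :
    DependsOn (partialIncrement q τ k) (Set.Icc (-(k : ℤ)) k) := by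
  intro x y hxy
  unfold partialIncrement
  congr 2
  · refine Finset.sum_congr rfl fun i hi => ?_
    rw [Finset.mem_range] at hi
    rw [hxy i (by constructor <;> omega)]
  · refine Finset.sum_congr rfl fun i hi => ?_
    rw [Finset.mem_range] at hi
    rw [hxy (i + 1) (by constructor <;> omega)]

end

theorem sum_Icc_one_eq_sum_range {M : Type*} [AddCommMonoid M] (φ : ℤ → M) (n : ℕ) :
    ∑ i ∈ Finset.Icc (1 : ℤ) n, φ i = ∑ i ∈ Finset.range n, φ (i + 1) := by
  refine (Finset.sum_bij (fun (i : ℕ) _ => (i : ℤ) + 1) ?_ ?_ ?_ ?_).symm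
  · intro i hi; simp only [Finset.mem_range, Finset.mem_Icc] at *; omega
  · intro i _ j _ h; simpa using h
  · intro t ht
    rw [Finset.mem_Icc] at ht
    exact ⟨(t - 1).toNat, by rw [Finset.mem_range]; omega, by omega⟩
  · intro i _; rfl

/-- Replacement of every horizon m by k. The fewer than k+1 short horizons are compared on the
larger event A₀, whose total cost is of order k and not n; the long ones differ from k only on the
rare event A. -/
theorem abs_sum_integral_sub_le {Ω : Type*} [MeasurableSpace Ω] {P : Measure Ω}
    [IsProbabilityMeasure P] {g : ℕ → Ω → ℝ} {B : ℝ} (hgm : ∀ m, Measurable (g m))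
    (hgB : ∀ m ω, |g m ω| ≤ 2 * B) {A A₀ : Set Ω} (hA : MeasurableSet A) (hA₀ : MeasurableSet A₀)
    {k n : ℕ} (h₀ : ∀ m, ∀ ω ∉ A₀, g m ω = g k ω)
    (h : ∀ m, k ≤ m → m < n → ∀ ω ∉ A, g m ω = g k ω) :
    |∑ m ∈ Finset.range n, ∫ ω, g m ω ∂P - n * ∫ ω, g k ω ∂P| ≤
      4 * B * (k * P.real A₀ + n * P.real A) := by
  have hi : ∀ m, Integrable (g m) P := fun m =>
    .of_bound (hgm m).aestronglyMeasurable (2 * B) (.of_forall fun ω => hgB m ω)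
  have hB0 : 0 ≤ B := by
    have : Nonempty Ω := nonempty_of_isProbabilityMeasure P
    linarith [(abs_nonneg _).trans (hgB 0 (Classical.arbitrary Ω))]
  have hdiff : ∀ (m : ℕ) (s : Set Ω), MeasurableSet s → (∀ ω, ω ∉ s → g m ω = g k ω) →
      |∫ ω, g m ω ∂P - ∫ ω, g k ω ∂P| ≤ 4 * B * P.real s := by
    intro m s hs h
    rw [← integral_sub (hi m) (hi k)]
    refine (abs_integral_le_integral_abs).trans ?_
    have : 4 * B * P.real s = ∫ ω, s.indicator (fun _ => 4 * B) ω ∂P := by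
      rw [integral_indicator_const _ hs, smul_eq_mul, mul_comm]
    rw [this]
    refine integral_mono ((hi m).sub (hi k)).abs ((integrable_const _).indicator hs) fun ω => ?_
    by_cases hω : ω ∈ s
    · rw [Set.indicator_of_mem hω]
      refine (abs_sub _ _).trans ?_
      linarith [hgB m ω, hgB k ω]
    · rw [Set.indicator_of_notMem hω]
      simp only [h ω hω, sub_self, abs_zero, le_refl]
  have e1 : (n : ℝ) * ∫ ω, g k ω ∂P = ∑ m ∈ Finset.range n, ∫ ω, g k ω ∂P := by simp
  rw [e1, ← Finset.sum_sub_distrib]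
  refine (Finset.abs_sum_le_sum_abs _ _).trans ?_
  have hle : ∀ m ∈ Finset.range n, |∫ ω, g m ω ∂P - ∫ ω, g k ω ∂P| ≤
      (if m < k then 4 * B * P.real A₀ else 0) + 4 * B * P.real A := by
    intro m hm
    by_cases hmk : m < k
    · rw [if_pos hmk]
      exact (hdiff m A₀ hA₀ (h₀ m)).trans (le_add_of_nonneg_right (by positivity))
    · rw [if_neg hmk, zero_add]
      exact hdiff m A hA (h m (not_lt.1 hmk) (Finset.mem_range.1 hm))
  refine (Finset.sum_le_sum hle).trans ?_
  rw [Finset.sum_add_distrib, ← Finset.sum_filter, Finset.sum_const, Finset.sum_const,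
    Finset.card_range, nsmul_eq_mul, nsmul_eq_mul]
  have hcard : (((Finset.range n).filter (· < k)).card : ℝ) ≤ k := by
    exact_mod_cast (Finset.card_le_card (t := Finset.range k) fun i hi => by
      simp only [Finset.mem_filter, Finset.mem_range] at hi ⊢; exact hi.2).trans_eq
      (Finset.card_range k)
  calc _ ≤ (k : ℝ) * (4 * B * P.real A₀) + n * (4 * B * P.real A) := by gcongr
    _ = _ := by ring

namespace SpectralSetup

set_option linter.unusedSectionVars false

variable {Ω Ω' : Type*} [MeasurableSpace Ω] [MeasurableSpace Ω'] {P : Measure Ω} {P' : Measure Ω'}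
  {d : ℕ} {X : ℤ → Ω → E d} {Θ : ℤ → Ω' → E d} {α : ℝ}
  [IsProbabilityMeasure P] [IsProbabilityMeasure P'] (S : SpectralSetup P P' X Θ α)
include S

/-- The expectation of a functional of a sum, as a sum of expected increments. -/
theorem integral_sum_eq {q : E d → ℝ} {τ : E d → E d} (hq : Measurable q) (hτ : Measurable τ)
    {B : ℝ} (hB : ∀ z, |q z| ≤ B) (hq0 : q 0 = 0) (r : ℝ) (n : ℕ) :
    ∫ ω, q (∑ i ∈ Finset.Icc (1 : ℤ) n, τ (r⁻¹ • X i ω)) ∂P =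
      ∑ m ∈ Finset.range n, ∫ ω, partialIncrement q τ m (fun t => r⁻¹ • X t ω) ∂P := by
  have hX := S.measurable_X
  -- X_1 + … + X_m and X_0 + … + X_{m-1} have the same law after truncation and scaling, which is
  -- what makes the expectations telescope.
  have hsh : ∀ m : ℕ, ∫ ω, q (∑ i ∈ Finset.range m, τ (r⁻¹ • X (i + 1) ω)) ∂P =
      ∫ ω, q (∑ i ∈ Finset.range m, τ (r⁻¹ • X i ω)) ∂P := fun m => by
    have hm : Measurable fun x : ℤ → E d => q (∑ i ∈ Finset.range m, τ (r⁻¹ • x i)) := by fun_prop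
    exact S.integral_shift hm 1
  have hint : ∀ φ : Ω → E d, Measurable φ → Integrable (fun ω => q (φ ω)) P := fun φ hφ =>
    .of_bound (hq.comp hφ).aestronglyMeasurable B (.of_forall fun ω => hB _)
  simp only [sum_Icc_one_eq_sum_range]
  rw [hsh]
  induction n with
  | zero => simp [hq0]
  | succ n ih =>
    rw [Finset.sum_range_succ, ← ih]
    have : ∫ ω, partialIncrement q τ n (fun t => r⁻¹ • X t ω) ∂P =
        ∫ ω, q (∑ i ∈ Finset.range (n + 1), τ (r⁻¹ • X i ω)) ∂P -
          ∫ ω, q (∑ i ∈ Finset.range n, τ (r⁻¹ • X (i + 1) ω)) ∂P :=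
      integral_sub (hint _ (by fun_prop)) (hint _ (by fun_prop))
    rw [this, hsh]
    ring

/-- Dominated convergence: all increments are bounded by 2B and live on ‖x_0‖ > ε, a set of finite
mass, and the forward sums converge almost everywhere. -/
theorem tendsto_integral_partialIncrement {xs : ℕ → ℝ} (hlim : Tendsto xs atTop atTop)
    (hC : ClusterBound P X xs)
    (hmom : 1 < α → ∫⁻ ω, (∑' i : ℕ, ‖Θ (i + 1) ω‖ₑ) ^ (α - 1) ∂P' < ∞)
    {q : E d → ℝ} {τ : E d → E d} (hq : Continuous q) {B : ℝ} (hB : ∀ z, |q z| ≤ B)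
    (hτc : Continuous τ) (hτ : ∀ z, ‖τ z‖ ≤ ‖z‖) {ε : ℝ} (hε : 0 < ε)
    (hτ0 : ∀ z, ‖z‖ ≤ ε → τ z = 0) :
    Tendsto (fun k => ∫ x, partialIncrement q τ k x ∂tailMeasure P' Θ α) atTop
        (𝓝 (∫ x, increment q τ x ∂tailMeasure P' Θ α)) ∧
      Integrable (increment q τ) (tailMeasure P' Θ α) := by
  have hB0 : 0 ≤ 2 * B := by linarith [(abs_nonneg _).trans (hB 0)]
  have hdom : Integrable (({x : ℤ → E d | ε < ‖x 0‖} : Set _).indicator fun _ => 2 * B)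
      (tailMeasure P' Θ α) := by
    refine (integrable_indicator_iff (measurableSet_lt_norm ε 0)).2 (integrableOn_const ?_)
    rw [S.tailMeasure_norm_zero hε]; exact ENNReal.ofReal_ne_top
  have hsummable := S.ae_totalSum hlim hC hmom
  have hbound : ∀ (D : (ℤ → E d) → ℝ) (x : ℤ → E d), |D x| ≤ 2 * B → (‖x 0‖ ≤ ε → D x = 0) →
      ‖D x‖ ≤ ({x : ℤ → E d | ε < ‖x 0‖} : Set _).indicator (fun _ => 2 * B) x := by
    intro D x h1 h2
    by_cases hx : ε < ‖x 0‖
    · rw [Set.indicator_of_mem (s := {x : ℤ → E d | ε < ‖x 0‖}) hx]; exact h1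
    · rw [Set.indicator_of_notMem (s := {x : ℤ → E d | ε < ‖x 0‖}) hx, h2 (not_lt.1 hx), norm_zero]
  constructor
  · refine tendsto_integral_of_dominated_convergence _
      (fun k => (measurable_partialIncrement hq.measurable hτc.measurable k).aestronglyMeasurable)
      hdom (fun k => .of_forall fun x => hbound _ x (abs_partialIncrement_le hB k x)
        fun h => partialIncrement_eq_zero hτ0 h k) ?_
    filter_upwards [hsummable] with x hx
    have hs := summable_norm_of_totalSum hx
    have hs0 : Summable fun i : ℕ => τ (x i) := .of_norm (.of_nonneg_of_le
      (fun _ => norm_nonneg _) (fun i => hτ _) (hs.comp_injective Nat.cast_injective))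
    have hs1 : Summable fun i : ℕ => τ (x (i + 1)) := by
      exact_mod_cast (summable_nat_add_iff 1).2 hs0
    exact ((hq.tendsto _).comp (hs0.hasSum.tendsto_sum_nat.comp (tendsto_add_atTop_nat 1))).sub
      ((hq.tendsto _).comp hs1.hasSum.tendsto_sum_nat)
  · refine hdom.mono' (measurable_increment hq.measurable hτc.measurable).aestronglyMeasurable ?_
    filter_upwards [hsummable] with x hx
    refine hbound _ x ?_ fun h => increment_eq_zero hτ (summable_norm_of_totalSum hx) (hτ0 _ h)
    refine (abs_sub _ _).trans ?_
    linarith [hB (∑' i : ℕ, τ (x i)), hB (∑' i : ℕ, τ (x (i + 1)))]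

/-- Large deviations for sums of truncated variables. -/
theorem tendsto_truncated {xs : ℕ → ℝ} (hlim : Tendsto xs atTop atTop)
    (hC : ClusterBound P X xs)
    (hmom : 1 < α → ∫⁻ ω, (∑' i : ℕ, ‖Θ (i + 1) ω‖ₑ) ^ (α - 1) ∂P' < ∞)
    {q : E d → ℝ} {τ : E d → E d} (hq : Continuous q) {B : ℝ} (hB : ∀ z, |q z| ≤ B)
    (hq0 : ∀ᶠ z in 𝓝 0, q z = 0)
    (hτc : Continuous τ) (hτ : ∀ z, ‖τ z‖ ≤ ‖z‖) {ε : ℝ} (hε : 0 < ε)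
    (hτ0 : ∀ z, ‖z‖ ≤ ε → τ z = 0) :
    Tendsto (fun n : ℕ => (∫ ω, q (∑ i ∈ Finset.Icc (1 : ℤ) n, τ ((xs n)⁻¹ • X i ω)) ∂P) /
        (n * P.real {ω | xs n < ‖X 0 ω‖})) atTop
      (𝓝 (∫ x in anchor d, q (∑' t, τ (x t)) ∂tailMeasure P' Θ α)) := by
  obtain ⟨hk, hint⟩ := S.tendsto_integral_partialIncrement hlim hC hmom hq hB hτc hτ hε hτ0
  rw [← S.integral_increment hlim hC hmom hq.measurable hτc.measurable hτ hq0
    (.of_forall fun x => hq.continuousAt) hint]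
  have hB0 : 0 ≤ B := (abs_nonneg _).trans (hB 0)
  refine tendsto_of_approx fun e he => ?_
  -- Short horizons and late exceedances each cost at most 4B times this fraction of nP(‖X_0‖ > x),
  -- together at most e; the summand 1 covers B = 0.
  have hη : 0 < e / (4 * B + 1) / 2 := by positivity
  obtain ⟨k, hk1, hk2⟩ := ((hC ε hε _ hη).and
    ((Metric.tendsto_nhds.1 hk) e he)).exists
  have hD : Tendsto (fun n => (∫ ω, partialIncrement q τ k (fun t => (xs n)⁻¹ • X t ω) ∂P) /
      P.real {ω | xs n < ‖X 0 ω‖}) atTop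
      (𝓝 (∫ x, partialIncrement q τ k x ∂tailMeasure P' Θ α)) := by
    have hDc := continuous_partialIncrement hq hτc k
    have hDb := abs_partialIncrement_le (τ := τ) hB k
    have hDd := dependsOn_partialIncrement (q := q) (τ := τ) k
    have hD0 := fun x hx => partialIncrement_eq_zero (q := q) (x := x) hτ0 hx k
    generalize partialIncrement q τ k = D at *
    exact (S.tendsto_tailMeasure_of_vanish hDc hDb hDd hε hD0).comp hlim
  refine ⟨_, _, hD, ?_, ?_⟩
  swap
  · rw [abs_sub_comm]; exact hk2.le
  have hratio := (S.tendsto_tail_ratio hε).comp hlim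
  -- The k short horizons contribute k/n times a converging tail ratio, which vanishes.
  have hkn : Tendsto (fun n : ℕ => (k : ℝ) / n *
      (P.real {ω | ε * xs n < ‖X 0 ω‖} / P.real {ω | xs n < ‖X 0 ω‖})) atTop (𝓝 0) := by
    have := (tendsto_const_div_atTop_nhds_zero_nat (k : ℝ)).mul hratio
    rwa [zero_mul] at this
  filter_upwards [hk1, hkn.eventually (gt_mem_nhds hη), eventually_ge_atTop 1,
    hlim.eventually (eventually_gt_atTop 0)] with n hn1 hn2 hn3 hx0
  rw [S.integral_sum_eq hq.measurable hτc.measurable hB hq0.self_of_nhds]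
  have hp := S.tail_pos (xs n)
  have hn0 : (0 : ℝ) < n := by exact_mod_cast hn3
  have hX := S.measurable_X
  have hnorm : ∀ t ω, ‖(xs n)⁻¹ • X t ω‖ ≤ ε ↔ ‖X t ω‖ ≤ ε * xs n := fun t ω => by
    rw [norm_smul, norm_inv, Real.norm_of_nonneg hx0.le, inv_mul_le_iff₀ hx0, mul_comm]
  -- Off `A0` all increments are 0. Off A no value between times k and n survives the truncation, so
  -- the horizons from k on give the same increment.
  set A := {ω | ε * xs n < ‖X 0 ω‖ ∧ ∃ i ∈ Finset.Icc (k : ℤ) n, ε * xs n < ‖X i ω‖}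
  set A0 := {ω | ε * xs n < ‖X 0 ω‖}
  have hA0 : MeasurableSet A0 := S.measurableSet_norm _ 0
  have hA : MeasurableSet A := by
    refine hA0.inter ?_
    exact measurableSet_exists fun i => (MeasurableSet.const _).inter (S.measurableSet_norm _ i)
  have hpath : Measurable fun ω (t : ℤ) => (xs n)⁻¹ • X t ω := by fun_prop
  obtain ⟨g, hg⟩ : ∃ g : ℕ → Ω → ℝ, ∀ m ω, partialIncrement q τ m (fun t => (xs n)⁻¹ • X t ω) =
    g m ω := ⟨_, fun _ _ => rfl⟩
  have hgm : ∀ m, Measurable (g m) := fun m => by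
    have := (measurable_partialIncrement hq.measurable hτc.measurable m).comp hpath
    exact (funext (hg m) : _ = g m) ▸ this
  have hgB : ∀ m ω, |g m ω| ≤ 2 * B := fun m ω => hg m ω ▸ abs_partialIncrement_le hB m _
  have hg0 : ∀ m, ∀ ω ∉ A0, g m ω = g k ω := fun m ω hω => by
    have h0 := (hnorm 0 ω).2 (not_lt.1 hω)
    have hz := partialIncrement_eq_zero (q := q) (x := fun t => (xs n)⁻¹ • X t ω) hτ0 h0
    rw [← hg, ← hg, hz, hz]
  have hgk : ∀ m, k ≤ m → m < n → ∀ ω ∉ A, g m ω = g k ω := fun m hkm hmn ω hω => by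
    by_cases h0 : ω ∈ A0
    · rw [← hg, ← hg]
      refine partialIncrement_congr hτ0 hkm fun i hik him => (hnorm i ω).2 ?_
      by_contra hc
      exact hω ⟨h0, i, Finset.mem_Icc.2 ⟨hik, by omega⟩, not_le.1 hc⟩
    · exact hg0 m ω h0
  simp only [hg]
  have hsum := abs_sum_integral_sub_le (P := P) hgm hgB hA hA0 hg0 hgk
  have e2 : ∀ a b : ℝ, a / (n * P.real {ω | xs n < ‖X 0 ω‖}) - b / P.real {ω | xs n < ‖X 0 ω‖} =
      (a - n * b) / (n * P.real {ω | xs n < ‖X 0 ω‖}) := fun a b => by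
    field_simp
  rw [e2, abs_div, abs_of_pos (mul_pos hn0 hp), div_le_iff₀ (mul_pos hn0 hp)]
  refine hsum.trans ?_
  clear hsum
  change P.real A ≤ _ at hn1
  have h2 : k * P.real A0 ≤ e / (4 * B + 1) / 2 * (n * P.real {ω | xs n < ‖X 0 ω‖}) := by
    rw [div_mul_div_comm, div_lt_iff₀ (mul_pos hn0 hp)] at hn2
    exact hn2.le
  generalize P.real A = a at *
  generalize P.real A0 = a0 at *
  generalize P.real {ω | xs n < ‖X 0 ω‖} = p at *
  have h3 : n * a ≤ e / (4 * B + 1) / 2 * (n * p) := by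
    calc n * a ≤ n * (e / (4 * B + 1) / 2 * p) := by gcongr
      _ = _ := by ring
  have h4 : 4 * B * (e / (4 * B + 1)) ≤ e := by
    rw [mul_div_assoc', div_le_iff₀ (by positivity)]
    nlinarith
  calc _ ≤ 4 * B * (e / (4 * B + 1) / 2 * (n * p) + e / (4 * B + 1) / 2 * (n * p)) := by gcongr
    _ = 4 * B * (e / (4 * B + 1)) * (n * p) := by ring
    _ ≤ e * (n * p) := by gcongr

end SpectralSetup

end HeavyTail

namespace HeavyTail

/-! ### Sums of small values -/

/-- The vanishing-small-values condition along one sequence of levels, in quantified form. -/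
def SmallValueBound {Ω : Type*} [MeasurableSpace Ω] {d : ℕ} (P : Measure Ω) (X : ℤ → Ω → E d)
    (xs : ℕ → ℝ) : Prop :=
  ∀ δ : ℝ, 0 < δ → ∀ η : ℝ, 0 < η → ∀ᶠ ε : ℝ in 𝓝[>] 0, ∀ᶠ n : ℕ in atTop,
    P.real {ω | δ * xs n < ‖truncSum X (ε * xs n) n ω‖} ≤
      η * (n * P.real {ω | xs n < ‖X 0 ω‖})

namespace SpectralSetup

set_option linter.unusedSectionVars false

variable {Ω Ω' : Type*} [MeasurableSpace Ω] [MeasurableSpace Ω'] {P : Measure Ω} {P' : Measure Ω'}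
  {d : ℕ} {X : ℤ → Ω → E d} {Θ : ℤ → Ω' → E d} {α : ℝ}
  [IsProbabilityMeasure P] [IsProbabilityMeasure P'] (S : SpectralSetup P P' X Θ α)
include S

theorem smallValueBound {Λ : ℕ → Set ℝ} (hV : VanishingSmallValues P X Λ) {xs : ℕ → ℝ}
    (hxs : ∀ n, 1 ≤ n → xs n ∈ Λ n) (hlim : Tendsto xs atTop atTop) : SmallValueBound P X xs := by
  intro δ hδ η hη
  filter_upwards [(hV δ hδ).eventually (gt_mem_nhds (ENNReal.ofReal_pos.2 hη))] with ε hε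
  filter_upwards [eventually_lt_of_limsup_lt hε, eventually_ge_atTop 1,
    hlim.eventually (eventually_gt_atTop 0)] with n hn hn1 hx
  have hp := S.tail_pos (xs n)
  have hn0 : (0 : ℝ) < n := by exact_mod_cast hn1
  have h1 : P {ω | δ < (xs n)⁻¹ * ‖truncSum X (ε * xs n) n ω‖} /
      ((n : ℝ≥0∞) * P {ω | xs n < ‖X 0 ω‖}) ≤ ENNReal.ofReal η :=
    (le_iSup₂ (f := fun x (_ : x ∈ Λ n) => P {ω | δ < x⁻¹ * ‖truncSum X (ε * x) n ω‖} /
      ((n : ℝ≥0∞) * P {ω | x < ‖X 0 ω‖})) (xs n) (hxs n hn1)).trans hn.le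
  have h2 := ENNReal.toReal_mono ENNReal.ofReal_ne_top h1
  rw [ENNReal.toReal_div, ENNReal.toReal_mul, ENNReal.toReal_natCast, ENNReal.toReal_ofReal hη.le]
    at h2
  have e : {ω | δ * xs n < ‖truncSum X (ε * xs n) n ω‖} =
      {ω | δ < (xs n)⁻¹ * ‖truncSum X (ε * xs n) n ω‖} := by
    ext ω
    simp only [Set.mem_ofPred_eq]
    rw [inv_mul_eq_div, lt_div_iff₀ hx]
  rw [e]
  exact (div_le_iff₀ (mul_pos hn0 hp)).1 h2

/-- The truncated mean of the marginal. -/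
theorem integrable_truncated (s : ℝ) (t : ℤ) :
    Integrable (fun ω => ({ω | ‖X t ω‖ ≤ s} : Set Ω).indicator (fun ω => ‖X t ω‖) ω) P := by
  have hm : MeasurableSet {ω | ‖X t ω‖ ≤ s} :=
    measurableSet_le (S.measurable_X t).norm measurable_const
  refine .of_bound ((S.measurable_X t).norm.indicator hm).aestronglyMeasurable |s|
    (.of_forall fun ω => ?_)
  by_cases h : ‖X t ω‖ ≤ s
  · rw [Set.indicator_of_mem (s := {ω | ‖X t ω‖ ≤ s}) h, norm_norm]
    exact h.trans (le_abs_self s)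
  · rw [Set.indicator_of_notMem (s := {ω | ‖X t ω‖ ≤ s}) h, norm_zero]
    exact abs_nonneg _

theorem integral_truncated_le_add {s : ℝ} (hs : 0 < s) :
    ∫ ω, ({ω | ‖X 0 ω‖ ≤ s} : Set Ω).indicator (fun ω => ‖X 0 ω‖) ω ∂P ≤
      ∫ ω, ({ω | ‖X 0 ω‖ ≤ s / 2} : Set Ω).indicator (fun ω => ‖X 0 ω‖) ω ∂P +
        s * P.real {ω | s / 2 < ‖X 0 ω‖} := by
  have hm := S.measurableSet_norm (s / 2) 0
  have : s * P.real {ω | s / 2 < ‖X 0 ω‖} =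
      ∫ ω, ({ω | s / 2 < ‖X 0 ω‖} : Set Ω).indicator (fun _ => s) ω ∂P := by
    rw [integral_indicator_const _ hm, smul_eq_mul, mul_comm]
  rw [this, ← integral_add (S.integrable_truncated _ 0) ((integrable_const _).indicator hm)]
  refine integral_mono (S.integrable_truncated _ 0) ((S.integrable_truncated _ 0).add
    ((integrable_const _).indicator hm)) fun ω => ?_
  simp only [Set.indicator_apply, Set.mem_ofPred_eq]
  have := norm_nonneg (X 0 ω)
  split_ifs <;> linarith

/-- The truncated mean is of the order of `s P(‖X_0‖ > s)` if `α < 1`. -/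
theorem exists_integral_truncated_le (hα : α < 1) :
    ∃ M s₀ : ℝ, 0 < M ∧ 0 < s₀ ∧ ∀ s, s₀ ≤ s →
      ∫ ω, ({ω | ‖X 0 ω‖ ≤ s} : Set Ω).indicator (fun ω => ‖X 0 ω‖) ω ∂P ≤
        M * (s * P.real {ω | s < ‖X 0 ω‖}) := by
  set T : ℝ → ℝ := fun s => P.real {ω | s < ‖X 0 ω‖}
  set G : ℝ → ℝ := fun s => ∫ ω, ({ω | ‖X 0 ω‖ ≤ s} : Set Ω).indicator (fun ω => ‖X 0 ω‖) ω ∂P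
  have hT : ∀ s, 0 < T s := S.tail_pos
  have hTanti : ∀ s t, s ≤ t → T t ≤ T s := fun s t hst =>
    measureReal_mono fun ω hω => lt_of_le_of_lt hst hω
  have hG0 : ∀ s, 0 ≤ G s := fun s => integral_nonneg fun ω =>
    Set.indicator_nonneg (fun _ _ => norm_nonneg _) _
  have hGmono : ∀ s t, s ≤ t → G s ≤ G t := fun s t hst => by
    refine integral_mono (S.integrable_truncated _ 0) (S.integrable_truncated _ 0) fun ω => ?_
    exact Set.indicator_le_indicator_of_subset (fun ω hω => le_trans hω hst)
      (fun _ => norm_nonneg _) _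
  have hrec : ∀ s, 0 < s → G s ≤ G (s / 2) + s * T (s / 2) := fun s hs =>
    S.integral_truncated_le_add hs
  -- Halving a large level multiplies the tail by about 2^α, which is below 2 since α < 1; b is a
  -- bound in between.
  obtain ⟨b, hb1, hb2⟩ : ∃ b : ℝ, (1 / 2 : ℝ) ^ (-α) < b ∧ b < 2 := by
    refine exists_between ?_
    rw [Real.rpow_neg (by norm_num), one_div, Real.inv_rpow (by norm_num), inv_inv]
    calc (2 : ℝ) ^ α < 2 ^ (1 : ℝ) := Real.rpow_lt_rpow_of_exponent_lt (by norm_num) hα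
      _ = 2 := Real.rpow_one 2
  have hb0 : 0 < b := lt_of_le_of_lt (by positivity) hb1
  obtain ⟨s₁, hs₁⟩ := eventually_atTop.1 ((S.tendsto_tail_ratio (u := 1 / 2) (by norm_num)).eventually
    (gt_mem_nhds hb1))
  have hratio : ∀ s, s₁ ≤ s → T (s / 2) ≤ b * T s := fun s hs => by
    have h := hs₁ s hs
    rw [show 1 / 2 * s = s / 2 by ring] at h
    exact ((div_lt_iff₀ (hT s)).1 h).le
  set s₀ := max s₁ 1
  have hs₀ : 0 < s₀ := lt_of_lt_of_le one_pos (le_max_right _ _)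
  -- The first term covers the base range from s₀ to 2s₀; the second makes bM/2 + b ≤ M, the
  -- inequality that closes the dyadic induction.
  set M := max (G (2 * s₀) / (s₀ * T (2 * s₀))) (2 * b / (2 - b))
  have hM0 : 0 < M := lt_of_lt_of_le (div_pos (by positivity) (by linarith)) (le_max_right _ _)
  have hMb : b * M / 2 + b ≤ M := by
    have : 2 * b ≤ M * (2 - b) := (div_le_iff₀ (by linarith)).1 (le_max_right _ _)
    linarith
  have hMG : G (2 * s₀) ≤ M * (s₀ * T (2 * s₀)) :=
    (div_le_iff₀ (mul_pos hs₀ (hT _))).1 (le_max_left _ _)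
  have key : ∀ n : ℕ, ∀ s, s₀ ≤ s → s ≤ 2 ^ n * (2 * s₀) → G s ≤ M * (s * T s) := by
    intro n
    induction n with
    | zero =>
      intro s h1 h2
      rw [pow_zero, one_mul] at h2
      calc G s ≤ G (2 * s₀) := hGmono _ _ h2
        _ ≤ M * (s₀ * T (2 * s₀)) := hMG
        _ ≤ M * (s * T s) := by
          have := hTanti _ _ h2
          have := (hT (2 * s₀)).le
          have : 0 ≤ s := hs₀.le.trans h1
          gcongr
    | succ n ih =>
      intro s h1 h2
      rcases le_total s (2 * s₀) with h | h
      · exact ih s h1 (h.trans (le_mul_of_one_le_left (by positivity) (one_le_pow₀ (by norm_num))))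
      · have hs : 0 < s := hs₀.trans_le h1
        have h3 := ih (s / 2) (by linarith) (by rw [pow_succ] at h2; linarith)
        have h4 := hratio s ((le_max_left _ _).trans h1)
        calc G s ≤ G (s / 2) + s * T (s / 2) := hrec s hs
          _ ≤ M * (s / 2 * T (s / 2)) + s * T (s / 2) := by gcongr
          _ = (M / 2 + 1) * s * T (s / 2) := by ring
          _ ≤ (M / 2 + 1) * s * (b * T s) := by gcongr
          _ = (b * M / 2 + b) * (s * T s) := by ring
          _ ≤ M * (s * T s) := by
            have := hT s
            gcongr
  refine ⟨M, s₀, hM0, hs₀, fun s hs => ?_⟩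
  obtain ⟨n, hn⟩ := pow_unbounded_of_one_lt (s / (2 * s₀)) (one_lt_two)
  exact key n s hs ((div_le_iff₀ (by positivity)).1 hn.le)

/-- Markov's inequality for the sum of the truncated norms. The truncated mean at level εx is of
order εx P(‖X_0‖ > εx), that is ε^(1-α) x P(‖X_0‖ > x), and 1 - α > 0. -/
theorem smallValueBound_of_lt_one (hα : α < 1) {xs : ℕ → ℝ} (hlim : Tendsto xs atTop atTop) :
    SmallValueBound P X xs := by
  obtain ⟨M, s₀, hM, hs₀, hG⟩ := S.exists_integral_truncated_le hα
  intro δ hδ η hη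
  -- The doubled ε^(-α) is a strict upper bound for the limit of the tail ratio, hence for the ratio
  -- eventually.
  have hpow : Tendsto (fun ε : ℝ => M / δ * (ε * (ε ^ (-α) + ε ^ (-α)))) (𝓝[>] 0) (𝓝 0) := by
    have h1 : Tendsto (fun ε : ℝ => ε ^ (1 - α)) (𝓝[>] 0) (𝓝 0) := by
      have := (Real.continuousAt_rpow_const 0 (1 - α) (.inr (by linarith))).tendsto
      rw [Real.zero_rpow (by linarith)] at this
      exact this.mono_left nhdsWithin_le_nhds
    have h2 := h1.const_mul (M / δ * 2)
    rw [mul_zero] at h2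
    refine h2.congr' ?_
    filter_upwards [self_mem_nhdsWithin] with ε hε
    rw [show (1 : ℝ) - α = 1 + -α by ring, Real.rpow_add hε, Real.rpow_one]
    ring
  filter_upwards [hpow.eventually (gt_mem_nhds hη), self_mem_nhdsWithin] with ε hε hε0
  have hε0 : 0 < ε := hε0
  have hεα : 0 < ε ^ (-α) := Real.rpow_pos_of_pos hε0 _
  filter_upwards [((S.tendsto_tail_ratio hε0).comp hlim).eventually
      (gt_mem_nhds (show ε ^ (-α) < ε ^ (-α) + ε ^ (-α) by linarith)),
    hlim.eventually (eventually_ge_atTop (s₀ / ε)), hlim.eventually (eventually_gt_atTop 0)]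
    with n hn1 hn2 hx
  have hp := S.tail_pos (xs n)
  set c := ε * xs n
  have hc : s₀ ≤ c := by simpa only [c, mul_comm] using (div_le_iff₀ hε0).1 hn2
  have hint : Integrable (fun ω => ∑ i ∈ Finset.Icc (1 : ℤ) n,
      ({ω | ‖X i ω‖ ≤ c} : Set Ω).indicator (fun ω => ‖X i ω‖) ω) P :=
    integrable_finsetSum _ fun i _ => S.integrable_truncated c i
  have hmarkov := mul_meas_ge_le_integral_of_nonneg (μ := P) (.of_forall fun ω =>
    Finset.sum_nonneg fun i _ => Set.indicator_nonneg (fun _ _ => norm_nonneg _) ω) hint (δ * xs n)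
  have hsum : ∫ ω, ∑ i ∈ Finset.Icc (1 : ℤ) n,
      ({ω | ‖X i ω‖ ≤ c} : Set Ω).indicator (fun ω => ‖X i ω‖) ω ∂P =
      n * ∫ ω, ({ω | ‖X 0 ω‖ ≤ c} : Set Ω).indicator (fun ω => ‖X 0 ω‖) ω ∂P := by
    rw [integral_finsetSum _ fun i _ => S.integrable_truncated c i]
    rw [Finset.sum_congr rfl (g := fun _ =>
      ∫ ω, ({ω | ‖X 0 ω‖ ≤ c} : Set Ω).indicator (fun ω => ‖X 0 ω‖) ω ∂P) fun i _ => ?_]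
    · simp
    · have hm : Measurable (({x : ℤ → E d | ‖x 0‖ ≤ c} : Set _).indicator fun x => ‖x 0‖) :=
        Measurable.indicator (by fun_prop) (measurableSet_le (by fun_prop) measurable_const)
      have h := S.integral_shift hm i
      simp only [Set.indicator_apply, Set.mem_ofPred_eq, zero_add] at h ⊢
      exact h
  rw [hsum] at hmarkov
  have hsub : P.real {ω | δ * xs n < ‖truncSum X c n ω‖} ≤ P.real {ω | δ * xs n ≤
      ∑ i ∈ Finset.Icc (1 : ℤ) n, ({ω | ‖X i ω‖ ≤ c} : Set Ω).indicator (fun ω => ‖X i ω‖) ω} := by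
    refine measureReal_mono fun ω hω => ?_
    refine (le_of_lt hω).trans ((norm_sum_le _ _).trans (Finset.sum_le_sum fun i _ => ?_))
    simp only [Set.indicator_apply, Set.mem_ofPred_eq]
    split_ifs <;> simp
  have hδx : 0 < δ * xs n := mul_pos hδ hx
  refine hsub.trans ?_
  rw [mul_comm, ← le_div_iff₀ hδx] at hmarkov
  refine hmarkov.trans ?_
  rw [div_le_iff₀ hδx]
  have h5 : P.real {ω | c < ‖X 0 ω‖} ≤ (ε ^ (-α) + ε ^ (-α)) * P.real {ω | xs n < ‖X 0 ω‖} :=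
    ((div_lt_iff₀ hp).1 hn1).le
  calc _ ≤ n * (M * (c * P.real {ω | c < ‖X 0 ω‖})) := by gcongr; exact hG c hc
    _ ≤ n * (M * (c * ((ε ^ (-α) + ε ^ (-α)) * P.real {ω | xs n < ‖X 0 ω‖}))) := by gcongr
    _ = M / δ * (ε * (ε ^ (-α) + ε ^ (-α))) * (n * P.real {ω | xs n < ‖X 0 ω‖}) * (δ * xs n) := by
        simp only [c]; field_simp
    _ ≤ _ := by gcongr

end SpectralSetup

end HeavyTail

namespace HeavyTail

/-! ### The limit measure on `ℝ^d` and the large deviation principle -/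

/-- The law of the sum of a cluster anchored at its last maximum. -/
noncomputable def clusterMeasure {Ω' : Type*} [MeasurableSpace Ω'] (P' : Measure Ω') {d : ℕ}
    (Θ : ℤ → Ω' → E d) (α : ℝ) : Measure (E d) :=
  ((tailMeasure P' Θ α).restrict (anchor d)).map fun x => ∑' t, x t

/-- Smooth truncation from below. -/
noncomputable def softTrunc {d : ℕ} (a b : ℝ) (z : E d) : E d := ramp a b ‖z‖ • z

section

variable {d : ℕ}

theorem continuous_softTrunc (a b : ℝ) : Continuous (softTrunc (d := d) a b) := by
  unfold softTrunc; fun_prop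

theorem norm_softTrunc_le (a b : ℝ) (z : E d) : ‖softTrunc a b z‖ ≤ ‖z‖ := by
  rw [softTrunc, norm_smul, Real.norm_of_nonneg (ramp_nonneg _ _ _)]
  exact mul_le_of_le_one_left (norm_nonneg _) (ramp_le_one _ _ _)

theorem softTrunc_eq_zero {a b : ℝ} (hab : a < b) {z : E d} (h : ‖z‖ ≤ a) :
    softTrunc a b z = 0 := by
  rw [softTrunc, ramp_eq_zero hab h, zero_smul]

theorem softTrunc_eq_self {a b : ℝ} (hab : a < b) {z : E d} (h : b ≤ ‖z‖) :
    softTrunc a b z = z := by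
  rw [softTrunc, ramp_eq_one hab h, one_smul]

theorem enorm_tsum_le_totalSum {τ : E d → E d} (hτ : ∀ z, ‖τ z‖ ≤ ‖z‖) (x : ℤ → E d) :
    ‖∑' t, τ (x t)‖ₑ ≤ totalSum x :=
  enorm_tsum_le_tsum_enorm.trans (ENNReal.tsum_le_tsum fun _ => enorm_le_iff_norm_le.2 (hτ _))

theorem measurable_tsum_path : Measurable fun x : ℤ → E d => ∑' t, x t := by
  fun_prop

end

namespace SpectralSetup

set_option linter.unusedSectionVars false

variable {Ω Ω' : Type*} [MeasurableSpace Ω] [MeasurableSpace Ω'] {P : Measure Ω} {P' : Measure Ω'}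
  {d : ℕ} {X : ℤ → Ω → E d} {Θ : ℤ → Ω' → E d} {α : ℝ}
  [IsProbabilityMeasure P] [IsProbabilityMeasure P'] (S : SpectralSetup P P' X Θ α)
include S

theorem clusterMeasure_norm_ne_top {xs : ℕ → ℝ} (hlim : Tendsto xs atTop atTop)
    (hC : ClusterBound P X xs)
    (hmom : 1 < α → ∫⁻ ω, (∑' i : ℕ, ‖Θ (i + 1) ω‖ₑ) ^ (α - 1) ∂P' < ∞) {u : ℝ} (hu : 0 < u) :
    clusterMeasure P' Θ α {z | u < ‖z‖} ≠ ∞ := by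
  refine ne_top_of_le_ne_top (S.tailMeasure_anchor_totalSum_ne_top hlim hC hmom hu) ?_
  rw [clusterMeasure, Measure.map_apply measurable_tsum_path
    (measurableSet_lt measurable_const measurable_norm)]
  refine measure_mono fun x (hx : u < ‖∑' t, x t‖) => ?_
  refine lt_of_lt_of_le ?_ (enorm_tsum_le_totalSum (τ := id) (fun z => le_rfl) x)
  rw [← ofReal_norm]
  exact (ENNReal.ofReal_lt_ofReal_iff (hu.trans hx)).2 hx

theorem clusterMeasure_smul {c : ℝ} (hc : 0 < c) {A : Set (E d)} (hA : MeasurableSet A) :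
    clusterMeasure P' Θ α {z | c • z ∈ A} = ENNReal.ofReal (c ^ α) * clusterMeasure P' Θ α A := by
  have hm := measurable_tsum_path (d := d)
  have hA' : MeasurableSet {z : E d | c • z ∈ A} := (measurable_const_smul c) hA
  rw [clusterMeasure, Measure.map_apply hm hA', Measure.map_apply hm hA,
    Measure.restrict_apply (hm hA'), Measure.restrict_apply (hm hA),
    ← tailMeasure_smul_set S.measurable_Θ S.index_pos hc ((hm hA).inter (measurableSet_anchor d))]
  congr 1
  ext x
  simp only [Set.mem_inter_iff, Set.mem_preimage, Set.mem_ofPred_eq, smul_mem_anchor hc,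
    tsum_const_smul'']

/-- Every nonzero term is eventually left unchanged by the truncation, as its upper level is at most
2ε. The cluster sums converge by domination with ‖x_t‖, and the integrals because the integrand is
bounded and supported on total sums above u. -/
theorem tendsto_integral_softTrunc {xs : ℕ → ℝ} (hlim : Tendsto xs atTop atTop)
    (hC : ClusterBound P X xs)
    (hmom : 1 < α → ∫⁻ ω, (∑' i : ℕ, ‖Θ (i + 1) ω‖ₑ) ^ (α - 1) ∂P' < ∞)
    {f : E d → ℝ} (hf : Continuous f) {B : ℝ} (hB : ∀ z, |f z| ≤ B) {u : ℝ} (hu : 0 < u)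
    (hf0 : ∀ z, ‖z‖ ≤ u → f z = 0) {b : ℝ → ℝ} (hb : ∀ ε, 0 < ε → ε < b ε ∧ b ε ≤ 2 * ε) :
    Tendsto (fun ε => ∫ x in anchor d, f (∑' t, softTrunc ε (b ε) (x t)) ∂tailMeasure P' Θ α)
      (𝓝[>] 0) (𝓝 (∫ z, f z ∂clusterMeasure P' Θ α)) := by
  have hm := measurable_tsum_path (d := d)
  rw [clusterMeasure, integral_map hm.aemeasurable hf.measurable.aestronglyMeasurable]
  have hB0 : 0 ≤ B := (abs_nonneg _).trans (hB 0)
  have hms : MeasurableSet {x : ℤ → E d | ENNReal.ofReal u < totalSum x} :=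
    measurableSet_lt measurable_const measurable_totalSum
  refine tendsto_integral_filter_of_dominated_convergence
    (({x : ℤ → E d | ENNReal.ofReal u < totalSum x} : Set _).indicator fun _ => B)
    (.of_forall fun ε => ?_) (.of_forall fun ε => .of_forall fun x => ?_) ?_ ?_
  · have h1 := (continuous_softTrunc (d := d) ε (b ε)).measurable
    have h2 : Measurable fun x : ℤ → E d => ∑' t, softTrunc ε (b ε) (x t) :=
      Measurable.tsum fun t => h1.comp (measurable_pi_apply t)
    exact (hf.measurable.comp h2).aestronglyMeasurable
  · by_cases hx : ENNReal.ofReal u < totalSum x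
    · rw [Set.indicator_of_mem (s := {x : ℤ → E d | ENNReal.ofReal u < totalSum x}) hx]
      exact hB _
    · rw [Set.indicator_of_notMem (s := {x : ℤ → E d | ENNReal.ofReal u < totalSum x}) hx, hf0,
        norm_zero]
      have := (enorm_tsum_le_totalSum (norm_softTrunc_le ε (b ε)) x).trans (not_lt.1 hx)
      rw [← ofReal_norm] at this
      exact (ENNReal.ofReal_le_ofReal_iff hu.le).1 this
  · exact (integrable_indicator_iff hms).2
      (integrableOn_const (S.tailMeasure_anchor_totalSum_ne_top hlim hC hmom hu))
  · filter_upwards [ae_restrict_of_ae (S.ae_totalSum hlim hC hmom)] with x hx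
    refine (hf.tendsto _).comp (tendsto_tsum_of_dominated_convergence
      (summable_norm_of_totalSum hx) (fun t => ?_) (.of_forall fun ε t => norm_softTrunc_le _ _ _))
    refine tendsto_const_nhds.congr' ?_
    by_cases h0 : x t = 0
    · refine .of_forall fun ε => ?_
      simp [h0, softTrunc]
    · have hpos : 0 < ‖x t‖ / 2 := half_pos (norm_pos_iff.2 h0)
      filter_upwards [self_mem_nhdsWithin,
        mem_nhdsWithin_of_mem_nhds (gt_mem_nhds hpos)] with ε hε0 hε
      obtain ⟨h1, h2⟩ := hb ε hε0
      exact (softTrunc_eq_self h1 (by change ε < _ at hε; linarith)).symm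

theorem measurable_partialSum (n : ℕ) : Measurable (partialSum X n) :=
  Finset.measurable_sum _ fun i _ => S.measurable_X i

/-- A union bound for the event that some value falls into the ramp of the soft truncation, where it
is neither kept whole nor removed. -/
theorem measure_exists_between_le {a b : ℝ} (hab : a ≤ b) (n : ℕ) :
    P.real {ω | ∃ i ∈ Finset.Icc (1 : ℤ) n, a < ‖X i ω‖ ∧ ‖X i ω‖ ≤ b} ≤
      n * (P.real {ω | a < ‖X 0 ω‖} - P.real {ω | b < ‖X 0 ω‖}) := by
  have h1 : ∀ i : ℤ, P.real {ω | a < ‖X i ω‖ ∧ ‖X i ω‖ ≤ b} =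
      P.real {ω | a < ‖X 0 ω‖} - P.real {ω | b < ‖X 0 ω‖} := fun i => by
    have e : {ω | a < ‖X i ω‖ ∧ ‖X i ω‖ ≤ b} = {ω | a < ‖X i ω‖} \ {ω | b < ‖X i ω‖} := by
      ext ω; simp
    have hsub : {ω | b < ‖X i ω‖} ⊆ {ω | a < ‖X i ω‖} := fun ω hω => lt_of_le_of_lt hab hω
    rw [e, measureReal_sdiff hsub (S.measurableSet_norm b i)]
    simp only [measureReal_def, S.measure_norm_shift _ i]
  have e : {ω | ∃ i ∈ Finset.Icc (1 : ℤ) n, a < ‖X i ω‖ ∧ ‖X i ω‖ ≤ b} =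
      ⋃ i ∈ Finset.Icc (1 : ℤ) n, {ω | a < ‖X i ω‖ ∧ ‖X i ω‖ ≤ b} := by
    ext ω; simp only [Set.mem_iUnion, Set.mem_ofPred_eq, exists_prop]
  rw [e]
  refine (measureReal_biUnion_finset_le _ _).trans ?_
  simp only [h1, Finset.sum_const, nsmul_eq_mul]
  simp

/-- The approximation of a functional of the sum by the functional of the truncated sum. -/
theorem abs_integral_sub_truncated_le {f : E d → ℝ} (hf : Continuous f) {B : ℝ}
    (hB : ∀ z, |f z| ≤ B) {q : E d → ℝ} (hq : Continuous q) (hq0 : ∀ z, 0 ≤ q z)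
    (hq1 : ∀ z, q z ≤ 1) {w δ : ℝ} (hw : 0 ≤ w)
    (hfq : ∀ z y, ‖z - y‖ ≤ δ → |f z - f y| ≤ w * q y) {x : ℝ} (hx : 0 < x) {ε b : ℝ}
    (hεb : ε < b) (n : ℕ) :
    |∫ ω, f (x⁻¹ • partialSum X n ω) ∂P -
        ∫ ω, f (∑ i ∈ Finset.Icc (1 : ℤ) n, softTrunc ε b (x⁻¹ • X i ω)) ∂P| ≤
      w * ∫ ω, q (∑ i ∈ Finset.Icc (1 : ℤ) n, softTrunc ε b (x⁻¹ • X i ω)) ∂P +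
        2 * B * P.real {ω | δ * x < ‖truncSum X (ε * x) n ω‖} +
        2 * B * (n * (P.real {ω | ε * x < ‖X 0 ω‖} - P.real {ω | b * x < ‖X 0 ω‖})) := by
  have hX := S.measurable_X
  have hB0 : 0 ≤ B := (abs_nonneg _).trans (hB 0)
  set V : Ω → E d := fun ω => ∑ i ∈ Finset.Icc (1 : ℤ) n, softTrunc ε b (x⁻¹ • X i ω)
  set W : Ω → E d := fun ω => x⁻¹ • partialSum X n ω
  have hVm : Measurable V := Finset.measurable_sum _ fun i _ =>
    (continuous_softTrunc ε b).measurable.comp (by fun_prop)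
  have hWm : Measurable W := (S.measurable_partialSum n).const_smul x⁻¹
  have hTm : Measurable fun ω => truncSum X (ε * x) n ω := by
    unfold truncSum
    refine Finset.measurable_sum _ fun i _ => Measurable.ite ?_ (hX i) measurable_const
    exact measurableSet_le (hX i).norm measurable_const
  set A₁ := {ω | δ * x < ‖truncSum X (ε * x) n ω‖}
  set A₂ := {ω | ∃ i ∈ Finset.Icc (1 : ℤ) n, ε * x < ‖X i ω‖ ∧ ‖X i ω‖ ≤ b * x}
  have hA₁ : MeasurableSet A₁ := measurableSet_lt measurable_const hTm.norm
  have hA₂ : MeasurableSet A₂ := by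
    refine measurableSet_exists fun i => (MeasurableSet.const _).inter ?_
    exact (measurableSet_lt measurable_const (hX i).norm).inter
      (measurableSet_le (hX i).norm measurable_const)
  have hi : ∀ φ : Ω → E d, Measurable φ → Integrable (fun ω => f (φ ω)) P := fun φ hφ =>
    .of_bound (hf.measurable.comp hφ).aestronglyMeasurable B (.of_forall fun ω => hB _)
  have hiq : Integrable (fun ω => q (V ω)) P :=
    .of_bound (hq.measurable.comp hVm).aestronglyMeasurable 1 (.of_forall fun ω => by
      rw [Real.norm_of_nonneg (hq0 _)]; exact hq1 _)
  have hind : ∀ A : Set Ω, MeasurableSet A →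
      ∫ ω, A.indicator (fun _ => 2 * B) ω ∂P = 2 * B * P.real A := fun A hA => by
    rw [integral_indicator_const _ hA, smul_eq_mul, mul_comm]
  have hindi : ∀ A : Set Ω, MeasurableSet A → Integrable (A.indicator fun _ => 2 * B) P :=
    fun A hA => (integrable_const _).indicator hA
  have hA₂le : 2 * B * P.real A₂ ≤
      2 * B * (n * (P.real {ω | ε * x < ‖X 0 ω‖} - P.real {ω | b * x < ‖X 0 ω‖})) :=
    mul_le_mul_of_nonneg_left (S.measure_exists_between_le
      (mul_le_mul_of_nonneg_right hεb.le hx.le) n) (by positivity)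
  refine le_trans ?_ (add_le_add_right hA₂le _)
  have hsum := integral_add ((hiq.const_mul w).add (hindi A₁ hA₁)) (hindi A₂ hA₂)
  simp only [Pi.add_apply] at hsum
  rw [← integral_sub (hi W hWm) (hi V hVm), ← hind A₁ hA₁, ← hind A₂ hA₂, ← integral_const_mul,
    ← integral_add (hiq.const_mul w) (hindi A₁ hA₁), ← hsum]
  refine abs_integral_le_integral_abs.trans (integral_mono ((hi W hWm).sub (hi V hVm)).abs
    (((hiq.const_mul w).add (hindi A₁ hA₁)).add (hindi A₂ hA₂)) fun ω => ?_)
  have hn1 : 0 ≤ A₁.indicator (fun _ => 2 * B) ω := Set.indicator_nonneg (fun _ _ => by positivity) _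
  have hn2 : 0 ≤ A₂.indicator (fun _ => 2 * B) ω := Set.indicator_nonneg (fun _ _ => by positivity) _
  have hwq : 0 ≤ w * q (V ω) := mul_nonneg hw (hq0 _)
  have hcrude : |f (W ω) - f (V ω)| ≤ 2 * B := by
    refine (abs_sub _ _).trans ?_
    linarith [hB (W ω), hB (V ω)]
  change |f (W ω) - f (V ω)| ≤
    w * q (V ω) + A₁.indicator (fun _ => 2 * B) ω + A₂.indicator (fun _ => 2 * B) ω
  by_cases h2 : ω ∈ A₂
  · rw [Set.indicator_of_mem h2]; linarith
  by_cases h1 : ω ∈ A₁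
  · rw [Set.indicator_of_mem h1]; linarith
  refine (hfq _ _ ?_).trans (by linarith)
  -- Off both exceptional events each value is either removed or kept whole, so the discrepancy is
  -- exactly the scaled sum of small values.
  have hdiff : W ω - V ω = x⁻¹ • truncSum X (ε * x) n ω := by
    simp only [W, V, partialSum, truncSum, Finset.smul_sum, ← Finset.sum_sub_distrib]
    refine Finset.sum_congr rfl fun i hi => ?_
    have hn : ‖x⁻¹ • X i ω‖ = x⁻¹ * ‖X i ω‖ := by
      rw [norm_smul, norm_inv, Real.norm_of_nonneg hx.le]
    split_ifs with hc
    · rw [softTrunc_eq_zero hεb, sub_zero]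
      rw [hn, inv_mul_le_iff₀ hx, mul_comm]; exact hc
    · rw [softTrunc_eq_self hεb, sub_self, smul_zero]
      rw [hn, le_inv_mul_iff₀ hx, mul_comm]
      by_contra hc'
      exact h2 ⟨i, hi, not_le.1 hc, (not_le.1 hc').le⟩
  rw [hdiff, norm_smul, norm_inv, Real.norm_of_nonneg hx.le, inv_mul_le_iff₀ hx, mul_comm x δ]
  exact not_lt.1 h1

/-- The large deviation principle for uniformly continuous test functions. -/
theorem tendsto_of_uniformContinuous {xs : ℕ → ℝ} (hlim : Tendsto xs atTop atTop)
    (hC : ClusterBound P X xs) (hV : SmallValueBound P X xs)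
    (hmom : 1 < α → ∫⁻ ω, (∑' i : ℕ, ‖Θ (i + 1) ω‖ₑ) ^ (α - 1) ∂P' < ∞)
    {f : E d → ℝ} (hf : UniformContinuous f) {B : ℝ} (hB : ∀ z, |f z| ≤ B) {u : ℝ} (hu : 0 < u)
    (hf0 : ∀ z, ‖z‖ ≤ u → f z = 0) :
    Tendsto (fun n : ℕ => (∫ ω, f ((xs n)⁻¹ • partialSum X n ω) ∂P) /
        (n * P.real {ω | xs n < ‖X 0 ω‖})) atTop (𝓝 (∫ z, f z ∂clusterMeasure P' Θ α)) := by
  have hB0 : 0 ≤ B := (abs_nonneg _).trans (hB 0)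
  -- Bounds the limiting integrals of q uniformly over all truncation levels, since truncated
  -- cluster sums are at most the total sum and q vanishes on the ball of radius u/4.
  set C := ((tailMeasure P' Θ α).restrict (anchor d)).real {x | ENNReal.ofReal (u / 4) < totalSum x}
  have hC0 : 0 ≤ C := measureReal_nonneg
  set q : E d → ℝ := fun z => ramp (u / 4) (u / 2) ‖z‖
  have hu4 : u / 4 < u / 2 := by linarith
  have hqc : Continuous q := by fun_prop
  have hq0 : ∀ z, 0 ≤ q z := fun z => ramp_nonneg _ _ _
  have hq1 : ∀ z, q z ≤ 1 := fun z => ramp_le_one _ _ _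
  have hqz : ∀ z : E d, ‖z‖ ≤ u / 4 → q z = 0 := fun z hz => ramp_eq_zero hu4 hz
  have hqev : ∀ᶠ z in 𝓝 (0 : E d), q z = 0 := by
    filter_upwards [Metric.closedBall_mem_nhds (0 : E d) (show 0 < u / 4 by positivity)] with z hz
    exact hqz z (mem_closedBall_zero_iff.1 hz)
  have hfev : ∀ᶠ z in 𝓝 (0 : E d), f z = 0 := by
    filter_upwards [Metric.closedBall_mem_nhds (0 : E d) hu] with z hz
    exact hf0 z (mem_closedBall_zero_iff.1 hz)
  have hqint : ∀ a b : ℝ, ∫ x in anchor d, q (∑' t, softTrunc a b (x t)) ∂tailMeasure P' Θ α ≤ C := by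
    intro a b
    have hms : MeasurableSet {x : ℤ → E d | ENNReal.ofReal (u / 4) < totalSum x} :=
      measurableSet_lt measurable_const measurable_totalSum
    have hfin := S.tailMeasure_anchor_totalSum_ne_top hlim hC hmom (u := u / 4) (by positivity)
    have hI : Integrable (({x : ℤ → E d | ENNReal.ofReal (u / 4) < totalSum x} : Set _).indicator
        fun _ => (1 : ℝ)) ((tailMeasure P' Θ α).restrict (anchor d)) :=
      (integrable_indicator_iff hms).2 (integrableOn_const hfin)
    refine (integral_mono_of_nonneg (.of_forall fun x => hq0 _) hI (.of_forall fun x => ?_)).trans ?_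
    · by_cases hx : ENNReal.ofReal (u / 4) < totalSum x
      · refine (hq1 _).trans_eq ?_
        exact (Set.indicator_of_mem
          (s := {x : ℤ → E d | ENNReal.ofReal (u / 4) < totalSum x}) hx fun _ => (1 : ℝ)).symm
      · refine Eq.trans_le (hqz _ ?_) (Set.indicator_nonneg (fun _ _ => zero_le_one) _)
        have := (enorm_tsum_le_totalSum (norm_softTrunc_le a b) x).trans (not_lt.1 hx)
        rw [← ofReal_norm] at this
        exact (ENNReal.ofReal_le_ofReal_iff (by positivity)).1 this
    · rw [integral_indicator_const _ hms, smul_eq_mul, mul_one]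
  refine tendsto_of_approx fun e he => ?_
  -- The modulus w will cost w(C+1) = e/2; the two exceptional events cost 4Bη ≤ e/2 with η as
  -- below.
  set w := e / (2 * (C + 1))
  have hw : 0 < w := by positivity
  set η := e / (8 * B + 1)
  have hη : 0 < η := by positivity
  obtain ⟨δ₀, hδ₀, hδf⟩ := Metric.uniformContinuous_iff.1 hf w hw
  set δ := min (δ₀ / 2) (u / 2)
  have hδ : 0 < δ := lt_min (by positivity) (by positivity)
  -- Where ‖y‖ ≥ u/2 the weight q is 1 and uniform continuity applies. Otherwise z is still in the
  -- ball of radius u, because δ ≤ u/2, and both values are 0.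
  have hfq : ∀ z y : E d, ‖z - y‖ ≤ δ → |f z - f y| ≤ w * q y := by
    intro z y hzy
    by_cases hy : u / 2 ≤ ‖y‖
    · have : q y = 1 := ramp_eq_one hu4 hy
      rw [this, mul_one]
      have h1 : dist z y < δ₀ := by
        rw [dist_eq_norm]
        exact (hzy.trans (min_le_left _ _)).trans_lt (by linarith)
      exact (hδf h1).le
    · have h1 : ‖z‖ ≤ u := by
        have := norm_sub_norm_le z y
        have := hzy.trans (min_le_right _ _)
        linarith
      rw [hf0 z h1, hf0 y (by linarith), sub_self, abs_zero]
      exact mul_nonneg hw.le (hq0 y)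
  -- The upper level b is so close to ε that the ramp zone carries limiting tail mass below η.
  have hbex : ∀ ε : ℝ, ∃ b, 0 < ε → (ε < b ∧ b ≤ 2 * ε) ∧ ε ^ (-α) - b ^ (-α) < η := by
    intro ε
    by_cases hε : 0 < ε
    · have hc : Tendsto (fun b : ℝ => ε ^ (-α) - b ^ (-α)) (𝓝[>] ε) (𝓝 0) := by
        have := (Real.continuousAt_rpow_const ε (-α) (.inl hε.ne')).tendsto.const_sub (ε ^ (-α))
        rw [sub_self] at this
        exact this.mono_left nhdsWithin_le_nhds
      obtain ⟨b, h1, h2, h3⟩ := ((hc.eventually (gt_mem_nhds hη)).and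
        (Ioc_mem_nhdsGT (show ε < 2 * ε by linarith))).exists
      exact ⟨b, fun _ => ⟨⟨h2, h3⟩, h1⟩⟩
    · exact ⟨0, fun h => absurd h hε⟩
  choose b hb using hbex
  have hconv := S.tendsto_integral_softTrunc hlim hC hmom hf.continuous hB hu hf0
    (b := b) fun ε hε => (hb ε hε).1
  obtain ⟨ε, hε1, hε2, hε0⟩ := ((hV δ hδ η hη).and
    ((Metric.tendsto_nhds.1 hconv e he).and self_mem_nhdsWithin)).exists
  have hε0 : 0 < ε := hε0
  obtain ⟨⟨hb1, hb2⟩, hb3⟩ := hb ε hε0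
  have htr : ∀ g : E d → ℝ, Continuous g → (∃ B, ∀ z, |g z| ≤ B) → (∀ᶠ z in 𝓝 0, g z = 0) →
      Tendsto (fun n : ℕ => (∫ ω, g (∑ i ∈ Finset.Icc (1 : ℤ) n,
        softTrunc ε (b ε) ((xs n)⁻¹ • X i ω)) ∂P) / (n * P.real {ω | xs n < ‖X 0 ω‖})) atTop
      (𝓝 (∫ x in anchor d, g (∑' t, softTrunc ε (b ε) (x t)) ∂tailMeasure P' Θ α)) :=
    fun g hg ⟨B, hB⟩ hg0 => S.tendsto_truncated hlim hC hmom hg hB hg0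
      (continuous_softTrunc ε (b ε)) (norm_softTrunc_le ε (b ε)) hε0
      fun z hz => softTrunc_eq_zero hb1 hz
  refine ⟨_, _, htr f hf.continuous ⟨B, hB⟩ hfev, ?_, ?_⟩
  swap
  · rw [abs_sub_comm]; exact hε2.le
  have hqlim := htr q hqc ⟨1, fun z => by rw [abs_of_nonneg (hq0 z)]; exact hq1 z⟩ hqev
  have hrat := ((S.tendsto_tail_ratio hε0).comp hlim).sub
    ((S.tendsto_tail_ratio (hε0.trans hb1)).comp hlim)
  filter_upwards [hε1, hqlim.eventually (gt_mem_nhds ((hqint ε (b ε)).trans_lt (lt_add_one C))),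
    hrat.eventually (gt_mem_nhds hb3), eventually_ge_atTop 1,
    hlim.eventually (eventually_gt_atTop 0)] with n h1 h2 h3 hn hx
  have hp := S.tail_pos (xs n)
  have hn0 : (0 : ℝ) < n := by exact_mod_cast hn
  have hmain := S.abs_integral_sub_truncated_le hf.continuous hB hqc hq0 hq1 hw.le hfq hx hb1 n
  rw [← sub_div, abs_div, abs_of_pos (mul_pos hn0 hp), div_le_iff₀ (mul_pos hn0 hp)]
  refine hmain.trans ?_
  simp only [Function.comp] at h3
  rw [← sub_div, div_lt_iff₀ hp] at h3
  rw [div_lt_iff₀ (mul_pos hn0 hp)] at h2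
  generalize P.real {ω | xs n < ‖X 0 ω‖} = p at *
  calc _ ≤ w * ((C + 1) * (n * p)) + 2 * B * (η * (n * p)) + 2 * B * (n * (η * p)) := by
        gcongr
    _ = (w * (C + 1) + 4 * B * η) * (n * p) := by ring
    _ ≤ e * (n * p) := by
        have e1 : w * (C + 1) = e / 2 := by simp only [w]; field_simp
        have e2 : 4 * B * η ≤ e / 2 := by
          simp only [η]
          rw [mul_div_assoc', div_le_iff₀ (by positivity)]
          nlinarith
        gcongr
        linarith

/-- The large deviation principle for bounded continuous test functions vanishing near `0`. -/
theorem tendsto_clusterMeasure {xs : ℕ → ℝ} (hlim : Tendsto xs atTop atTop)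
    (hC : ClusterBound P X xs) (hV : SmallValueBound P X xs)
    (hmom : 1 < α → ∫⁻ ω, (∑' i : ℕ, ‖Θ (i + 1) ω‖ₑ) ^ (α - 1) ∂P' < ∞)
    {f : E d → ℝ} (hf : Continuous f) {B : ℝ} (hB : ∀ z, |f z| ≤ B) {u : ℝ} (hu : 0 < u)
    (hf0 : ∀ z, ‖z‖ ≤ u → f z = 0) :
    Tendsto (fun n : ℕ => (∫ ω, f ((xs n)⁻¹ • partialSum X n ω) ∂P) /
        (n * P.real {ω | xs n < ‖X 0 ω‖})) atTop (𝓝 (∫ z, f z ∂clusterMeasure P' Θ α)) := by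
  have hB0 : 0 ≤ B := (abs_nonneg _).trans (hB 0)
  have hX := S.measurable_X
  set μ := clusterMeasure P' Θ α
  have hms : MeasurableSet {z : E d | u < ‖z‖} := measurableSet_lt measurable_const measurable_norm
  have hfin : μ {z | u < ‖z‖} ≠ ∞ := S.clusterMeasure_norm_ne_top hlim hC hmom hu
  have hfi : ∀ (g : E d → ℝ) (c : ℝ), Measurable g → (∀ z, |g z| ≤ c) → (∀ z, ‖z‖ ≤ u → g z = 0) →
      Integrable g μ := by
    intro g c hg hc hg0
    have hI : Integrable (({z : E d | u < ‖z‖} : Set _).indicator fun _ => c) μ :=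
      (integrable_indicator_iff hms).2 (integrableOn_const hfin)
    refine hI.mono' hg.aestronglyMeasurable (.of_forall fun z => ?_)
    by_cases hz : u < ‖z‖
    · rw [Set.indicator_of_mem (s := {z : E d | u < ‖z‖}) hz]; exact hc z
    · rw [Set.indicator_of_notMem (s := {z : E d | u < ‖z‖}) hz, hg0 z (not_lt.1 hz), norm_zero]
  have hκ : Tendsto (fun K : ℕ => ∫ z, (1 - cutoff (K : ℝ) z) ∂μ.restrict {z | u < ‖z‖}) atTop
      (𝓝 0) := by
    have : IsFiniteMeasure (μ.restrict {z | u < ‖z‖}) :=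
      ⟨by rw [Measure.restrict_apply_univ]; exact hfin.lt_top⟩
    exact tendsto_integral_one_sub_cutoff _ (g := fun z : E d => z) aemeasurable_id
  refine tendsto_of_approx fun e he => ?_
  obtain ⟨K, hK1, hK2⟩ := ((hκ.eventually (gt_mem_nhds (show 0 < e / (B + 1) by positivity))).and
    (eventually_ge_atTop ⌈u⌉₊)).exists
  have huK : u ≤ K := (Nat.le_ceil u).trans (by exact_mod_cast hK2)
  -- κ is uniformly continuous and vanishes on the ball of radius u, because K ≥ u. The previous
  -- result applied to κ shows that little rescaled mass lies far out, which reduces f to its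
  -- compactly supported part.
  set κ : E d → ℝ := fun z => 1 - cutoff (K : ℝ) z
  have hκ0 : ∀ z, 0 ≤ κ z := fun z => sub_nonneg.2 (cutoff_le_one _ _)
  have hκ1 : ∀ z, |κ z| ≤ 1 := fun z => by
    rw [abs_of_nonneg (hκ0 z)]; exact sub_le_self _ (cutoff_nonneg _ _)
  have hκz : ∀ z, ‖z‖ ≤ u → κ z = 0 := fun z hz => by
    simp only [κ, cutoff_eq_one (hz.trans huK), sub_self]
  have hκc : Continuous κ := continuous_const.sub (continuous_cutoff _)
  have hκu : UniformContinuous κ := by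
    refine (LipschitzWith.of_dist_le_mul (K := 1) fun z y => ?_).uniformContinuous
    rw [Real.dist_eq, NNReal.coe_one, one_mul, dist_eq_norm]
    simp only [κ, sub_sub_sub_cancel_left]
    rw [abs_sub_comm]
    exact lipschitz_cutoff _ _ _
  have hgc : Continuous fun z => f z * cutoff (K : ℝ) z := hf.mul (continuous_cutoff _)
  have hgu : UniformContinuous fun z => f z * cutoff (K : ℝ) z := by
    refine HasCompactSupport.uniformContinuous_of_continuous
      (HasCompactSupport.intro (isCompact_closedBall (0 : E d) (K + 1)) fun z hz => ?_) hgc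
    rw [mem_closedBall_zero_iff, not_le] at hz
    rw [cutoff_eq_zero hz.le, mul_zero]
  have hgB : ∀ z, |f z * cutoff (K : ℝ) z| ≤ B := fun z => by
    rw [abs_mul, abs_of_nonneg (cutoff_nonneg _ _)]
    exact (mul_le_of_le_one_right (abs_nonneg _) (cutoff_le_one _ _)).trans (hB z)
  have hg0 : ∀ z, ‖z‖ ≤ u → f z * cutoff (K : ℝ) z = 0 := fun z hz => by rw [hf0 z hz, zero_mul]
  have hfg : ∀ z, |f z - f z * cutoff (K : ℝ) z| ≤ B * κ z := fun z => by
    rw [show f z - f z * cutoff (K : ℝ) z = f z * κ z by simp only [κ]; ring, abs_mul,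
      abs_of_nonneg (hκ0 z)]
    exact mul_le_mul_of_nonneg_right (hB z) (hκ0 z)
  have hκint : ∫ z, κ z ∂μ < e / (B + 1) := by
    rwa [setIntegral_eq_integral_of_forall_compl_eq_zero (s := {z : E d | u < ‖z‖})
      fun z hz => hκz z (not_lt.1 hz)] at hK1
  have hBe : B * (e / (B + 1)) ≤ e := by
    rw [mul_div_assoc', div_le_iff₀ (by positivity)]; nlinarith
  refine ⟨_, _, S.tendsto_of_uniformContinuous hlim hC hV hmom hgu hgB hu hg0, ?_, ?_⟩
  · have hκl := S.tendsto_of_uniformContinuous hlim hC hV hmom hκu hκ1 hu hκz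
    filter_upwards [hκl.eventually (gt_mem_nhds hκint), eventually_ge_atTop 1] with n h1 hn
    have hp := S.tail_pos (xs n)
    have hn0 : (0 : ℝ) < n := by exact_mod_cast hn
    have hWm : Measurable fun ω => (xs n)⁻¹ • partialSum X n ω :=
      by exact (S.measurable_partialSum n).const_smul (xs n)⁻¹
    have hi : ∀ (g : E d → ℝ) (c : ℝ), Continuous g → (∀ z, |g z| ≤ c) →
        Integrable (fun ω => g ((xs n)⁻¹ • partialSum X n ω)) P := fun g c hg hc =>
      .of_bound (hg.measurable.comp hWm).aestronglyMeasurable c (.of_forall fun ω => hc _)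
    rw [← sub_div, abs_div, abs_of_pos (mul_pos hn0 hp), div_le_iff₀ (mul_pos hn0 hp),
      ← integral_sub (hi f B hf hB) (hi _ B hgc hgB)]
    rw [div_lt_iff₀ (mul_pos hn0 hp)] at h1
    calc _ ≤ ∫ ω, B * κ ((xs n)⁻¹ • partialSum X n ω) ∂P :=
          abs_integral_le_integral_abs.trans (integral_mono
            ((hi f B hf hB).sub (hi _ B hgc hgB)).abs ((hi κ 1 hκc hκ1).const_mul B)
            fun ω => hfg _)
      _ = B * ∫ ω, κ ((xs n)⁻¹ • partialSum X n ω) ∂P := integral_const_mul _ _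
      _ ≤ B * (e / (B + 1) * (n * P.real {ω | xs n < ‖X 0 ω‖})) := by gcongr
      _ = B * (e / (B + 1)) * (n * P.real {ω | xs n < ‖X 0 ω‖}) := by ring
      _ ≤ _ := by gcongr
  · have hi1 := hfi f B hf.measurable hB hf0
    have hi2 := hfi _ B hgc.measurable hgB hg0
    have hi3 := hfi κ 1 hκc.measurable hκ1 hκz
    rw [← integral_sub hi1 hi2]
    calc _ ≤ ∫ z, B * κ z ∂μ := abs_integral_le_integral_abs.trans
          (integral_mono (hi1.sub hi2).abs (hi3.const_mul B) fun z => hfg z)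
      _ = B * ∫ z, κ z ∂μ := integral_const_mul _ _
      _ ≤ B * (e / (B + 1)) := by gcongr
      _ ≤ e := hBe

end SpectralSetup

end HeavyTail

namespace HeavyTail

/-! ### Half-spaces and the limit constant -/

/-- The indicator of `(1, ∞)`. -/
noncomputable def aboveOne : ℝ → ℝ := (Set.Ioi 1).indicator fun _ => 1

theorem measurable_aboveOne : Measurable aboveOne := measurable_const.indicator measurableSet_Ioi

theorem aboveOne_of_lt {s : ℝ} (h : 1 < s) : aboveOne s = 1 := Set.indicator_of_mem h _

theorem aboveOne_of_le {s : ℝ} (h : s ≤ 1) : aboveOne s = 0 :=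
  Set.indicator_of_notMem (fun h' => absurd h' (not_lt.2 h)) _

theorem continuousAt_aboveOne {s : ℝ} (h : s ≠ 1) : ContinuousAt aboveOne s := by
  rcases lt_or_gt_of_ne h with h | h
  · refine (continuousAt_const (y := (0 : ℝ))).congr ?_
    filter_upwards [gt_mem_nhds h] with t ht using (aboveOne_of_le (le_of_lt ht)).symm
  · refine (continuousAt_const (y := (1 : ℝ))).congr ?_
    filter_upwards [lt_mem_nhds h] with t ht using (aboveOne_of_lt ht).symm

theorem aboveOne_mul (w : ℝ) :
    (fun y => aboveOne (y * w)) = ({y | 1 < y * w} : Set ℝ).indicator fun _ => 1 := rfl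

theorem measurableSet_one_lt_mul (w : ℝ) : MeasurableSet {y : ℝ | 1 < y * w} :=
  measurableSet_lt measurable_const (by fun_prop)

theorem radialMeasure_one_lt_mul {α : ℝ} (hα : 0 < α) (w : ℝ) :
    radialMeasure α {y | 1 < y * w} = ENNReal.ofReal (max w 0 ^ α) := by
  rw [radialMeasure_setOf_lt_mul hα one_pos, Real.one_rpow, one_mul]

theorem integrable_aboveOne_mul {α : ℝ} (hα : 0 < α) (w : ℝ) :
    Integrable (fun y => aboveOne (y * w)) (radialMeasure α) := by
  rw [aboveOne_mul]
  refine (integrable_indicator_iff (measurableSet_one_lt_mul w)).2 (integrableOn_const ?_)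
  rw [radialMeasure_one_lt_mul hα]
  exact ENNReal.ofReal_ne_top

theorem integral_aboveOne_sub {α : ℝ} (hα : 0 < α) (a b : ℝ) :
    ∫ y, (aboveOne (y * a) - aboveOne (y * b)) ∂radialMeasure α = max a 0 ^ α - max b 0 ^ α := by
  have h : ∀ w, ∫ y, aboveOne (y * w) ∂radialMeasure α = max w 0 ^ α := fun w => by
    rw [aboveOne_mul, integral_indicator_const _ (measurableSet_one_lt_mul w), measureReal_def,
      radialMeasure_one_lt_mul hα, ENNReal.toReal_ofReal (by positivity), smul_eq_mul, mul_one]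
  rw [integral_sub (integrable_aboveOne_mul hα a) (integrable_aboveOne_mul hα b), h, h]

/-- For y > 0 the difference of the indicators has a constant sign, so its absolute value integrates
to a difference of two tails. -/
theorem lintegral_aboveOne_sub_le {α : ℝ} (hα : 0 < α) (a b : ℝ) :
    ∫⁻ y, ‖aboveOne (y * a) - aboveOne (y * b)‖ₑ ∂radialMeasure α ≤
      ENNReal.ofReal |max a 0 ^ α - max b 0 ^ α| := by
  wlog hab : a ≤ b generalizing a b with H
  · have := H b a (le_of_not_ge hab)
    rw [abs_sub_comm] at this
    refine le_trans (lintegral_mono fun y => ?_) this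
    rw [enorm_sub_rev]
  have hle : max a 0 ^ α ≤ max b 0 ^ α :=
    Real.rpow_le_rpow (le_max_right _ _) (max_le_max_right 0 hab) hα.le
  have hmB := measurableSet_one_lt_mul b
  have hmA := measurableSet_one_lt_mul a
  have h1 : ∫⁻ y, ‖aboveOne (y * a) - aboveOne (y * b)‖ₑ ∂radialMeasure α ≤
      radialMeasure α ({y | 1 < y * b} \ {y | 1 < y * a}) := by
    rw [← lintegral_indicator_one (hmB.diff hmA)]
    refine lintegral_mono_ae ?_
    filter_upwards [radialMeasure_ae_pos α] with y hy
    have hyab : y * a ≤ y * b := mul_le_mul_of_nonneg_left hab hy.le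
    rcases lt_or_ge 1 (y * a) with h | h
    · rw [aboveOne_of_lt h, aboveOne_of_lt (h.trans_le hyab)]
      simp
    · rcases lt_or_ge 1 (y * b) with h' | h'
      · rw [Set.indicator_of_mem (show y ∈ {y | 1 < y * b} \ {y | 1 < y * a} from
          ⟨h', fun h'' => absurd h'' (not_lt.2 h)⟩), aboveOne_of_le h, aboveOne_of_lt h']
        simp
      · rw [aboveOne_of_le h, aboveOne_of_le h']
        simp
  refine h1.trans ?_
  rw [abs_sub_comm, abs_of_nonneg (sub_nonneg.2 hle)]
  rcases le_or_gt a 0 with ha | ha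
  · rw [max_eq_right ha, Real.zero_rpow hα.ne', sub_zero, ← radialMeasure_one_lt_mul hα]
    exact measure_mono Set.sdiff_subset
  · have hsub : {y : ℝ | 1 < y * a} ⊆ {y | 1 < y * b} := fun y (hy : 1 < y * a) => by
      have hy0 : 0 < y := pos_of_mul_pos_left (one_pos.trans hy) ha.le
      exact hy.trans_le (mul_le_mul_of_nonneg_left hab hy0.le)
    rw [measure_sdiff hsub hmA.nullMeasurableSet (by
      rw [radialMeasure_one_lt_mul hα]; exact ENNReal.ofReal_ne_top),
      radialMeasure_one_lt_mul hα, radialMeasure_one_lt_mul hα,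
      ENNReal.ofReal_sub _ (by positivity)]

/-- Uniform convergence over regions follows from convergence along all selections. -/
theorem tendsto_iSup_of_selections {Λ : ℕ → Set ℝ} (hΛ : ∀ n, 1 ≤ n → (Λ n).Nonempty)
    {g : ℕ → ℝ → ℝ}
    (h : ∀ xs : ℕ → ℝ, (∀ n, 1 ≤ n → xs n ∈ Λ n) → Tendsto (fun n => g n (xs n)) atTop (𝓝 0)) :
    Tendsto (fun n => ⨆ x ∈ Λ n, ENNReal.ofReal |g n x|) atTop (𝓝 0) := by
  rw [ENNReal.tendsto_nhds_zero]
  intro ε hε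
  -- At each n a point of Λ_n that violates the bound is selected whenever there is one; convergence
  -- along this selection excludes violations for large n.
  have hsel : ∀ n, ∃ x, 1 ≤ n → x ∈ Λ n ∧ ((∃ y ∈ Λ n, ε < ENNReal.ofReal |g n y|) →
      ε < ENNReal.ofReal |g n x|) := by
    intro n
    by_cases hn : 1 ≤ n
    · by_cases hy : ∃ y ∈ Λ n, ε < ENNReal.ofReal |g n y|
      · obtain ⟨y, hy1, hy2⟩ := hy
        exact ⟨y, fun _ => ⟨hy1, fun _ => hy2⟩⟩
      · obtain ⟨y, hy1⟩ := hΛ n hn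
        exact ⟨y, fun _ => ⟨hy1, fun h => absurd h hy⟩⟩
    · exact ⟨0, fun h => absurd h hn⟩
  choose xs hxs using hsel
  have hlim := h xs fun n hn => (hxs n hn).1
  have hlim2 : Tendsto (fun n => ENNReal.ofReal |g n (xs n)|) atTop (𝓝 0) := by
    have := ENNReal.tendsto_ofReal hlim.abs
    rwa [abs_zero, ENNReal.ofReal_zero] at this
  filter_upwards [ENNReal.tendsto_nhds_zero.1 hlim2 ε hε, eventually_ge_atTop 1] with n hn hn1
  refine iSup₂_le fun y hy => ?_
  by_contra hc
  exact absurd ((hxs n hn1).2 ⟨y, hy, not_le.1 hc⟩) (not_lt.2 hn)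

namespace SpectralSetup

set_option linter.unusedSectionVars false

variable {Ω Ω' : Type*} [MeasurableSpace Ω] [MeasurableSpace Ω'] {P : Measure Ω} {P' : Measure Ω'}
  {d : ℕ} {X : ℤ → Ω → E d} {Θ : ℤ → Ω' → E d} {α : ℝ}
  [IsProbabilityMeasure P] [IsProbabilityMeasure P'] (S : SpectralSetup P P' X Θ α)
include S

theorem ae_summable_norm {xs : ℕ → ℝ} (hlim : Tendsto xs atTop atTop) (hC : ClusterBound P X xs)
    (hmom : 1 < α → ∫⁻ ω, (∑' i : ℕ, ‖Θ (i + 1) ω‖ₑ) ^ (α - 1) ∂P' < ∞) :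
    ∀ᵐ ω ∂P', Summable fun i : ℕ => ‖Θ i ω‖ := by
  filter_upwards [S.ae_forwardSum hlim hC hmom] with ω hω
  refine (ENNReal.summable_toReal hω).congr fun t => ?_
  simp

theorem measurable_clusterDiff (θ : E d) : Measurable (clusterDiff Θ α θ) := by
  have := S.measurable_Θ
  unfold clusterDiff
  fun_prop

/-- The two positive parts differ by at most |θ'Θ_0| ≤ 1 and are bounded by ∑_{i≥0}‖Θ_i‖, which is
at least 1. The difference of powers is then at most a constant times this sum to the power max(α-1,
0). -/
theorem integrable_clusterDiff {xs : ℕ → ℝ} (hlim : Tendsto xs atTop atTop)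
    (hC : ClusterBound P X xs)
    (hmom : 1 < α → ∫⁻ ω, (∑' i : ℕ, ‖Θ (i + 1) ω‖ₑ) ^ (α - 1) ∂P' < ∞) {θ : E d}
    (hθ : ‖θ‖ = 1) : Integrable (clusterDiff Θ α θ) P' := by
  have hfin := S.lintegral_forwardSum_rpow hmom
  have hmeas : Measurable fun ω => forwardSum 0 (fun t => Θ t ω) :=
    (measurable_forwardSum 0).comp S.measurable_spectral
  have hi : Integrable (fun ω => (forwardSum 0 (fun t => Θ t ω) ^ max (α - 1) 0).toReal) P' :=
    integrable_toReal_of_lintegral_ne_top (hmeas.pow_const _).aemeasurable hfin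
  refine (hi.const_mul (max 1 α)).mono' (S.measurable_clusterDiff θ).aestronglyMeasurable ?_
  filter_upwards [S.ae_forwardSum hlim hC hmom, S.ae_norm_zero, S.ae_summable_norm hlim hC hmom]
    with ω hω h1 hs
  have hs0 : Summable fun i : ℕ => Θ i ω := .of_norm hs
  set F := forwardSum 0 (fun t => Θ t ω)
  have hF : F.toReal = ∑' i : ℕ, ‖Θ i ω‖ := by
    simp only [F, forwardSum, add_zero]
    rw [ENNReal.tsum_toReal_eq fun i => enorm_ne_top]
    simp
  have hF1 : 1 ≤ F.toReal := by
    rw [hF, ← h1]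
    exact hs.le_tsum 0 fun i _ => norm_nonneg _
  have hsplit : inner ℝ θ (∑' i : ℕ, Θ i ω) =
      inner ℝ θ (Θ 0 ω) + inner ℝ θ (∑' i : ℕ, Θ (i + 1) ω) := by
    rw [hs0.tsum_eq_zero_add, inner_add_right]
    simp
  have hle1 : |inner ℝ θ (Θ 0 ω)| ≤ 1 := by
    have := abs_real_inner_le_norm θ (Θ 0 ω)
    rwa [hθ, h1, one_mul] at this
  have hnorm1 : ∀ v : E d, ‖v‖ ≤ F.toReal → max (inner ℝ θ v) 0 ≤ F.toReal := fun v hv =>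
    max_le ((le_abs_self _).trans ((abs_real_inner_le_norm θ v).trans (by rwa [hθ, one_mul])))
      ENNReal.toReal_nonneg
  have ha : ‖∑' i : ℕ, Θ i ω‖ ≤ F.toReal := by rw [hF]; exact norm_tsum_le_tsum_norm hs
  have hb : ‖∑' i : ℕ, Θ (i + 1) ω‖ ≤ F.toReal := by
    have hs1 : Summable fun i : ℕ => ‖Θ (i + 1) ω‖ := by
      exact_mod_cast (summable_nat_add_iff 1).2 hs
    refine (norm_tsum_le_tsum_norm hs1).trans ?_
    rw [hF, hs.tsum_eq_zero_add]
    push_cast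
    exact le_add_of_nonneg_left (norm_nonneg _)
  set a := inner ℝ θ (∑' i : ℕ, Θ i ω)
  set b := inner ℝ θ (∑' i : ℕ, Θ (i + 1) ω)
  have hd : |max a 0 - max b 0| ≤ 1 := by
    refine (abs_max_sub_max_le_max _ _ _ _).trans (max_le ?_ (by simp))
    rw [hsplit, add_sub_cancel_right]
    exact hle1
  rw [← ENNReal.toReal_rpow]
  change |max a 0 ^ α - max b 0 ^ α| ≤ _
  have hα := S.index_pos
  rw [abs_le] at hd
  rcases le_total (max b 0) (max a 0) with h | h
  · rw [abs_of_nonneg (sub_nonneg.2 (Real.rpow_le_rpow (le_max_right _ _) h hα.le))]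
    exact rpow_sub_rpow_le hα (le_max_right _ _) h hd.2 (hnorm1 _ ha) hF1
  · rw [abs_sub_comm, abs_of_nonneg (sub_nonneg.2 (Real.rpow_le_rpow (le_max_right _ _) h hα.le))]
    exact rpow_sub_rpow_le hα (le_max_right _ _) h (by linarith [hd.1]) (hnorm1 _ hb) hF1

theorem increment_aboveOne_smul (θ : E d) (y : ℝ) (ω : Ω') :
    increment (fun z => aboveOne (inner ℝ θ z)) id (fun t => y • Θ t ω) =
      aboveOne (y * inner ℝ θ (∑' i : ℕ, Θ i ω)) -
        aboveOne (y * inner ℝ θ (∑' i : ℕ, Θ (i + 1) ω)) := by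
  simp only [increment, id, tsum_const_smul'', inner_smul_right]

/-- The value of the limit measure on half-spaces. -/
theorem clusterMeasure_halfSpace {xs : ℕ → ℝ} (hlim : Tendsto xs atTop atTop)
    (hC : ClusterBound P X xs)
    (hmom : 1 < α → ∫⁻ ω, (∑' i : ℕ, ‖Θ (i + 1) ω‖ₑ) ^ (α - 1) ∂P' < ∞) {θ : E d}
    (hθ : ‖θ‖ = 1) :
    (clusterMeasure P' Θ α).real {z | 1 < inner ℝ θ z} = ∫ ω, clusterDiff Θ α θ ω ∂P' := by
  have hα := S.index_pos
  have hm := measurable_tsum_path (d := d)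
  set q : E d → ℝ := fun z => aboveOne (inner ℝ θ z)
  have hq : Measurable q := measurable_aboveOne.comp (by fun_prop)
  have hqs : q = ({z | 1 < inner ℝ θ z} : Set (E d)).indicator fun _ => 1 := rfl
  have hms : MeasurableSet {z : E d | 1 < inner ℝ θ z} :=
    measurableSet_lt measurable_const (by fun_prop)
  have hpath : Measurable fun (p : ℝ × Ω') (t : ℤ) => p.1 • Θ t p.2 := by
    have := S.measurable_Θ
    fun_prop
  have hD : Measurable (increment q id) := measurable_increment hq measurable_id
  -- Without truncation the increment need not be supported on ‖x_0‖ > ε; its integrability is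
  -- obtained by integrating out the radius first.
  have hDint : Integrable (increment q id) (tailMeasure P' Θ α) := by
    refine ⟨hD.aestronglyMeasurable, ?_⟩
    rw [hasFiniteIntegral_iff_enorm, lintegral_tailMeasure S.measurable_Θ hD.enorm]
    have hle : ∫⁻ ω, ∫⁻ y, ‖increment q id (fun t => y • Θ t ω)‖ₑ ∂radialMeasure α ∂P' ≤
        ∫⁻ ω, ENNReal.ofReal |clusterDiff Θ α θ ω| ∂P' := lintegral_mono fun ω => by
      simp only [q, S.increment_aboveOne_smul]
      exact lintegral_aboveOne_sub_le hα _ _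
    refine hle.trans_lt ?_
    have := (S.integrable_clusterDiff hlim hC hmom hθ).abs.lintegral_lt_top
    exact this
  -- The indicator is discontinuous only on the hyperplane θ'z = 1, which is hit by at most one
  -- multiple of each path and so has mass 0.
  have hqc : ∀ᵐ x ∂(tailMeasure P' Θ α).restrict (anchor d), ContinuousAt q (∑' t, id (x t)) := by
    have hmA : MeasurableSet {x : ℤ → E d | inner ℝ θ (∑' t, x t) = 1} :=
      measurableSet_eq_fun (by fun_prop) measurable_const
    have h0 : tailMeasure P' Θ α {x | inner ℝ θ (∑' t, x t) = 1} = 0 := by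
      rw [tailMeasure_apply S.measurable_Θ hmA, lintegral_eq_zero_of_ae_eq_zero]
      refine .of_forall fun ω => ?_
      simp only [Set.mem_ofPred_eq, tsum_const_smul'', inner_smul_right]
      exact radialMeasure_setOf_mul_eq α one_pos _
    filter_upwards [ae_restrict_of_ae (measure_eq_zero_iff_ae_notMem.1 h0)] with x hx
    exact ContinuousAt.comp (f := fun z : E d => inner ℝ θ z) (continuousAt_aboveOne hx)
      (by fun_prop)
  have hq0 : ∀ᶠ z in 𝓝 (0 : E d), q z = 0 := by
    have : Tendsto (fun z : E d => inner ℝ θ z) (𝓝 0) (𝓝 0) := by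
      have h : Continuous fun z : E d => inner ℝ θ z := by fun_prop
      simpa using h.tendsto 0
    filter_upwards [this.eventually (gt_mem_nhds one_pos)] with z hz using aboveOne_of_le hz.le
  have h := S.integral_increment hlim hC hmom hq measurable_id (fun z => le_rfl) hq0 hqc hDint
  have h1 : ∫ x in anchor d, q (∑' t, id (x t)) ∂tailMeasure P' Θ α =
      (clusterMeasure P' Θ α).real {z | 1 < inner ℝ θ z} := by
    have h2 := integral_map (μ := (tailMeasure P' Θ α).restrict (anchor d)) hm.aemeasurable
      (f := q) hq.aestronglyMeasurable
    have h3 : ∫ z, q z ∂clusterMeasure P' Θ α =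
        (clusterMeasure P' Θ α).real {z | 1 < inner ℝ θ z} := by
      rw [hqs, integral_indicator_const _ hms, smul_eq_mul, mul_one]
    exact h2.symm.trans h3
  rw [← h1, ← h]
  unfold tailMeasure at hDint ⊢
  rw [integral_map hpath.aemeasurable hD.aestronglyMeasurable]
  have hDint' := (integrable_map_measure hD.aestronglyMeasurable hpath.aemeasurable).1 hDint
  refine (integral_prod_symm _ hDint').trans (integral_congr_ae (.of_forall fun ω => ?_))
  simp only [Function.comp, q, S.increment_aboveOne_smul]
  exact integral_aboveOne_sub hα _ _

theorem clusterMeasure_halfSpace_smul {θ : E d} {s : ℝ} (hs : 0 < s) :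
    (clusterMeasure P' Θ α).real {z | s < inner ℝ θ z} =
      s ^ (-α) * (clusterMeasure P' Θ α).real {z | 1 < inner ℝ θ z} := by
  have hms : MeasurableSet {z : E d | 1 < inner ℝ θ z} :=
    measurableSet_lt measurable_const (by fun_prop)
  have h := S.clusterMeasure_smul (inv_pos.2 hs) hms
  have e : {z : E d | s⁻¹ • z ∈ {z : E d | 1 < inner ℝ θ z}} = {z | s < inner ℝ θ z} := by
    ext z
    simp only [Set.mem_ofPred_eq, inner_smul_right]
    rw [inv_mul_eq_div, one_lt_div hs]
  rw [e] at h
  rw [measureReal_def, h, ENNReal.toReal_mul, ENNReal.toReal_ofReal (by positivity),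
    Real.inv_rpow hs.le, ← Real.rpow_neg hs.le, measureReal_def]

/-- The large deviation relation for half-spaces along one sequence of levels. -/
theorem tendsto_halfSpace {xs : ℕ → ℝ} (hlim : Tendsto xs atTop atTop)
    (hC : ClusterBound P X xs) (hV : SmallValueBound P X xs)
    (hmom : 1 < α → ∫⁻ ω, (∑' i : ℕ, ‖Θ (i + 1) ω‖ₑ) ^ (α - 1) ∂P' < ∞) {θ : E d}
    (hθ : ‖θ‖ = 1) :
    Tendsto (fun n : ℕ => P.real {ω | xs n < inner ℝ θ (partialSum X n ω)} /
      (n * P.real {ω | xs n < ‖X 0 ω‖})) atTop (𝓝 (∫ ω, clusterDiff Θ α θ ω ∂P')) := by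
  rw [← S.clusterMeasure_halfSpace hlim hC hmom hθ]
  set μ := clusterMeasure P' Θ α
  set c := μ.real {z | 1 < inner ℝ θ z}
  have hin : ∀ z : E d, inner ℝ θ z ≤ ‖z‖ := fun z => by
    have := real_inner_le_norm θ z
    rwa [hθ, one_mul] at this
  have hms : ∀ s : ℝ, MeasurableSet {z : E d | s < inner ℝ θ z} := fun s =>
    measurableSet_lt measurable_const (by fun_prop)
  have hfin : ∀ s : ℝ, 0 < s → μ {z | s < inner ℝ θ z} ≠ ∞ := fun s hs =>
    ne_top_of_le_ne_top (S.clusterMeasure_norm_ne_top hlim hC hmom hs)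
      (measure_mono fun z hz => lt_of_lt_of_le hz (hin z))
  have hL : ∀ a b : ℝ, 0 < a → a < b → Tendsto (fun n : ℕ =>
      (∫ ω, ramp a b (inner ℝ θ ((xs n)⁻¹ • partialSum X n ω)) ∂P) /
        (n * P.real {ω | xs n < ‖X 0 ω‖})) atTop (𝓝 (∫ z, ramp a b (inner ℝ θ z) ∂μ)) :=
    fun a b ha hab => S.tendsto_clusterMeasure (f := fun z => ramp a b (inner ℝ θ z)) hlim hC hV
      hmom (by fun_prop) (B := 1) (fun z => by
        rw [abs_of_nonneg (ramp_nonneg _ _ _)]; exact ramp_le_one _ _ _) ha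
      fun z hz => ramp_eq_zero hab ((hin z).trans hz)
  -- A ramp from a to b lies between the indicators of two parallel half-spaces, whose masses are
  -- multiples of c by homogeneity.
  have hIL : ∀ a b : ℝ, 0 < a → a < b → Integrable (fun z : E d => ramp a b (inner ℝ θ z)) μ ∧
      ∫ z, ramp a b (inner ℝ θ z) ∂μ ≤ a ^ (-α) * c ∧
      b ^ (-α) * c ≤ ∫ z, ramp a b (inner ℝ θ z) ∂μ := by
    intro a b ha hab
    have hI : ∀ s, 0 < s → Integrable (({z | s < inner ℝ θ z} : Set (E d)).indicator
        fun _ => (1 : ℝ)) μ := fun s hs =>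
      (integrable_indicator_iff (hms s)).2 (integrableOn_const (hfin s hs))
    have hval : ∀ s, 0 < s → ∫ z, ({z | s < inner ℝ θ z} : Set (E d)).indicator
        (fun _ => (1 : ℝ)) z ∂μ = s ^ (-α) * c := fun s hs => by
      rw [integral_indicator_const _ (hms s), smul_eq_mul, mul_one]
      exact S.clusterMeasure_halfSpace_smul hs
    have hle : ∀ z : E d, ramp a b (inner ℝ θ z) ≤
        ({z | a < inner ℝ θ z} : Set (E d)).indicator (fun _ => (1 : ℝ)) z := fun z => by
      by_cases hz : a < inner ℝ θ z
      · rw [Set.indicator_of_mem (s := {z : E d | a < inner ℝ θ z}) hz]; exact ramp_le_one _ _ _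
      · rw [Set.indicator_of_notMem (s := {z : E d | a < inner ℝ θ z}) hz,
          ramp_eq_zero hab (not_lt.1 hz)]
    have hge : ∀ z : E d, ({z | b < inner ℝ θ z} : Set (E d)).indicator (fun _ => (1 : ℝ)) z ≤
        ramp a b (inner ℝ θ z) := fun z => by
      by_cases hz : b < inner ℝ θ z
      · rw [Set.indicator_of_mem (s := {z : E d | b < inner ℝ θ z}) hz, ramp_eq_one hab hz.le]
      · rw [Set.indicator_of_notMem (s := {z : E d | b < inner ℝ θ z}) hz]
        exact ramp_nonneg _ _ _
    have hR : Integrable (fun z : E d => ramp a b (inner ℝ θ z)) μ := by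
      refine (hI a ha).mono' (Continuous.aestronglyMeasurable (by fun_prop)) (.of_forall fun z => ?_)
      rw [Real.norm_of_nonneg (ramp_nonneg _ _ _)]
      exact hle z
    refine ⟨hR, ?_, ?_⟩
    · rw [← hval a ha]; exact integral_mono hR (hI a ha) hle
    · rw [← hval b (ha.trans hab)]; exact integral_mono (hI b (ha.trans hab)) hR hge
  have hcont : Tendsto (fun s : ℝ => s ^ (-α) * c) (𝓝 1) (𝓝 c) := by
    have := ((Real.continuousAt_rpow_const 1 (-α) (.inl one_ne_zero)).tendsto).mul_const c
    rwa [Real.one_rpow, one_mul] at this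
  have hset : ∀ (n : ℕ) (ω : Ω), 0 < xs n → (xs n < inner ℝ θ (partialSum X n ω) ↔
      1 < inner ℝ θ ((xs n)⁻¹ • partialSum X n ω)) := fun n ω hx => by
    rw [inner_smul_right, inv_mul_eq_div, one_lt_div hx]
  have hSm : ∀ n : ℕ, MeasurableSet {ω | xs n < inner ℝ θ (partialSum X n ω)} := fun n =>
    measurableSet_lt measurable_const (by have := S.measurable_partialSum n; fun_prop)
  have hPi : ∀ (n : ℕ) (a b : ℝ),
      Integrable (fun ω => ramp a b (inner ℝ θ ((xs n)⁻¹ • partialSum X n ω))) P := fun n a b => by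
    have := S.measurable_partialSum n
    refine .of_bound (Measurable.aestronglyMeasurable (by fun_prop)) 1 (.of_forall fun ω => ?_)
    rw [Real.norm_of_nonneg (ramp_nonneg _ _ _)]
    exact ramp_le_one _ _ _
  have hPind : ∀ n : ℕ, P.real {ω | xs n < inner ℝ θ (partialSum X n ω)} =
      ∫ ω, ({ω | xs n < inner ℝ θ (partialSum X n ω)} : Set Ω).indicator (fun _ => (1 : ℝ)) ω ∂P :=
    fun n => by rw [integral_indicator_const _ (hSm n), smul_eq_mul, mul_one]
  have hPii : ∀ n : ℕ, Integrable (({ω | xs n < inner ℝ θ (partialSum X n ω)} : Set Ω).indicator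
      fun _ => (1 : ℝ)) P := fun n => (integrable_const _).indicator (hSm n)
  -- The lower bound uses a ramp from 1 to some s > 1, the upper bound a ramp from some s < 1 to 1,
  -- with s close to 1.
  refine tendsto_order.2 ⟨fun l hl => ?_, fun l hl => ?_⟩
  · obtain ⟨s, hs1, hs2⟩ := ((hcont.mono_left (nhdsWithin_le_nhds (s := Set.Ioi 1))).eventually
      (lt_mem_nhds hl) |>.and self_mem_nhdsWithin).exists
    filter_upwards [(hL 1 s one_pos hs2).eventually
      (lt_mem_nhds (hs1.trans_le (hIL 1 s one_pos hs2).2.2)), eventually_ge_atTop 1,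
      hlim.eventually (eventually_gt_atTop 0)] with n h1 hn hx
    refine h1.trans_le ?_
    gcongr
    rw [hPind]
    refine integral_mono (hPi n 1 s) (hPii n) fun ω => ?_
    by_cases hω : xs n < inner ℝ θ (partialSum X n ω)
    · rw [Set.indicator_of_mem (s := {ω | xs n < inner ℝ θ (partialSum X n ω)}) hω]
      exact ramp_le_one _ _ _
    · rw [Set.indicator_of_notMem (s := {ω | xs n < inner ℝ θ (partialSum X n ω)}) hω]
      exact (ramp_eq_zero hs2 (not_lt.1 fun h => hω ((hset n ω hx).2 h))).le
  · obtain ⟨s, ⟨hs1, hs0⟩, hs2⟩ := ((hcont.eventually (gt_mem_nhds hl)).and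
      (lt_mem_nhds one_pos) |>.filter_mono (nhdsWithin_le_nhds (s := Set.Iio 1)) |>.and
      self_mem_nhdsWithin).exists
    have hs2 : s < 1 := hs2
    filter_upwards [(hL s 1 hs0 hs2).eventually
      (gt_mem_nhds ((hIL s 1 hs0 hs2).2.1.trans_lt hs1)), eventually_ge_atTop 1,
      hlim.eventually (eventually_gt_atTop 0)] with n h1 hn hx
    refine lt_of_le_of_lt ?_ h1
    gcongr
    rw [hPind]
    refine integral_mono (hPii n) (hPi n s 1) fun ω => ?_
    by_cases hω : xs n < inner ℝ θ (partialSum X n ω)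
    · rw [Set.indicator_of_mem (s := {ω | xs n < inner ℝ θ (partialSum X n ω)}) hω]
      exact (ramp_eq_one hs2 ((hset n ω hx).1 hω).le).ge
    · rw [Set.indicator_of_notMem (s := {ω | xs n < inner ℝ θ (partialSum X n ω)}) hω]
      exact ramp_nonneg _ _ _

end SpectralSetup

end HeavyTail

namespace HeavyTail

/-! ### Measures on the punctured compactified space -/

section Punctured

variable {d : ℕ}

theorem toExt_injective : Function.Injective (toExt (d := d)) := by
  intro y z h
  ext i
  exact EReal.coe_injective (congrFun h i)

theorem continuous_toExt : Continuous (toExt (d := d)) :=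
  continuous_pi fun i => continuous_coe_real_ereal.comp (by fun_prop)

theorem measurableEmbedding_toExt : MeasurableEmbedding (toExt (d := d)) :=
  continuous_toExt.measurable.measurableEmbedding toExt_injective

theorem toExt_zero : toExt (0 : E d) = 0 := by
  ext i; simp [toExt]

theorem toExt_eq_zero {y : E d} : toExt y = 0 ↔ y = 0 := by
  rw [← toExt_zero]; exact toExt_injective.eq_iff

theorem measurableEmbedding_val :
    MeasurableEmbedding (Subtype.val : PuncturedSpace d → Fin d → EReal) := by
  exact MeasurableEmbedding.subtype_coe (s := {z : Fin d → EReal | z ≠ 0})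
    (measurableSet_singleton 0).compl

theorem isOpen_ne_zero : IsOpen {z : Fin d → EReal | z ≠ 0} := isOpen_compl_singleton

theorem isOpenEmbedding_val :
    IsOpenEmbedding (Subtype.val : PuncturedSpace d → Fin d → EReal) := by
  exact isOpen_ne_zero.isOpenEmbedding_subtypeVal

instance : SecondCountableTopology (PuncturedSpace d) :=
  isOpenEmbedding_val.isInducing.secondCountableTopology

instance : LocallyCompactSpace (PuncturedSpace d) :=
  isOpenEmbedding_val.locallyCompactSpace

/-- Transport of a measure on `ℝ^d` to the punctured compactified space. -/
noncomputable def extendMeasure (m : Measure (E d)) : Measure (PuncturedSpace d) :=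
  Measure.comap Subtype.val (m.map toExt)

/-- The trace on `ℝ^d` of a set in the punctured compactified space. -/
def trace (A : Set (PuncturedSpace d)) : Set (E d) := {y | ∃ z ∈ A, z.1 = toExt y}

theorem extendMeasure_apply (m : Measure (E d)) (A : Set (PuncturedSpace d)) :
    extendMeasure m A = m (trace A) := by
  rw [extendMeasure, measurableEmbedding_val.comap_apply, measurableEmbedding_toExt.map_apply]
  rfl

theorem measurableSet_trace {A : Set (PuncturedSpace d)} (hA : MeasurableSet A) :
    MeasurableSet (trace A) := by
  exact continuous_toExt.measurable (measurableEmbedding_val.measurableSet_image.2 hA)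

theorem trace_dilate {c : ℝ} (hc : c ≠ 0) (A : Set (PuncturedSpace d)) :
    trace (dilate c A) = {y | c⁻¹ • y ∈ trace A} := by
  have hcc : ((c⁻¹ : ℝ) : EReal) * (c : EReal) = 1 := by
    rw [← EReal.coe_mul, inv_mul_cancel₀ hc, EReal.coe_one]
  have hcc' : (c : EReal) * ((c⁻¹ : ℝ) : EReal) = 1 := by
    rw [← EReal.coe_mul, mul_inv_cancel₀ hc, EReal.coe_one]
  have hsm : ∀ (y : E d) (i : Fin d), toExt (c⁻¹ • y) i = ((c⁻¹ : ℝ) : EReal) * toExt y i :=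
    fun y i => by
      simp only [toExt, PiLp.smul_apply, smul_eq_mul, EReal.coe_mul]
  ext y
  constructor
  · rintro ⟨z, ⟨a, ha, haz⟩, hz⟩
    refine ⟨a, ha, funext fun i => ?_⟩
    rw [hsm, ← hz, haz i, ← mul_assoc, hcc, one_mul]
  · rintro ⟨a, ha, hay⟩
    have hy : toExt y ≠ 0 := by
      intro h0
      rw [toExt_eq_zero] at h0
      rw [h0, smul_zero, toExt_zero] at hay
      exact a.2 hay
    refine ⟨⟨toExt y, hy⟩, ⟨a, ha, fun i => ?_⟩, rfl⟩
    rw [hay, hsm, ← mul_assoc, hcc', one_mul]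

theorem trace_halfSpace (θ : E d) : trace (halfSpace θ) = {y | 1 < inner ℝ θ y} := by
  ext y
  constructor
  · rintro ⟨z, ⟨y', hz, h⟩, hy⟩
    rw [toExt_injective (hy.symm.trans hz)]
    exact h
  · intro (h : 1 < inner ℝ θ y)
    have hy : toExt y ≠ 0 := by
      rw [Ne, toExt_eq_zero]
      rintro rfl
      rw [inner_zero_right] at h
      linarith
    exact ⟨⟨toExt y, hy⟩, ⟨y, rfl, h⟩, rfl⟩

/-- The extension by zero of a function on the punctured space, read on `ℝ^d`. -/
noncomputable def readBack (f : PuncturedSpace d → ℝ) (y : E d) : ℝ :=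
  Function.extend Subtype.val f 0 (toExt y)

theorem integral_extendMeasure (m : Measure (E d)) (f : PuncturedSpace d → ℝ) :
    ∫ z, f z ∂extendMeasure m = ∫ y, readBack f y ∂m := by
  unfold readBack
  rw [← measurableEmbedding_toExt.integral_map (Function.extend Subtype.val f 0)]
  have h1 : ∫ z, f z ∂extendMeasure m = ∫ z, Function.extend Subtype.val f 0
      (Subtype.val z) ∂extendMeasure m :=
    integral_congr_ae (.of_forall fun z => (Subtype.val_injective.extend_apply f 0 z).symm)
  rw [h1, ← measurableEmbedding_val.integral_map (Function.extend Subtype.val f 0), extendMeasure,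
    measurableEmbedding_val.map_comap]
  refine setIntegral_eq_integral_of_forall_compl_eq_zero fun z hz => ?_
  exact Function.extend_apply' _ _ _ fun ⟨a, ha⟩ => hz ⟨a, ha⟩

/-- A compact subset of the punctured space stays away from 0 but may reach infinity. Its test
functions therefore become bounded continuous functions that vanish near 0, with no decay at
infinity. -/
theorem readBack_properties {f : PuncturedSpace d → ℝ} (hf : Continuous f)
    (hc : HasCompactSupport f) :
    Continuous (readBack f) ∧ (∃ B, ∀ y, |readBack f y| ≤ B) ∧
      ∃ u : ℝ, 0 < u ∧ ∀ y, ‖y‖ ≤ u → readBack f y = 0 := by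
  have hcont : Continuous (readBack f) := by
    have h : Continuous (Function.extend Subtype.val f 0) := by
      exact HasCompactSupport.continuous_extend_zero isOpen_ne_zero hf hc
    exact h.comp continuous_toExt
  obtain ⟨B, hB⟩ := hc.exists_bound_of_continuous hf
  refine ⟨hcont, ⟨max B 0, fun y => ?_⟩, ?_⟩
  · by_cases hy : toExt y = 0
    · have : readBack f y = 0 := Function.extend_apply' _ _ _ fun ⟨a, ha⟩ => a.2 (ha.trans hy)
      rw [this, abs_zero]
      exact le_max_right _ _
    · have : readBack f y = f ⟨toExt y, hy⟩ :=
        Subtype.val_injective.extend_apply f 0 (⟨toExt y, hy⟩ : PuncturedSpace d)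
      rw [this]
      exact (hB _).trans (le_max_left _ _)
  · have hK : IsCompact (Subtype.val '' tsupport f) := hc.image continuous_subtype_val
    have h0 : toExt (0 : E d) ∈ (Subtype.val '' tsupport f)ᶜ := by
      rw [toExt_zero]
      rintro ⟨a, -, ha⟩
      exact a.2 ha
    have hnhds := (continuous_toExt.tendsto (0 : E d)).eventually
      (hK.isClosed.isOpen_compl.mem_nhds h0)
    obtain ⟨u, hu, hball⟩ := Metric.nhds_basis_closedBall.eventually_iff.1 hnhds
    refine ⟨u, hu, fun y hy => ?_⟩
    have hy' := hball (mem_closedBall_zero_iff.2 hy)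
    by_cases h : toExt y = 0
    · exact Function.extend_apply' _ _ _ fun ⟨a, ha⟩ => a.2 (ha.trans h)
    · have : readBack f y = f ⟨toExt y, h⟩ :=
        Subtype.val_injective.extend_apply f 0 (⟨toExt y, h⟩ : PuncturedSpace d)
      rw [this]
      by_contra hne
      exact hy' ⟨⟨toExt y, h⟩, subset_tsupport f hne, rfl⟩

/-- `m` is `α`-homogeneous, finite off balls around `0` and has no atom at `0`. -/
structure HomogeneousOn (α : ℝ) (m : Measure (E d)) : Prop where
  finite : ∀ u : ℝ, 0 < u → m {z | u < ‖z‖} ≠ ∞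
  smul : ∀ c : ℝ, 0 < c → ∀ A : Set (E d), MeasurableSet A →
    m {z | c • z ∈ A} = ENNReal.ofReal (c ^ α) * m A
  zero : m {0} = 0

theorem HomogeneousOn.homogeneousRadon {α : ℝ} {m : Measure (E d)} (h : HomogeneousOn α m) :
    HomogeneousRadon α (extendMeasure m) where
  finite_compact K hK := by
    have hKc : IsCompact (Subtype.val '' K) := hK.image continuous_subtype_val
    have h0 : toExt (0 : E d) ∈ (Subtype.val '' K)ᶜ := by
      rw [toExt_zero]
      rintro ⟨a, -, ha⟩
      exact a.2 ha
    have hnhds := (continuous_toExt.tendsto (0 : E d)).eventually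
      (hKc.isClosed.isOpen_compl.mem_nhds h0)
    obtain ⟨u, hu, hball⟩ := Metric.nhds_basis_closedBall.eventually_iff.1 hnhds
    rw [extendMeasure_apply]
    refine (measure_mono fun y hy => ?_).trans_lt (h.finite u hu).lt_top
    change u < ‖y‖
    by_contra hc
    obtain ⟨z, hz, hzy⟩ := hy
    exact hball (mem_closedBall_zero_iff.2 (not_lt.1 hc)) ⟨z, hz, hzy⟩
  homogeneous t ht A hA := by
    rw [extendMeasure_apply, extendMeasure_apply, trace_dilate ht.ne',
      h.smul t⁻¹ (inv_pos.2 ht) _ (measurableSet_trace hA), Real.inv_rpow ht.le,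
      ← Real.rpow_neg ht.le]

/-- The coordinates of a point with the infinite ones replaced by `0`. -/
noncomputable def finitePart (z : PuncturedSpace d) : E d := WithLp.toLp 2 fun i => (z.1 i).toReal

theorem measurable_finitePart : Measurable (finitePart (d := d)) := by
  unfold finitePart
  refine (WithLp.measurable_toLp 2 _).comp (measurable_pi_lambda _ fun i => ?_)
  exact measurable_ereal_toReal.comp ((measurable_pi_apply i).comp measurable_subtype_coe)

theorem toExt_finitePart {z : PuncturedSpace d} (hz : ∀ i, z.1 i ≠ ⊤ ∧ z.1 i ≠ ⊥) :
    toExt (finitePart z) = z.1 :=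
  funext fun i => EReal.coe_toReal (hz i).1 (hz i).2

theorem isCompact_preimage_val {C : Set (Fin d → EReal)} (hC : IsClosed C) (h0 : 0 ∉ C) :
    IsCompact ({z | z.1 ∈ C} : Set (PuncturedSpace d)) := by
  rw [isOpenEmbedding_val.isInducing.isCompact_iff]
  convert hC.isCompact
  ext z
  constructor
  · rintro ⟨a, ha, rfl⟩; exact ha
  · intro hz
    exact ⟨⟨z, fun h => h0 (h ▸ hz)⟩, hz, rfl⟩

/-- The points with an infinite coordinate form a compact set, of finite mass, that is invariant
under dilation by 2. Homogeneity multiplies its mass by 2^(-α) < 1, so it is null. -/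
theorem HomogeneousRadon.ae_finite {α : ℝ} (hα : 0 < α) {ν : Measure (PuncturedSpace d)}
    (h : HomogeneousRadon α ν) : ∀ᵐ z ∂ν, ∀ i, z.1 i ≠ ⊤ ∧ z.1 i ≠ ⊥ := by
  set C : Set (Fin d → EReal) := ⋃ i, {z | z i = ⊤ ∨ z i = ⊥}
  have hC : IsClosed C := isClosed_iUnion_of_finite fun i =>
    (isClosed_eq (continuous_apply i) continuous_const).union
      (isClosed_eq (continuous_apply i) continuous_const)
  have hC0 : (0 : Fin d → EReal) ∉ C := by
    simp only [C, Set.mem_iUnion, Set.mem_ofPred_eq, Pi.zero_apply, not_exists, not_or]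
    exact fun i => ⟨EReal.zero_ne_top, EReal.zero_ne_bot⟩
  set I : Set (PuncturedSpace d) := {z | z.1 ∈ C}
  have hIc : IsCompact I := isCompact_preimage_val hC hC0
  have hdil : dilate 2 I = I := by
    ext z
    simp only [dilate, I, C, Set.mem_ofPred_eq, Set.mem_iUnion]
    have h2 : (0 : EReal) < ((2 : ℝ) : EReal) := by exact_mod_cast two_pos
    constructor
    · rintro ⟨a, ⟨i, hi⟩, haz⟩
      refine ⟨i, ?_⟩
      rw [haz i]
      rcases hi with hi | hi
      · left; rw [hi, EReal.mul_top_of_pos h2]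
      · right; rw [hi, EReal.mul_bot_of_pos h2]
    · rintro ⟨i, hi⟩
      have hcc : ((2 : ℝ) : EReal) * ((2⁻¹ : ℝ) : EReal) = 1 := by
        rw [← EReal.coe_mul, mul_inv_cancel₀ two_ne_zero, EReal.coe_one]
      have h2' : (0 : EReal) < ((2⁻¹ : ℝ) : EReal) := by exact_mod_cast (by norm_num : (0:ℝ) < 2⁻¹)
      have hi' : ((2⁻¹ : ℝ) : EReal) * z.1 i = ⊤ ∨ ((2⁻¹ : ℝ) : EReal) * z.1 i = ⊥ := by
        rcases hi with hi | hi
        · left; rw [hi, EReal.mul_top_of_pos h2']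
        · right; rw [hi, EReal.mul_bot_of_pos h2']
      refine ⟨⟨fun j => ((2⁻¹ : ℝ) : EReal) * z.1 j, fun h0 => ?_⟩, ⟨i, hi'⟩, fun j => ?_⟩
      · have := congrFun h0 i
        simp only [Pi.zero_apply] at this
        rw [this] at hi'
        rcases hi' with hi' | hi'
        · exact EReal.zero_ne_top hi'
        · exact EReal.zero_ne_bot hi'
      · rw [← mul_assoc, hcc, one_mul]
  have hhom := h.homogeneous 2 two_pos I hIc.isClosed.measurableSet
  rw [hdil] at hhom
  have hfin := (h.finite_compact I hIc).ne
  have hlt : (2 : ℝ) ^ (-α) < 1 := Real.rpow_lt_one_of_one_lt_of_neg one_lt_two (by linarith)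
  have hI0 : ν I = 0 := by
    have h1 := congrArg ENNReal.toReal hhom
    rw [ENNReal.toReal_mul, ENNReal.toReal_ofReal (by positivity)] at h1
    have h2 : (ν I).toReal = 0 := by nlinarith [ENNReal.toReal_nonneg (a := ν I)]
    exact (ENNReal.toReal_eq_zero_iff _).1 h2 |>.resolve_right hfin
  filter_upwards [measure_eq_zero_iff_ae_notMem.1 hI0] with z hz i
  constructor
  · exact fun hi => hz (Set.mem_iUnion.2 ⟨i, .inl hi⟩)
  · exact fun hi => hz (Set.mem_iUnion.2 ⟨i, .inr hi⟩)

/-- The denominator d + 1 is cruder than √d but needs no separate treatment of d = 0. -/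
theorem exists_coord_of_norm {u : ℝ} (hu : 0 < u) {y : E d} (hy : u < ‖y‖) :
    ∃ i, u / (d + 1) ≤ |y i| := by
  by_contra! hc
  have hv : 0 < u / (d + 1 : ℝ) := by positivity
  have h1 : ‖y‖ ^ 2 ≤ d * (u / (d + 1)) ^ 2 := by
    rw [EuclideanSpace.norm_sq_eq]
    calc _ ≤ ∑ _i : Fin d, (u / (d + 1 : ℝ)) ^ 2 := Finset.sum_le_sum fun i _ => by
          rw [Real.norm_eq_abs]
          exact pow_le_pow_left₀ (abs_nonneg _) (hc i).le 2
      _ = _ := by simp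
  have h2 : (d : ℝ) * (u / (d + 1)) ^ 2 ≤ u ^ 2 := by
    rw [div_pow, mul_div_assoc', div_le_iff₀ (by positivity)]
    have hd : (0 : ℝ) ≤ d := Nat.cast_nonneg d
    nlinarith [mul_nonneg hd (sq_nonneg u), mul_nonneg (mul_nonneg hd hd) (sq_nonneg u),
      sq_nonneg u]
  nlinarith [norm_nonneg y]

/-- As there is no mass at infinity, ν is recovered from its part on ℝ^d. This reduces the
uniqueness questions to homogeneous measures on ℝ^d. -/
theorem HomogeneousRadon.homogeneousOn {α : ℝ} (hα : 0 < α) {ν : Measure (PuncturedSpace d)}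
    (h : HomogeneousRadon α ν) :
    HomogeneousOn α (ν.map finitePart) ∧ extendMeasure (ν.map finitePart) = ν := by
  have hae := h.ae_finite hα
  have hm := measurable_finitePart (d := d)
  refine ⟨⟨fun u hu => ?_, fun c hc A hA => ?_, ?_⟩, ?_⟩
  · rw [Measure.map_apply hm (measurableSet_lt measurable_const measurable_norm)]
    set v := u / (d + 1)
    have hv : 0 < v := by positivity
    set C : Set (Fin d → EReal) := ⋃ i, {z | (v : EReal) ≤ z i ∨ z i ≤ ((-v : ℝ) : EReal)}
    have hC : IsClosed C := isClosed_iUnion_of_finite fun i =>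
      (isClosed_le continuous_const (continuous_apply i)).union
        (isClosed_le (continuous_apply i) continuous_const)
    have hC0 : (0 : Fin d → EReal) ∉ C := by
      simp only [C, Set.mem_iUnion, Set.mem_ofPred_eq, Pi.zero_apply, not_exists, not_or, not_le]
      exact fun i => ⟨by exact_mod_cast hv, by exact_mod_cast (neg_lt_zero.2 hv)⟩
    refine ne_top_of_le_ne_top (h.finite_compact _ (isCompact_preimage_val hC hC0)).ne
      (measure_mono_ae ?_)
    filter_upwards [hae] with z hz hzu
    obtain ⟨i, hi⟩ := exists_coord_of_norm hu (show u < ‖finitePart z‖ from hzu)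
    refine Set.mem_iUnion.2 ⟨i, ?_⟩
    rw [← toExt_finitePart hz]
    rcases le_abs.1 hi with hi | hi
    · left; exact EReal.coe_le_coe_iff.2 hi
    · right; exact EReal.coe_le_coe_iff.2 (by linarith)
  · have hA' : MeasurableSet {z : E d | c • z ∈ A} := (measurable_const_smul c) hA
    have hcc : ((c⁻¹ : ℝ) : EReal) * (c : EReal) = 1 := by
      rw [← EReal.coe_mul, inv_mul_cancel₀ hc.ne', EReal.coe_one]
    have hcc' : (c : EReal) * ((c⁻¹ : ℝ) : EReal) = 1 := by
      rw [← EReal.coe_mul, mul_inv_cancel₀ hc.ne', EReal.coe_one]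
    rw [Measure.map_apply hm hA', Measure.map_apply hm hA]
    have hd := h.homogeneous c⁻¹ (inv_pos.2 hc) _ (hm hA)
    rw [Real.inv_rpow hc.le, Real.rpow_neg hc.le, inv_inv] at hd
    rw [← hd]
    congr 1
    ext z
    constructor
    · intro (hz : c • finitePart z ∈ A)
      refine ⟨⟨fun i => (c : EReal) * z.1 i, fun h0 => z.2 (funext fun i => ?_)⟩, ?_, fun i => ?_⟩
      · have := congrFun h0 i
        simp only [Pi.zero_apply] at this ⊢
        rw [← one_mul (z.1 i), ← hcc, mul_assoc, this, mul_zero]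
      · change finitePart _ ∈ A
        convert hz using 1
        ext i
        simp [finitePart, EReal.toReal_mul]
      · rw [← mul_assoc, hcc, one_mul]
    · rintro ⟨a, ha, haz⟩
      change c • finitePart z ∈ A
      convert (show finitePart a ∈ A from ha) using 1
      ext i
      simp only [finitePart, PiLp.smul_apply, smul_eq_mul, haz i, EReal.toReal_mul,
        EReal.toReal_coe]
      field_simp
  · rw [Measure.map_apply hm (measurableSet_singleton 0)]
    refine measure_eq_zero_iff_ae_notMem.2 ?_
    filter_upwards [hae] with z hz hz0
    have hz0 : finitePart z = 0 := hz0
    exact z.2 (by rw [← toExt_finitePart hz, hz0, toExt_zero])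
  · ext A hA
    rw [extendMeasure_apply, Measure.map_apply hm (measurableSet_trace hA)]
    refine measure_congr ?_
    filter_upwards [hae] with z hz
    refine propext ⟨?_, fun hzA => ⟨z, hzA, (toExt_finitePart hz).symm⟩⟩
    rintro ⟨a, ha, haz⟩
    rw [toExt_finitePart hz] at haz
    exact Subtype.ext haz ▸ ha

theorem SymmetricMeasure.map_finitePart {ν : Measure (PuncturedSpace d)} (h : SymmetricMeasure ν)
    {A : Set (E d)} (hA : MeasurableSet A) :
    ν.map finitePart {z | -z ∈ A} = ν.map finitePart A := by
  have hm := measurable_finitePart (d := d)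
  have hA' : MeasurableSet {z : E d | -z ∈ A} := measurable_neg hA
  rw [Measure.map_apply hm hA', Measure.map_apply hm hA, ← h _ (hm hA)]
  congr 1
  ext z
  have h1 : ((-1 : ℝ) : EReal) * ((-1 : ℝ) : EReal) = 1 := by
    rw [← EReal.coe_mul]; norm_num
  constructor
  · intro (hz : -finitePart z ∈ A)
    refine ⟨⟨fun i => ((-1 : ℝ) : EReal) * z.1 i, fun h0 => z.2 (funext fun i => ?_)⟩, ?_,
      fun i => ?_⟩
    · have := congrFun h0 i
      simp only [Pi.zero_apply] at this ⊢
      rw [← one_mul (z.1 i), ← h1, mul_assoc, this, mul_zero]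
    · change finitePart _ ∈ A
      convert hz using 1
      ext i
      simp only [finitePart, PiLp.neg_apply, EReal.toReal_mul, EReal.toReal_coe]
      ring
    · rw [← mul_assoc, h1, one_mul]
  · rintro ⟨a, ha, haz⟩
    change -finitePart z ∈ A
    convert (show finitePart a ∈ A from ha) using 1
    ext i
    simp only [finitePart, PiLp.neg_apply, haz i, EReal.toReal_mul, EReal.toReal_coe]
    ring

theorem HomogeneousRadon.ext {α : ℝ} {μ ν : Measure (PuncturedSpace d)}
    (hμ : HomogeneousRadon α μ) (hν : HomogeneousRadon α ν)
    (h : ∀ f : PuncturedSpace d → ℝ, Continuous f → HasCompactSupport f →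
      ∫ z, f z ∂μ = ∫ z, f z ∂ν) : μ = ν := by
  have : IsFiniteMeasureOnCompacts μ := ⟨hμ.finite_compact⟩
  have : IsFiniteMeasureOnCompacts ν := ⟨hν.finite_compact⟩
  exact Measure.ext_of_integral_eq_on_compactlySupported fun f =>
    h f f.continuous f.hasCompactSupport

end Punctured

namespace SpectralSetup

set_option linter.unusedSectionVars false

variable {Ω Ω' : Type*} [MeasurableSpace Ω] [MeasurableSpace Ω'] {P : Measure Ω} {P' : Measure Ω'}
  {d : ℕ} {X : ℤ → Ω → E d} {Θ : ℤ → Ω' → E d} {α : ℝ}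
  [IsProbabilityMeasure P] [IsProbabilityMeasure P'] (S : SpectralSetup P P' X Θ α)
include S

theorem integral_scaledLaw (f : PuncturedSpace d → ℝ) (hf : Measurable (readBack f)) (n : ℕ)
    (x : ℝ) :
    ∫ z, f z ∂scaledLaw P X n x = (∫ ω, readBack f (x⁻¹ • partialSum X n ω) ∂P) /
      (n * P.real {ω | x < ‖X 0 ω‖}) := by
  have hW : Measurable fun ω => x⁻¹ • partialSum X n ω := by
    exact (S.measurable_partialSum n).const_smul x⁻¹
  have e : scaledLaw P X n x = ((n : ℝ≥0∞) * P {ω | x < ‖X 0 ω‖})⁻¹ •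
      extendMeasure (P.map fun ω => x⁻¹ • partialSum X n ω) := by
    rw [scaledLaw, extendMeasure, Measure.map_map continuous_toExt.measurable hW]
    rfl
  rw [e, integral_smul_measure, integral_extendMeasure, integral_map hW.aemeasurable
    hf.aestronglyMeasurable, ENNReal.toReal_inv, ENNReal.toReal_mul, ENNReal.toReal_natCast,
    smul_eq_mul, inv_mul_eq_div]
  rfl

/-- The limit measure without its atom at `0`. -/
theorem homogeneousOn_clusterMeasure {xs : ℕ → ℝ} (hlim : Tendsto xs atTop atTop)
    (hC : ClusterBound P X xs)
    (hmom : 1 < α → ∫⁻ ω, (∑' i : ℕ, ‖Θ (i + 1) ω‖ₑ) ^ (α - 1) ∂P' < ∞) :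
    HomogeneousOn α ((clusterMeasure P' Θ α).restrict {0}ᶜ) where
  finite u hu := ne_top_of_le_ne_top (S.clusterMeasure_norm_ne_top hlim hC hmom hu)
    (Measure.restrict_apply_le _ _)
  smul c hc A hA := by
    have hA' : MeasurableSet {z : E d | c • z ∈ A} := (measurable_const_smul c) hA
    rw [Measure.restrict_apply hA', Measure.restrict_apply hA,
      ← S.clusterMeasure_smul hc (hA.inter (measurableSet_singleton 0).compl)]
    congr 1
    ext z
    simp [hc.ne']
  zero := by
    rw [Measure.restrict_apply (measurableSet_singleton 0)]
    simp

theorem vagueTendsto_scaledLaw {xs : ℕ → ℝ} (hlim : Tendsto xs atTop atTop)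
    (hC : ClusterBound P X xs) (hV : SmallValueBound P X xs)
    (hmom : 1 < α → ∫⁻ ω, (∑' i : ℕ, ‖Θ (i + 1) ω‖ₑ) ^ (α - 1) ∂P' < ∞) :
    VagueTendsto (fun n => scaledLaw P X n (xs n))
      (extendMeasure ((clusterMeasure P' Θ α).restrict {0}ᶜ)) := by
  intro f hf hc
  obtain ⟨h1, ⟨B, hB⟩, u, hu, h0⟩ := readBack_properties hf hc
  simp only [S.integral_scaledLaw f h1.measurable, integral_extendMeasure]
  rw [setIntegral_eq_integral_of_forall_compl_eq_zero fun z hz => ?_]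
  · exact S.tendsto_clusterMeasure hlim hC hV hmom h1 hB hu h0
  · rw [Set.mem_compl_iff, not_not, Set.mem_singleton_iff] at hz
    exact h0 z (by rw [hz, norm_zero]; exact hu.le)

end SpectralSetup

end HeavyTail

namespace HeavyTail

/-! ### Homogeneous measures are determined by half-spaces -/

/-! ### Finite differences of the exponential and of its Taylor remainders -/

section FiniteDifference

/-- The `M`-th forward difference of `φ` at `a` with step `b`. -/
noncomputable def forwardDiff (M : ℕ) (φ : ℝ → ℂ) (a b : ℝ) : ℂ :=
  ∑ k ∈ Finset.range (M + 1), ((-1) ^ (M - k) * (M.choose k : ℂ)) * φ (a + k * b)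

theorem forwardDiff_polynomial {M : ℕ} {p : Polynomial ℂ} (hp : p.natDegree < M) (a b : ℝ) :
    forwardDiff M (fun r => p.eval (r : ℂ)) a b = 0 := by
  have hdeg : (p.comp (Polynomial.C (b : ℂ) * Polynomial.X + Polynomial.C (a : ℂ))).natDegree <
      M := by
    refine lt_of_le_of_lt Polynomial.natDegree_comp_le (lt_of_le_of_lt ?_ hp)
    exact mul_le_of_le_one_right (Nat.zero_le _) Polynomial.natDegree_linear_le
  have h := congrFun (Polynomial.fwdDiff_iter_eq_zero_of_degree_lt hdeg) 0
  rw [fwdDiff_iter_eq_sum_shift] at h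
  rw [forwardDiff, ← Pi.zero_apply (M := fun _ => ℂ) (0 : ℂ), ← h]
  refine Finset.sum_congr rfl fun k _ => ?_
  simp only [zsmul_eq_mul, Int.cast_mul, Int.cast_pow, Int.cast_neg, Int.cast_one,
    Int.cast_natCast, nsmul_eq_mul, mul_one, zero_add, Polynomial.eval_comp, Polynomial.eval_add,
    Polynomial.eval_mul, Polynomial.eval_C, Polynomial.eval_X, Complex.ofReal_add,
    Complex.ofReal_mul, Complex.ofReal_natCast]
  ring_nf

theorem forwardDiff_sub (M : ℕ) (φ ψ : ℝ → ℂ) (a b : ℝ) :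
    forwardDiff M (fun r => φ r - ψ r) a b = forwardDiff M φ a b - forwardDiff M ψ a b := by
  simp only [forwardDiff, mul_sub, Finset.sum_sub_distrib]

theorem forwardDiff_exp (M : ℕ) (a b : ℝ) :
    forwardDiff M (fun r => Complex.exp (r * Complex.I)) a b =
      Complex.exp (a * Complex.I) * (Complex.exp (b * Complex.I) - 1) ^ M := by
  rw [sub_eq_add_neg, add_pow, Finset.mul_sum]
  refine Finset.sum_congr rfl fun k _ => ?_
  rw [← Complex.exp_nat_mul]
  have : Complex.exp (((a + k * b : ℝ) : ℂ) * Complex.I) =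
      Complex.exp (a * Complex.I) * Complex.exp (k * (b * Complex.I)) := by
    rw [← Complex.exp_add]; congr 1; push_cast; ring
  simp only [this]
  ring

/-- Starting at a - Nb distributes a factor e^(-ib) to each squared difference, and e^(-ib)(e^(ib) -
1)² = -(2 - 2cos b) is real. The weight is thus nonnegative up to a sign. -/
theorem forwardDiff_exp_centered (N : ℕ) (a b : ℝ) :
    forwardDiff (2 * N) (fun r => Complex.exp (r * Complex.I)) (a - N * b) b =
      (-1) ^ N * (((2 - 2 * Real.cos b) ^ N : ℝ) : ℂ) * Complex.exp (a * Complex.I) := by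
  have h1 : Complex.exp (((a - N * b : ℝ) : ℂ) * Complex.I) =
      Complex.exp (a * Complex.I) * Complex.exp (-(b * Complex.I)) ^ N := by
    rw [← Complex.exp_nat_mul, ← Complex.exp_add]; congr 1; push_cast; ring
  have h2 : Complex.exp (-(b * Complex.I)) * (Complex.exp (b * Complex.I) - 1) ^ 2 =
      -1 * ((2 - 2 * Real.cos b : ℝ) : ℂ) := by
    have h3 : Complex.exp (-(b * Complex.I)) * Complex.exp (b * Complex.I) = 1 := by
      rw [← Complex.exp_add]; simp
    have h4 : 2 * Complex.cos b = Complex.exp (b * Complex.I) + Complex.exp (-(b * Complex.I)) := by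
      rw [Complex.two_cos, neg_mul]
    push_cast
    rw [h4]
    linear_combination (Complex.exp (b * Complex.I) - 2) * h3
  rw [forwardDiff_exp, h1, pow_mul, mul_assoc, ← mul_pow, h2, mul_pow]
  push_cast
  ring

/-- The Taylor polynomial of `r ↦ exp (i r)` with `n` terms. -/
noncomputable def expTaylor (n : ℕ) : Polynomial ℂ :=
  ∑ j ∈ Finset.range n, Polynomial.C (Complex.I ^ j / (j.factorial : ℂ)) * Polynomial.X ^ j

/-- The remainder of the Taylor expansion of `r ↦ exp (i r)`. -/
noncomputable def expRemainder (n : ℕ) (r : ℝ) : ℂ :=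
  Complex.exp (r * Complex.I) - (expTaylor n).eval (r : ℂ)

theorem eval_expTaylor (n : ℕ) (r : ℝ) : (expTaylor n).eval (r : ℂ) =
    ∑ j ∈ Finset.range n, ((r : ℂ) * Complex.I) ^ j / (j.factorial : ℂ) := by
  rw [expTaylor, Polynomial.eval_finsetSum]
  refine Finset.sum_congr rfl fun j _ => ?_
  simp only [Polynomial.eval_mul, Polynomial.eval_C, Polynomial.eval_pow, Polynomial.eval_X,
    mul_pow]
  ring

theorem natDegree_expTaylor_lt {n : ℕ} (hn : 0 < n) : (expTaylor n).natDegree < n := by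
  refine lt_of_le_of_lt (Polynomial.natDegree_sum_le_of_forall_le (n := n - 1) _ _ fun j hj => ?_)
    (by omega)
  have := Finset.mem_range.1 hj
  exact (Polynomial.natDegree_C_mul_X_pow_le _ _).trans (by omega)

theorem continuous_expRemainder (n : ℕ) : Continuous (expRemainder n) := by
  unfold expRemainder
  have := (expTaylor n).continuous
  fun_prop

theorem forwardDiff_expRemainder {n M : ℕ} (hn : 0 < n) (hM : n ≤ M) (a b : ℝ) :
    forwardDiff M (expRemainder n) a b =
      forwardDiff M (fun r => Complex.exp (r * Complex.I)) a b := by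
  have h := forwardDiff_sub M (fun r => Complex.exp (r * Complex.I))
    (fun r => (expTaylor n).eval (r : ℂ)) a b
  rw [forwardDiff_polynomial ((natDegree_expTaylor_lt hn).trans_le hM), sub_zero] at h
  exact h

theorem norm_expRemainder_le_of_abs_le_one (n : ℕ) {r : ℝ} (hr : |r| ≤ 1) :
    ‖expRemainder n r‖ ≤ 3 * |r| ^ n := by
  have h := Complex.norm_exp_sub_sum_le_norm_mul_exp ((r : ℂ) * Complex.I) n
  have hn : ‖(r : ℂ) * Complex.I‖ = |r| := by simp
  rw [← eval_expTaylor, hn] at h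
  refine h.trans ?_
  rw [mul_comm]
  have : Real.exp |r| ≤ 3 := (Real.exp_le_exp.2 hr).trans (Real.exp_one_lt_d9.le.trans (by norm_num))
  gcongr

theorem norm_expRemainder_le_of_one_le_abs {n : ℕ} (hn : 0 < n) {r : ℝ} (hr : 1 ≤ |r|) :
    ‖expRemainder n r‖ ≤ (n + 1) * |r| ^ (n - 1) := by
  refine (norm_sub_le _ _).trans ?_
  rw [Complex.norm_exp_ofReal_mul_I, eval_expTaylor]
  have h1 : ‖∑ j ∈ Finset.range n, ((r : ℂ) * Complex.I) ^ j / (j.factorial : ℂ)‖ ≤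
      n * |r| ^ (n - 1) := by
    refine (norm_sum_le _ _).trans ((Finset.sum_le_card_nsmul _ _ (|r| ^ (n - 1)) fun j hj => ?_).trans
      (by simp))
    have hj' := Finset.mem_range.1 hj
    rw [norm_div, norm_pow, norm_mul, Complex.norm_I, mul_one, Complex.norm_natCast,
      Complex.norm_real, Real.norm_eq_abs]
    refine (div_le_self (by positivity) (by exact_mod_cast Nat.factorial_pos j)).trans ?_
    exact pow_le_pow_right₀ hr (by omega)
  have h2 : 1 ≤ |r| ^ (n - 1) := one_le_pow₀ hr
  linarith

/-- Order n at 0 and order n - 1 at infinity: exactly what is integrable against a homogeneous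
measure of index strictly between n - 1 and n. -/
theorem norm_expRemainder_le {n : ℕ} (hn : 0 < n) (r : ℝ) :
    ‖expRemainder n r‖ ≤ (n + 3) * min (|r| ^ n) (|r| ^ (n - 1)) := by
  rcases le_total |r| 1 with h | h
  · rw [min_eq_left (pow_le_pow_of_le_one (abs_nonneg _) h (by omega))]
    refine (norm_expRemainder_le_of_abs_le_one n h).trans ?_
    gcongr
    linarith [(Nat.cast_nonneg n : (0 : ℝ) ≤ n)]
  · rw [min_eq_right (pow_le_pow_right₀ h (by omega))]
    refine (norm_expRemainder_le_of_one_le_abs hn h).trans ?_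
    gcongr
    norm_num

/-- The even part of the remainder. -/
noncomputable def evenRemainder (n : ℕ) (r : ℝ) : ℂ := (expRemainder n r + expRemainder n (-r)) / 2

/-- The two remainders differ by a term of odd degree, which cancels in the even part. -/
theorem evenRemainder_succ (m : ℕ) : evenRemainder (2 * m + 2) = evenRemainder (2 * m + 1) := by
  have h : ∀ r : ℝ, expRemainder (2 * m + 2) r = expRemainder (2 * m + 1) r -
      ((r : ℂ) * Complex.I) ^ (2 * m + 1) / ((2 * m + 1).factorial : ℂ) := fun r => by
    simp only [expRemainder, eval_expTaylor]
    rw [Finset.sum_range_succ _ (2 * m + 1)]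
    ring
  ext r
  simp only [evenRemainder, h]
  have : (((-r : ℝ) : ℂ) * Complex.I) ^ (2 * m + 1) = -((r : ℂ) * Complex.I) ^ (2 * m + 1) := by
    push_cast
    rw [neg_mul, Odd.neg_pow ⟨m, rfl⟩]
  rw [this]
  ring

/-- The cancellation of the odd term gains one order at 0 without losing one at infinity. The window
from 2m to 2m + 2 now contains the odd index 2m + 1, which the full remainder cannot reach. -/
theorem norm_evenRemainder_le (m : ℕ) (r : ℝ) :
    ‖evenRemainder (2 * m + 1) r‖ ≤
      (2 * m + 3) * min (|r| ^ (2 * m + 2)) (|r| ^ (2 * m)) := by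
  have htri : ∀ n, ‖evenRemainder n r‖ ≤ (‖expRemainder n r‖ + ‖expRemainder n (-r)‖) / 2 :=
    fun n => by
      rw [evenRemainder, norm_div, Complex.norm_ofNat]
      gcongr
      exact norm_add_le _ _
  have hm : (0 : ℝ) ≤ m := Nat.cast_nonneg m
  rcases le_total |r| 1 with h | h
  · rw [min_eq_left (pow_le_pow_of_le_one (abs_nonneg _) h (by omega)), ← evenRemainder_succ]
    have h1 := norm_expRemainder_le_of_abs_le_one (2 * m + 2) h
    have h2 := norm_expRemainder_le_of_abs_le_one (2 * m + 2) (r := -r) (by rwa [abs_neg])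
    rw [abs_neg] at h2
    refine (htri _).trans ?_
    nlinarith [pow_nonneg (abs_nonneg r) (2 * m + 2)]
  · rw [min_eq_right (pow_le_pow_right₀ h (by omega))]
    have h1 := norm_expRemainder_le_of_one_le_abs (n := 2 * m + 1) (by omega) h
    have h2 := norm_expRemainder_le_of_one_le_abs (n := 2 * m + 1) (by omega) (r := -r)
      (by rwa [abs_neg])
    rw [abs_neg] at h2
    simp only [Nat.add_sub_cancel] at h1 h2
    push_cast at h1 h2
    refine (htri _).trans ?_
    nlinarith [pow_nonneg (abs_nonneg r) (2 * m)]

/-- Reflecting the nodes gives the centered difference at -a with step -b, and the weight 2 - 2cos b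
is even in b. -/
theorem forwardDiff_evenRemainder {n N : ℕ} (hn : 0 < n) (hM : n ≤ 2 * N) (a b : ℝ) :
    forwardDiff (2 * N) (evenRemainder n) (a - N * b) b =
      (-1) ^ N * (((2 - 2 * Real.cos b) ^ N : ℝ) : ℂ) *
        ((Complex.exp (a * Complex.I) + Complex.exp (-a * Complex.I)) / 2) := by
  have h : forwardDiff (2 * N) (evenRemainder n) (a - N * b) b =
      (forwardDiff (2 * N) (expRemainder n) (a - N * b) b +
        forwardDiff (2 * N) (expRemainder n) (-a - N * (-b)) (-b)) / 2 := by
    simp only [forwardDiff, evenRemainder]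
    rw [← Finset.sum_add_distrib, Finset.sum_div]
    refine Finset.sum_congr rfl fun k _ => ?_
    rw [show -(a - N * b + k * b) = -a - N * (-b) + k * (-b) by ring]
    ring
  rw [h, forwardDiff_expRemainder hn hM, forwardDiff_expRemainder hn hM, forwardDiff_exp_centered,
    forwardDiff_exp_centered, Real.cos_neg]
  push_cast
  ring

/-- The weight is bounded and of order 2N at 0, so it makes a homogeneous measure of index below 2N
finite. -/
theorem two_sub_cos_pow_le (N : ℕ) (r : ℝ) :
    ‖(((2 - 2 * Real.cos r) ^ N : ℝ) : ℂ)‖ ≤ 4 ^ N * min (|r| ^ (2 * N)) (|r| ^ 0) := by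
  have h0 : 0 ≤ 2 - 2 * Real.cos r := by linarith [Real.cos_le_one r]
  have h1 : 2 - 2 * Real.cos r ≤ |r| ^ 2 := by
    rw [sq_abs]; linarith [Real.one_sub_sq_div_two_le_cos (x := r)]
  have h2 : 2 - 2 * Real.cos r ≤ 4 := by linarith [Real.neg_one_le_cos r]
  rw [Complex.norm_real, Real.norm_of_nonneg (pow_nonneg h0 N), pow_zero]
  have h3 : (2 - 2 * Real.cos r) ^ N ≤ |r| ^ (2 * N) := by
    rw [pow_mul]; exact pow_le_pow_left₀ h0 h1 N
  have h4 : (2 - 2 * Real.cos r) ^ N ≤ 4 ^ N := pow_le_pow_left₀ h0 h2 N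
  rcases le_total (|r| ^ (2 * N)) 1 with h | h
  · rw [min_eq_left h]
    exact h3.trans (le_mul_of_one_le_left (by positivity) (one_le_pow₀ (by norm_num)))
  · rw [min_eq_right h, mul_one]; exact h4

end FiniteDifference

theorem lintegral_min_pow_radialMeasure {α : ℝ} {a b : ℕ} (hb : (b : ℝ) < α)
    (ha : α < a) : ∫⁻ y, ENNReal.ofReal (min (y ^ a) (y ^ b)) ∂radialMeasure α ≠ ∞ := by
  have h1 : IntegrableOn (fun y : ℝ => α * y ^ ((a : ℝ) - α - 1)) (Set.Ioc 0 1) := by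
    have := (intervalIntegral.intervalIntegrable_rpow' (a := 0) (b := 1)
      (r := (a : ℝ) - α - 1) (by linarith)).1
    exact this.const_mul α
  have h2 : IntegrableOn (fun y : ℝ => α * y ^ ((b : ℝ) - α - 1)) (Set.Ioi 1) :=
    (integrableOn_Ioi_rpow_of_lt (by linarith) one_pos).const_mul α
  have hα : 0 < α := lt_of_le_of_lt (Nat.cast_nonneg b) hb
  have hpow : ∀ (c : ℕ) (y : ℝ), 0 < y →
      α * y ^ (-α - 1) * y ^ c = α * y ^ ((c : ℝ) - α - 1) := fun c y hy => by
    rw [mul_assoc, ← Real.rpow_natCast, ← Real.rpow_add hy]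
    congr 2
    ring
  unfold radialMeasure
  rw [lintegral_withDensity_eq_lintegral_mul _ (by fun_prop) (by fun_prop),
    ← Set.Ioc_union_Ioi_eq_Ioi (zero_le_one' ℝ)]
  refine ne_top_of_le_ne_top (ENNReal.add_ne_top.2 ⟨h1.lintegral_lt_top.ne, h2.lintegral_lt_top.ne⟩)
    ((lintegral_union_le _ _ _).trans (add_le_add ?_ ?_))
  · refine setLIntegral_mono' measurableSet_Ioc fun y hy => ?_
    have hy0 : 0 < y := hy.1
    simp only [Pi.mul_apply]
    rw [← ENNReal.ofReal_mul (by positivity), ← hpow a y hy0]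
    refine ENNReal.ofReal_le_ofReal (mul_le_mul_of_nonneg_left (min_le_left _ _) (by positivity))
  · refine setLIntegral_mono' measurableSet_Ioi fun y hy => ?_
    have hy0 : 0 < y := one_pos.trans hy
    simp only [Pi.mul_apply]
    rw [← ENNReal.ofReal_mul (by positivity), ← hpow b y hy0]
    refine ENNReal.ofReal_le_ofReal (mul_le_mul_of_nonneg_left (min_le_right _ _) (by positivity))

/-! ### Fourier inversion for homogeneous measures from their projections -/

section Homogeneous

variable {d : ℕ} {α : ℝ} {m m₁ m₂ : Measure (E d)}

theorem HomogeneousOn.smul_lt (h : HomogeneousOn α m) {g : E d → ℝ} (hg : Measurable g)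
    (hgs : ∀ (c : ℝ) z, 0 < c → g (c • z) = c * g z) {r : ℝ} (hr : 0 < r) :
    m {z | r < g z} = m {z | 1 < g z} * ENNReal.ofReal (r ^ (-α)) := by
  have h1 := h.smul r⁻¹ (inv_pos.2 hr) {z | 1 < g z} (measurableSet_lt measurable_const hg)
  rw [Real.inv_rpow hr.le, ← Real.rpow_neg hr.le, mul_comm] at h1
  rw [← h1]
  congr 1
  ext z
  simp only [Set.mem_ofPred_eq, hgs _ _ (inv_pos.2 hr)]
  rw [inv_mul_eq_div, one_lt_div hr]

/-- The norm has a power law under m, so the bound reduces to a radial integral that converges at 0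
because α < a and at infinity because b < α. -/
theorem HomogeneousOn.integrable_of_norm_le (hα : 0 < α) (h : HomogeneousOn α m) {a b : ℕ}
    (hb : (b : ℝ) < α) (ha : α < a) {f : E d → ℂ} (hf : AEStronglyMeasurable f m) {C : ℝ}
    (hle : ∀ z, ‖f z‖ ≤ C * min (‖z‖ ^ a) (‖z‖ ^ b)) : Integrable f m := by
  have hfin1 := h.finite 1 one_pos
  have ha0 : a ≠ 0 := by
    rintro rfl
    rw [Nat.cast_zero] at ha
    linarith
  have hmap := restrict_Ioi_eq_radialMeasure (m := m.map fun z => ‖z‖) hα hfin1 fun r hr => by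
    rw [Measure.map_apply measurable_norm measurableSet_Ioi]
    exact h.smul_lt measurable_norm (fun c z hc => by rw [norm_smul, Real.norm_of_nonneg hc.le]) hr
  have hlint : ∫⁻ z, ENNReal.ofReal (min (‖z‖ ^ a) (‖z‖ ^ b)) ∂m ≠ ∞ := by
    have e : ∀ z : E d, ENNReal.ofReal (min (‖z‖ ^ a) (‖z‖ ^ b)) =
        (Set.Ioi (0 : ℝ)).indicator (fun y => ENNReal.ofReal (min (y ^ a) (y ^ b))) ‖z‖ :=
      fun z => by
        rcases (norm_nonneg z).eq_or_lt with hz | hz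
        · rw [← hz, Set.indicator_of_notMem (by simp), zero_pow ha0,
            min_eq_left (pow_nonneg le_rfl b), ENNReal.ofReal_zero]
        · rw [Set.indicator_of_mem (Set.mem_Ioi.2 hz)]
    simp only [e]
    rw [← lintegral_map (μ := m) (g := fun z : E d => ‖z‖)
      (f := (Set.Ioi (0 : ℝ)).indicator fun y => ENNReal.ofReal (min (y ^ a) (y ^ b)))
      (Measurable.indicator (by fun_prop) measurableSet_Ioi) measurable_norm,
      lintegral_indicator measurableSet_Ioi, hmap, lintegral_smul_measure]
    exact ENNReal.mul_ne_top hfin1 (lintegral_min_pow_radialMeasure hb ha)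
  have hint : Integrable (fun z : E d => min (‖z‖ ^ a) (‖z‖ ^ b)) m :=
    (lintegral_ofReal_ne_top_iff_integrable (Measurable.aestronglyMeasurable (by fun_prop))
      (.of_forall fun z => by positivity)).1 hlint
  exact (hint.const_mul C).mono' hf (.of_forall hle)

theorem min_mul_pow_le {s t : ℝ} (hs : 0 ≤ s) (ht : 0 ≤ t) (a b : ℕ) :
    min ((s * t) ^ a) ((s * t) ^ b) ≤ (s ^ a + s ^ b) * min (t ^ a) (t ^ b) := by
  rw [mul_pow, mul_pow]
  have hsa := pow_nonneg hs a
  have hsb := pow_nonneg hs b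
  rcases le_total (t ^ a) (t ^ b) with h | h
  · rw [min_eq_left h]
    exact (min_le_left _ _).trans (mul_le_mul_of_nonneg_right (by linarith) (by positivity))
  · rw [min_eq_right h]
    exact (min_le_right _ _).trans (mul_le_mul_of_nonneg_right (by linarith) (by positivity))

theorem HomogeneousOn.integrable_inner (hα : 0 < α) (h : HomogeneousOn α m) {a b : ℕ}
    (hb : (b : ℝ) < α) (ha : α < a) {φ : ℝ → ℂ} (hφ : Continuous φ) {C : ℝ} (hC : 0 ≤ C)
    (hle : ∀ r, ‖φ r‖ ≤ C * min (|r| ^ a) (|r| ^ b)) (ξ : E d) :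
    Integrable (fun z => φ (inner ℝ ξ z)) m := by
  refine h.integrable_of_norm_le hα hb ha (C := C * (‖ξ‖ ^ a + ‖ξ‖ ^ b))
    (Continuous.aestronglyMeasurable (by fun_prop)) fun z => (hle _).trans ?_
  rw [mul_assoc]
  refine mul_le_mul_of_nonneg_left ?_ hC
  have h1 := abs_real_inner_le_norm ξ z
  refine le_trans ?_ (min_mul_pow_le (norm_nonneg ξ) (norm_nonneg z) a b)
  exact min_le_min (pow_le_pow_left₀ (abs_nonneg _) h1 a) (pow_le_pow_left₀ (abs_nonneg _) h1 b)

/-- Two measures which agree on all half-spaces. -/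
def AgreeOn (m₁ m₂ : Measure (E d)) : Prop :=
  ∀ θ : E d, ‖θ‖ = 1 → m₁ {z | 1 < inner ℝ θ z} = m₂ {z | 1 < inner ℝ θ z}

/-- By homogeneity the value on one half-space in the direction of ξ fixes all tails of the
projection onto ξ. -/
theorem map_inner_restrict_Ioi (h₁ : HomogeneousOn α m₁)
    (h₂ : HomogeneousOn α m₂) (h : AgreeOn m₁ m₂) (ξ : E d) :
    (m₁.map fun z => inner ℝ ξ z).restrict (Set.Ioi 0) =
      (m₂.map fun z => inner ℝ ξ z).restrict (Set.Ioi 0) := by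
  have hm : ∀ ξ : E d, Measurable fun z : E d => inner ℝ ξ z := fun ξ => by fun_prop
  have key : ∀ {m : Measure (E d)}, HomogeneousOn α m → ξ ≠ 0 → ∀ r : ℝ, 0 < r →
      m.map (fun z => inner ℝ ξ z) (Set.Ioi r) =
        m {z | 1 < inner ℝ (‖ξ‖⁻¹ • ξ) z} * ENNReal.ofReal ((r / ‖ξ‖) ^ (-α)) := by
    intro m hmo hξ r hr
    have hξ' : 0 < ‖ξ‖ := norm_pos_iff.2 hξ
    rw [← hmo.smul_lt (hm _) (fun c z _ => by rw [inner_smul_right]) (div_pos hr hξ'),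
      Measure.map_apply (hm ξ) measurableSet_Ioi]
    congr 1
    ext z
    simp only [Set.mem_preimage, Set.mem_Ioi, Set.mem_ofPred_eq, real_inner_smul_left]
    rw [div_lt_iff₀ hξ', mul_comm ‖ξ‖⁻¹, inv_mul_cancel_right₀ hξ'.ne']
  by_cases hξ : ξ = 0
  · have hz : ∀ m : Measure (E d), (m.map fun z => inner ℝ ξ z).restrict (Set.Ioi 0) = 0 := by
      intro m
      rw [Measure.restrict_eq_zero, Measure.map_apply (hm ξ) measurableSet_Ioi]
      convert measure_empty (μ := m)
      ext z
      simp [hξ]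
    rw [hz, hz]
  · have hn : ‖‖ξ‖⁻¹ • ξ‖ = 1 := by
      rw [norm_smul, norm_inv, norm_norm, inv_mul_cancel₀ (norm_ne_zero_iff.2 hξ)]
    refine restrict_Ioi_ext (fun r hr => ?_) fun r hr => ?_
    · rw [key h₁ hξ r hr, key h₂ hξ r hr, h _ hn]
    · rw [key h₁ hξ r hr]
      refine ENNReal.mul_ne_top (ne_top_of_le_ne_top (h₁.finite 1 one_pos)
        (measure_mono fun z (hz : 1 < inner ℝ _ z) => ?_)) ENNReal.ofReal_ne_top
      have := real_inner_le_norm (‖ξ‖⁻¹ • ξ) z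
      rw [hn, one_mul] at this
      exact hz.trans_le this

theorem map_inner_restrict_compl (h₁ : HomogeneousOn α m₁)
    (h₂ : HomogeneousOn α m₂) (h : AgreeOn m₁ m₂) (ξ : E d) :
    (m₁.map fun z => inner ℝ ξ z).restrict {0}ᶜ = (m₂.map fun z => inner ℝ ξ z).restrict {0}ᶜ := by
  have hm : ∀ ξ : E d, Measurable fun z : E d => inner ℝ ξ z := fun ξ => by fun_prop
  have hpos := map_inner_restrict_Ioi h₁ h₂ h ξ
  have hneg := map_inner_restrict_Ioi h₁ h₂ h (-ξ)
  have e : ({0}ᶜ : Set ℝ) = Set.Ioi 0 ∪ Set.Iio 0 := by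
    ext r; simp only [Set.mem_compl_iff, Set.mem_singleton_iff, Set.mem_union, Set.mem_Ioi,
      Set.mem_Iio]
    rw [← ne_eq, ne_iff_lt_or_gt, or_comm]
  have hd : Disjoint (Set.Ioi (0 : ℝ)) (Set.Iio 0) := by
    rw [Set.disjoint_left]
    intro r (h1 : 0 < r) (h2 : r < 0)
    linarith
  have hIio : ∀ (m : Measure (E d)) (A : Set ℝ), MeasurableSet A →
      (m.map fun z => inner ℝ ξ z).restrict (Set.Iio 0) A =
        (m.map fun z => inner ℝ (-ξ) z).restrict (Set.Ioi 0) {r | -r ∈ A} := by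
    intro m A hA
    have hA' : MeasurableSet {r : ℝ | -r ∈ A} := measurable_neg hA
    rw [Measure.restrict_apply hA, Measure.restrict_apply hA',
      Measure.map_apply (hm ξ) (hA.inter measurableSet_Iio),
      Measure.map_apply (hm (-ξ)) (hA'.inter measurableSet_Ioi)]
    congr 1
    ext z
    simp [inner_neg_left]
  rw [e, Measure.restrict_union hd measurableSet_Iio, Measure.restrict_union hd measurableSet_Iio,
    hpos]
  congr 1
  ext A hA
  rw [hIio _ _ hA, hIio _ _ hA, hneg]

/-- The projection may have an infinite atom at 0, which half-spaces do not see; the condition φ(0)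
= 0 makes it irrelevant. -/
theorem integral_inner_eq (h₁ : HomogeneousOn α m₁) (h₂ : HomogeneousOn α m₂)
    (h : AgreeOn m₁ m₂) {φ : ℝ → ℂ} (hφ : Continuous φ) (h0 : φ 0 = 0) (ξ : E d) :
    ∫ z, φ (inner ℝ ξ z) ∂m₁ = ∫ z, φ (inner ℝ ξ z) ∂m₂ := by
  have hm : Measurable fun z : E d => inner ℝ ξ z := by fun_prop
  have key : ∀ m : Measure (E d), ∫ z, φ (inner ℝ ξ z) ∂m =
      ∫ r in {0}ᶜ, φ r ∂(m.map fun z => inner ℝ ξ z) := fun m => by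
    rw [setIntegral_eq_integral_of_forall_compl_eq_zero, integral_map hm.aemeasurable
      hφ.aestronglyMeasurable]
    intro r hr
    rw [Set.mem_compl_iff, not_not, Set.mem_singleton_iff] at hr
    rw [hr, h0]
  rw [key, key, map_inner_restrict_compl h₁ h₂ h ξ]

/-- The nodes of the difference are the projections onto ξ - Nη + kη, so each term is the integral
of a function of a single projection. -/
theorem integral_forwardDiff_eq (h₁ : HomogeneousOn α m₁) (h₂ : HomogeneousOn α m₂)
    (h : AgreeOn m₁ m₂) {φ : ℝ → ℂ} (hφ : Continuous φ) (h0 : φ 0 = 0)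
    (hi₁ : ∀ ξ : E d, Integrable (fun z => φ (inner ℝ ξ z)) m₁)
    (hi₂ : ∀ ξ : E d, Integrable (fun z => φ (inner ℝ ξ z)) m₂) (M N : ℕ) (ξ η : E d) :
    ∫ z, forwardDiff M φ (inner ℝ ξ z - N * inner ℝ η z) (inner ℝ η z) ∂m₁ =
      ∫ z, forwardDiff M φ (inner ℝ ξ z - N * inner ℝ η z) (inner ℝ η z) ∂m₂ := by
  have e : ∀ z, forwardDiff M φ (inner ℝ ξ z - N * inner ℝ η z) (inner ℝ η z) =
      ∑ k ∈ Finset.range (M + 1), ((-1) ^ (M - k) * (M.choose k : ℂ)) *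
        φ (inner ℝ (ξ - (N : ℝ) • η + (k : ℝ) • η) z) := fun z => by
    simp only [forwardDiff, inner_add_left, inner_sub_left, real_inner_smul_left]
  simp only [e]
  rw [integral_finsetSum _ fun k _ => (hi₁ _).const_mul _,
    integral_finsetSum _ fun k _ => (hi₂ _).const_mul _]
  refine Finset.sum_congr rfl fun k _ => ?_
  rw [integral_const_mul, integral_const_mul, integral_inner_eq h₁ h₂ h hφ h0]

/-- Measures with equal weighted characteristic functions coincide. -/
theorem eq_of_weighted_charFun (hα : 0 < α) (h₁ : HomogeneousOn α m₁) (h₂ : HomogeneousOn α m₂)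
    {N : ℕ} (hN : α < (2 * N : ℕ))
    (h : ∀ ξ η : E d,
      ∫ z, (((2 - 2 * Real.cos (inner ℝ η z)) ^ N : ℝ) : ℂ) *
          Complex.exp (inner ℝ ξ z * Complex.I) ∂m₁ =
        ∫ z, (((2 - 2 * Real.cos (inner ℝ η z)) ^ N : ℝ) : ℂ) *
          Complex.exp (inner ℝ ξ z * Complex.I) ∂m₂) : m₁ = m₂ := by
  set w : E d → E d → ℝ := fun η z => (2 - 2 * Real.cos (inner ℝ η z)) ^ N
  have hwm : ∀ η, Measurable (w η) := fun η => by
    have : Continuous (w η) := by fun_prop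
    exact this.measurable
  have hw0 : ∀ η z, 0 ≤ w η z := fun η z =>
    pow_nonneg (by linarith [Real.cos_le_one (inner ℝ η z)]) N
  -- The weight is integrable since 2N > α, so the weighted measures are finite and determined by
  -- their characteristic functions.
  have hfin : ∀ {m : Measure (E d)}, HomogeneousOn α m → ∀ η,
      IsFiniteMeasure (m.withDensity fun z => ENNReal.ofReal (w η z)) := by
    intro m hm η
    have hI := hm.integrable_inner hα (a := 2 * N) (b := 0) (by simpa using hα) hN
      (φ := fun r => (((2 - 2 * Real.cos r) ^ N : ℝ) : ℂ)) (by fun_prop) (C := 4 ^ N)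
      (by positivity) (two_sub_cos_pow_le N) η
    have hI' : Integrable (w η) m := by
      refine hI.norm.congr (.of_forall fun z => ?_)
      change ‖((w η z : ℝ) : ℂ)‖ = w η z
      rw [Complex.norm_real, Real.norm_of_nonneg (hw0 η z)]
    exact isFiniteMeasure_withDensity hI'.lintegral_lt_top.ne
  have heq : ∀ η, (m₁.withDensity fun z => ENNReal.ofReal (w η z)) =
      m₂.withDensity fun z => ENNReal.ofReal (w η z) := by
    intro η
    have := hfin h₁ η
    have := hfin h₂ η
    refine Measure.ext_of_charFun (funext fun ξ => ?_)
    rw [charFun_apply, charFun_apply,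
      integral_withDensity_eq_integral_toReal_smul (hwm η).ennreal_ofReal
        (.of_forall fun _ => ENNReal.ofReal_lt_top),
      integral_withDensity_eq_integral_toReal_smul (hwm η).ennreal_ofReal
        (.of_forall fun _ => ENNReal.ofReal_lt_top)]
    have h' := h ξ η
    simp only [ENNReal.toReal_ofReal (hw0 _ _), Complex.real_smul, real_inner_comm ξ]
    exact h'
  -- Dividing by the weight recovers the measures where it does not vanish.
  have hres : ∀ η, m₁.restrict {z | w η z ≠ 0} = m₂.restrict {z | w η z ≠ 0} := by
    intro η
    have hs : MeasurableSet {z | w η z ≠ 0} :=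
      (measurableSet_eq_fun (hwm η) measurable_const).compl
    have key : ∀ (m : Measure (E d)) (A : Set (E d)), MeasurableSet A →
        m.restrict {z | w η z ≠ 0} A = ∫⁻ z, (A ∩ {z | w η z ≠ 0}).indicator
          (fun z => (ENNReal.ofReal (w η z))⁻¹) z
          ∂(m.withDensity fun z => ENNReal.ofReal (w η z)) := by
      intro m A hA
      have hg : Measurable ((A ∩ {z | w η z ≠ 0}).indicator
          fun z => (ENNReal.ofReal (w η z))⁻¹) :=
        (hwm η).ennreal_ofReal.inv.indicator (hA.inter hs)
      rw [lintegral_withDensity_eq_lintegral_mul _ (hwm η).ennreal_ofReal hg, Measure.restrict_apply hA,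
        ← lintegral_indicator_one (hA.inter hs)]
      refine lintegral_congr fun z => ?_
      simp only [Pi.mul_apply]
      by_cases hz : z ∈ A ∩ {z | w η z ≠ 0}
      · rw [Set.indicator_of_mem hz, Set.indicator_of_mem hz, ENNReal.mul_inv_cancel]
        · rfl
        · exact (ENNReal.ofReal_pos.2 (lt_of_le_of_ne (hw0 η z) (Ne.symm hz.2))).ne'
        · exact ENNReal.ofReal_ne_top
      · rw [Set.indicator_of_notMem hz, Set.indicator_of_notMem hz, mul_zero]
    ext A hA
    rw [key _ _ hA, key _ _ hA, heq]
  -- Countably many directions whose weights have no common zero off the origin: if z_i ≠ 0 and k >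
  -- |z_i|, then z_i/(k+1) is nonzero of modulus below 1, and its cosine is not 1.
  let η : Fin d × ℕ → E d := fun p => (1 / (p.2 + 1 : ℝ)) • EuclideanSpace.single p.1 (1 : ℝ)
  refine Measure.ext_of_iUnion_eq_univ (ι := Option (Fin d × ℕ))
    (s := fun o => o.elim {0} fun p => {z | w (η p) z ≠ 0}) ?_ ?_
  · refine Set.eq_univ_of_forall fun z => Set.mem_iUnion.2 ?_
    by_cases hz : z = 0
    · exact ⟨none, hz⟩
    obtain ⟨i, hi⟩ : ∃ i, z i ≠ 0 := by
      by_contra! hc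
      exact hz (by ext i; exact hc i)
    obtain ⟨k, hk⟩ := exists_nat_gt |z i|
    refine ⟨some (i, k), ?_⟩
    change (2 - 2 * Real.cos (inner ℝ (η (i, k)) z)) ^ N ≠ 0
    have hin : inner ℝ (η (i, k)) z = z i / (k + 1) := by
      simp only [η, real_inner_smul_left, EuclideanSpace.inner_single_left]
      simp
      ring
    have hlt : |z i / (k + 1)| < 1 := by
      rw [abs_div, abs_of_pos (by positivity : (0 : ℝ) < k + 1), div_lt_one (by positivity)]
      linarith
    rw [abs_lt] at hlt
    refine pow_ne_zero _ fun h0 => ?_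
    rw [hin] at h0
    have hcos : Real.cos (z i / (k + 1)) = 1 := by linarith
    have hpi := Real.pi_gt_three
    rw [Real.cos_eq_one_iff_of_lt_of_lt (by linarith) (by linarith)] at hcos
    exact hi ((div_eq_zero_iff.1 hcos).resolve_right (by positivity))
  · rintro (_ | p)
    · change m₁.restrict {0} = m₂.restrict {0}
      rw [Measure.restrict_eq_zero.2 h₁.zero, Measure.restrict_eq_zero.2 h₂.zero]
    · exact hres (η p)

/-- Half-spaces determine a homogeneous measure with a non-integer index. -/
theorem eq_of_agreeOn_of_notMem_natCast (hα : 0 < α) (hαn : α ∉ Set.range (Nat.cast : ℕ → ℝ))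
    (h₁ : HomogeneousOn α m₁) (h₂ : HomogeneousOn α m₂) (h : AgreeOn m₁ m₂) : m₁ = m₂ := by
  set n := ⌈α⌉₊
  have hn : 0 < n := Nat.ceil_pos.2 hα
  -- Strict because α is not an integer; with n = ⌈α⌉ this places α strictly between n - 1 and n.
  have hlt : α < n := lt_of_le_of_ne (Nat.le_ceil α) fun he => hαn ⟨n, he.symm⟩
  have hgt : ((n - 1 : ℕ) : ℝ) < α := Nat.lt_ceil.1 (by omega)
  have hi : ∀ {m : Measure (E d)}, HomogeneousOn α m → ∀ ξ : E d,
      Integrable (fun z => expRemainder n (inner ℝ ξ z)) m := fun hm ξ =>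
    hm.integrable_inner hα hgt hlt (continuous_expRemainder n) (C := n + 3) (by positivity)
      (norm_expRemainder_le hn) ξ
  have h0 : expRemainder n 0 = 0 := by
    have := norm_expRemainder_le_of_abs_le_one n (r := 0) (by simp)
    rw [abs_zero, zero_pow hn.ne', mul_zero] at this
    exact norm_le_zero_iff.1 this
  refine eq_of_weighted_charFun hα h₁ h₂ (N := n) (hlt.trans (by exact_mod_cast (by omega)))
    fun ξ η => ?_
  -- The difference of order 2n kills the Taylor polynomial, of degree below n, and turns the
  -- remainder into the weighted exponential up to a sign.
  have key := integral_forwardDiff_eq h₁ h₂ h (continuous_expRemainder n) h0 (hi h₁) (hi h₂)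
    (2 * n) n ξ η
  simp only [forwardDiff_expRemainder hn (show n ≤ 2 * n by omega), forwardDiff_exp_centered,
    mul_assoc] at key
  rw [integral_const_mul, integral_const_mul] at key
  exact mul_left_cancel₀ (pow_ne_zero _ (by norm_num)) key

/-- Half-spaces determine a symmetric homogeneous measure with an odd integer index. -/
theorem eq_of_agreeOn_of_symmetric {l : ℕ} (hα : α = 2 * l + 1)
    (h₁ : HomogeneousOn α m₁) (h₂ : HomogeneousOn α m₂) (h : AgreeOn m₁ m₂)
    (hs₁ : ∀ A, MeasurableSet A → m₁ {z | -z ∈ A} = m₁ A)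
    (hs₂ : ∀ A, MeasurableSet A → m₂ {z | -z ∈ A} = m₂ A) : m₁ = m₂ := by
  have hα0 : 0 < α := by rw [hα]; positivity
  have hlt : α < (2 * l + 2 : ℕ) := by rw [hα]; push_cast; linarith
  have hgt : ((2 * l : ℕ) : ℝ) < α := by rw [hα]; push_cast; linarith
  have hc : Continuous (evenRemainder (2 * l + 1)) := by
    unfold evenRemainder
    have := continuous_expRemainder (2 * l + 1)
    fun_prop
  have hi : ∀ {m : Measure (E d)}, HomogeneousOn α m → ∀ ξ : E d,
      Integrable (fun z => evenRemainder (2 * l + 1) (inner ℝ ξ z)) m := fun hm ξ =>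
    hm.integrable_inner hα0 hgt hlt hc (C := 2 * l + 3) (by positivity)
      (norm_evenRemainder_le l) ξ
  have h0 : evenRemainder (2 * l + 1) 0 = 0 := by
    have := norm_evenRemainder_le l 0
    rw [abs_zero, zero_pow (by omega), min_eq_left (pow_nonneg le_rfl _), mul_zero] at this
    exact norm_le_zero_iff.1 this
  set N := l + 1
  refine eq_of_weighted_charFun hα0 h₁ h₂ (N := N) hlt fun ξ η => ?_
  have key := integral_forwardDiff_eq h₁ h₂ h hc h0 (hi h₁) (hi h₂) (2 * N) N ξ η
  simp only [forwardDiff_evenRemainder (show 0 < 2 * l + 1 by omega)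
    (show 2 * l + 1 ≤ 2 * N by omega), mul_assoc] at key
  rw [integral_const_mul, integral_const_mul] at key
  have key := mul_left_cancel₀ (pow_ne_zero _ (by norm_num)) key
  -- The even remainder only yields the cosine part of the exponential; under a symmetric measure,
  -- averaging over z and -z shows that nothing is lost.
  have hsym : ∀ {m : Measure (E d)}, HomogeneousOn α m →
      (∀ A, MeasurableSet A → m {z | -z ∈ A} = m A) →
      ∫ z, (((2 - 2 * Real.cos (inner ℝ η z)) ^ N : ℝ) : ℂ) *
          ((Complex.exp (inner ℝ ξ z * Complex.I) + Complex.exp (-inner ℝ ξ z * Complex.I)) / 2) ∂m =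
        ∫ z, (((2 - 2 * Real.cos (inner ℝ η z)) ^ N : ℝ) : ℂ) *
          Complex.exp (inner ℝ ξ z * Complex.I) ∂m := by
    intro m hm hs
    set F : E d → ℂ := fun z => (((2 - 2 * Real.cos (inner ℝ η z)) ^ N : ℝ) : ℂ) *
      Complex.exp (inner ℝ ξ z * Complex.I)
    have hFc : Continuous F := by fun_prop
    have hF : Integrable F m := by
      have hI := hm.integrable_inner hα0 (a := 2 * N) (b := 0) (by simpa using hα0) hlt
        (φ := fun r => (((2 - 2 * Real.cos r) ^ N : ℝ) : ℂ)) (by fun_prop) (C := 4 ^ N)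
        (by positivity) (two_sub_cos_pow_le N) η
      refine hI.norm.mono' hFc.aestronglyMeasurable (.of_forall fun z => ?_)
      simp only [F]
      rw [norm_mul, Complex.norm_exp_ofReal_mul_I, mul_one]
    have hmap : m.map (fun z => -z) = m := by
      ext A hA
      rw [Measure.map_apply measurable_neg hA]
      exact hs A hA
    have hFneg : ∫ z, F (-z) ∂m = ∫ z, F z ∂m := by
      rw [← integral_map measurable_neg.aemeasurable hFc.aestronglyMeasurable (φ := fun z => -z),
        hmap]
    have hFi : Integrable (fun z => F (-z)) m := by
      have : Integrable F (m.map fun z => -z) := by rw [hmap]; exact hF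
      exact this.comp_measurable measurable_neg
    have e : ∀ z, (((2 - 2 * Real.cos (inner ℝ η z)) ^ N : ℝ) : ℂ) *
        ((Complex.exp (inner ℝ ξ z * Complex.I) + Complex.exp (-inner ℝ ξ z * Complex.I)) / 2) =
        (F z + F (-z)) / 2 := fun z => by
      simp only [F, inner_neg_right, Real.cos_neg, Complex.ofReal_neg]
      ring
    simp only [e]
    rw [integral_div, integral_add hF hFi, hFneg]
    ring
  rwa [hsym h₁ hs₁, hsym h₂ hs₂] at key

/-- Half-spaces determine a homogeneous measure on the line. -/
theorem eq_of_agreeOn_of_dim_one (hd : d = 1)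
    (h₁ : HomogeneousOn α m₁) (h₂ : HomogeneousOn α m₂) (h : AgreeOn m₁ m₂) : m₁ = m₂ := by
  subst hd
  set θ : E 1 := EuclideanSpace.single 0 1
  -- On the line a point is its own projection onto θ, so the measure off 0 is a single projection,
  -- known from the two half-lines.
  have hz : ∀ z : E 1, (inner ℝ θ z) • θ = z := fun z => by
    ext i
    rw [Subsingleton.elim i 0]
    simp [θ, EuclideanSpace.inner_single_left]
  have hm : Measurable fun z : E 1 => inner ℝ θ z := by fun_prop
  have hms : Measurable fun r : ℝ => r • θ := by fun_prop
  have key : ∀ {m : Measure (E 1)}, HomogeneousOn α m → ∀ A, MeasurableSet A →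
      m A = (m.map fun z => inner ℝ θ z).restrict {0}ᶜ {r | r • θ ∈ A} := by
    intro m hmo A hA
    have hA' : MeasurableSet {r : ℝ | r • θ ∈ A} := hms hA
    rw [Measure.restrict_apply hA', Measure.map_apply hm
      (hA'.inter (measurableSet_singleton 0).compl)]
    refine measure_congr ?_
    filter_upwards [measure_eq_zero_iff_ae_notMem.1 hmo.zero] with z hz0
    refine propext ⟨fun hzA => ⟨?_, fun h0 => hz0 ?_⟩, fun hzA => ?_⟩
    · change inner ℝ θ z • θ ∈ A
      rw [hz]; exact hzA
    · have h0 : inner ℝ θ z = 0 := h0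
      change z = 0
      rw [← hz z, h0, zero_smul]
    · have : inner ℝ θ z • θ ∈ A := hzA.1
      rwa [hz] at this
  ext A hA
  rw [key h₁ A hA, key h₂ A hA, map_inner_restrict_compl h₁ h₂ h]

end Homogeneous

end HeavyTail

namespace HeavyTail

/-! ### The large deviation limit -/

section Regions

variable {Ω : Type*} [MeasurableSpace Ω] {P : Measure Ω} {d : ℕ} {X : ℤ → Ω → E d} {Λ : ℕ → Set ℝ}

theorem AdmissibleRegions.tendsto_selection (h : AdmissibleRegions P X Λ) {xs : ℕ → ℝ}
    (hxs : ∀ n, 1 ≤ n → xs n ∈ Λ n) : Tendsto xs atTop atTop := by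
  refine tendsto_atTop_mono' _ ?_ h.inf_tendsto
  filter_upwards [eventually_ge_atTop 1] with n hn
  exact csInf_le ⟨0, fun x hx => (h.pos n hn hx).le⟩ (hxs n hn)

theorem AdmissibleRegions.exists_selection (h : AdmissibleRegions P X Λ) :
    ∃ xs : ℕ → ℝ, ∀ n, 1 ≤ n → xs n ∈ Λ n := by
  choose f hf using h.nonempty
  exact ⟨fun n => if hn : 1 ≤ n then f n hn else 0, fun n hn => by simpa [hn] using hf n hn⟩

theorem IsLargeDeviationLimit.unique (h : AdmissibleRegions P X Λ) {α : ℝ}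
    {μ ν : Measure (PuncturedSpace d)} (hμ : IsLargeDeviationLimit P X Λ α μ)
    (hν : IsLargeDeviationLimit P X Λ α ν) : μ = ν := by
  obtain ⟨xs, hxs⟩ := h.exists_selection
  exact hμ.1.ext hν.1 fun f hf hc =>
    tendsto_nhds_unique (hμ.2 xs hxs f hf hc) (hν.2 xs hxs f hf hc)

theorem SymmetricSequence.map_neg_partialSum (h : SymmetricSequence P X)
    (hX : ∀ t, Measurable (X t)) (n : ℕ) :
    P.map (fun ω => -partialSum X n ω) = P.map (partialSum X n) := by
  set G : (ℤ → E d) → E d := fun x => ∑ i ∈ Finset.Icc (1 : ℤ) n, x i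
  have hG : Measurable G := by fun_prop
  have h1 : Measurable fun ω (t : ℤ) => -X t ω := by fun_prop
  have h2 : Measurable fun ω (t : ℤ) => X t ω := by fun_prop
  have e1 : (fun ω => -partialSum X n ω) = G ∘ fun ω (t : ℤ) => -X t ω := by
    ext1 ω
    simp only [G, partialSum, Function.comp_apply, Finset.sum_neg_distrib]
  have e2 : partialSum X n = G ∘ fun ω (t : ℤ) => X t ω := rfl
  rw [e1, e2, ← Measure.map_map hG h1, ← Measure.map_map hG h2, h]

end Regions

section HalfSpaces

variable {d : ℕ} {α : ℝ}

theorem HomogeneousOn.map_neg {m : Measure (E d)} (h : HomogeneousOn α m) :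
    HomogeneousOn α (m.map fun z => -z) where
  finite u hu := by
    rw [Measure.map_apply measurable_neg (measurableSet_lt measurable_const measurable_norm)]
    simpa only [Set.preimage_ofPred_eq, norm_neg] using h.finite u hu
  smul c hc A hA := by
    have hA' : MeasurableSet {z : E d | c • z ∈ A} := (measurable_const_smul c) hA
    rw [Measure.map_apply measurable_neg hA', Measure.map_apply measurable_neg hA,
      ← h.smul c hc _ (measurable_neg hA)]
    congr 1
    ext z
    simp only [Set.mem_preimage, Set.mem_ofPred_eq, smul_neg]
  zero := by
    rw [Measure.map_apply measurable_neg (measurableSet_singleton 0), ← h.zero]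
    congr 1
    ext z
    simp

theorem HomogeneousRadon.agreeOn_map_finitePart {μ ν : Measure (PuncturedSpace d)} (hα : 0 < α)
    (hμ : HomogeneousRadon α μ) (hν : HomogeneousRadon α ν) (h : AgreeOnHalfSpaces ν μ) :
    AgreeOn (ν.map finitePart) (μ.map finitePart) := by
  intro θ hθ
  have h' := h θ hθ
  rw [← (hμ.homogeneousOn hα).2, ← (hν.homogeneousOn hα).2, extendMeasure_apply,
    extendMeasure_apply, trace_halfSpace] at h'
  exact h'

theorem HomogeneousRadon.eq_of_map_finitePart_eq {μ ν : Measure (PuncturedSpace d)} (hα : 0 < α)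
    (hμ : HomogeneousRadon α μ) (hν : HomogeneousRadon α ν)
    (h : ν.map finitePart = μ.map finitePart) : ν = μ := by
  rw [← (hμ.homogeneousOn hα).2, ← (hν.homogeneousOn hα).2, h]

end HalfSpaces

namespace SpectralSetup

variable {Ω Ω' : Type*} [MeasurableSpace Ω] [MeasurableSpace Ω'] {P : Measure Ω} {P' : Measure Ω'}
  {d : ℕ} {X : ℤ → Ω → E d} {Θ : ℤ → Ω' → E d} {α : ℝ}
  [IsProbabilityMeasure P] [IsProbabilityMeasure P'] (S : SpectralSetup P P' X Θ α)
include S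

/-- Symmetry is read off from the prelimit: S_n and -S_n have the same law, so the cluster measure
and its reflection give the same integrals to all test functions. -/
theorem symmetricMeasure_extendMeasure_clusterMeasure {xs : ℕ → ℝ} (hlim : Tendsto xs atTop atTop)
    (hC : ClusterBound P X xs) (hV : SmallValueBound P X xs)
    (hmom : 1 < α → ∫⁻ ω, (∑' i : ℕ, ‖Θ (i + 1) ω‖ₑ) ^ (α - 1) ∂P' < ∞)
    (hsym : SymmetricSequence P X) :
    SymmetricMeasure (extendMeasure ((clusterMeasure P' Θ α).restrict {0}ᶜ)) := by
  have hm := S.homogeneousOn_clusterMeasure hlim hC hmom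
  set m := (clusterMeasure P' Θ α).restrict {0}ᶜ
  have key : extendMeasure m = extendMeasure (m.map fun z => -z) := by
    refine hm.homogeneousRadon.ext hm.map_neg.homogeneousRadon fun f hf hc => ?_
    obtain ⟨h1, ⟨B, hB⟩, u, hu, h0⟩ := readBack_properties hf hc
    have h1' : Continuous fun y => readBack f (-y) := h1.comp continuous_neg
    have e0 : ∀ z ∉ ({0}ᶜ : Set (E d)), z = 0 := fun z hz => by simpa using hz
    rw [integral_extendMeasure, integral_extendMeasure,
      integral_map measurable_neg.aemeasurable h1.aestronglyMeasurable,
      setIntegral_eq_integral_of_forall_compl_eq_zero fun z hz => by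
        rw [e0 z hz]; exact h0 0 (by simpa using hu.le),
      setIntegral_eq_integral_of_forall_compl_eq_zero fun z hz => by
        rw [e0 z hz, neg_zero]; exact h0 0 (by simpa using hu.le)]
    have t1 := S.tendsto_clusterMeasure hlim hC hV hmom h1 hB hu h0
    have t2 := S.tendsto_clusterMeasure hlim hC hV hmom h1' (fun y => hB (-y)) hu
      fun y hy => h0 (-y) (by rwa [norm_neg])
    refine tendsto_nhds_unique t1 (t2.congr fun n => ?_)
    congr 1
    have hS := S.measurable_partialSum n
    have hc' : Continuous fun y : E d => readBack f ((xs n)⁻¹ • y) :=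
      h1.comp (continuous_const_smul _)
    calc ∫ ω, readBack f (-((xs n)⁻¹ • partialSum X n ω)) ∂P
        = ∫ ω, readBack f ((xs n)⁻¹ • -partialSum X n ω) ∂P := by simp only [smul_neg]
      _ = ∫ y, readBack f ((xs n)⁻¹ • y) ∂P.map (fun ω => -partialSum X n ω) :=
        (integral_map (measurable_neg.comp hS).aemeasurable hc'.aestronglyMeasurable).symm
      _ = ∫ y, readBack f ((xs n)⁻¹ • y) ∂P.map (partialSum X n) := by
        rw [hsym.map_neg_partialSum S.measurable_X n]
      _ = ∫ ω, readBack f ((xs n)⁻¹ • partialSum X n ω) ∂P :=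
        integral_map hS.aemeasurable hc'.aestronglyMeasurable
  intro A hA
  conv_rhs => rw [key]
  rw [extendMeasure_apply, extendMeasure_apply, trace_dilate (by norm_num),
    Measure.map_apply measurable_neg (measurableSet_trace hA)]
  norm_num
  rfl

end SpectralSetup

end HeavyTail

theorem theorem4p7
    {Ω Ω' : Type*} [MeasurableSpace Ω] [MeasurableSpace Ω']
    (P : Measure Ω) [IsProbabilityMeasure P] (P' : Measure Ω') [IsProbabilityMeasure P']
    (d : ℕ) (hd : 1 ≤ d)
    (X : ℤ → Ω → E d) (hX : ∀ t, Measurable (X t))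
    (Θ : ℤ → Ω' → E d) (hΘ : ∀ t, Measurable (Θ t))
    (α : ℝ) (hα : 0 < α)
    (hstat : StrictlyStationary P X)
    (hRV : RegVarSequence P X α)
    (hspec : IsSpectralTailProcess P X P' Θ)
    (Λ : ℕ → Set ℝ) (hΛ : AdmissibleRegions P X Λ)
    (hAC : AntiClustering P X Λ)
    (hVSV : 1 ≤ α → VanishingSmallValues P X Λ)
    (hmom : 1 < α → ∫⁻ ω, (∑' i : ℕ, ‖Θ (i + 1) ω‖ₑ) ^ (α - 1) ∂P' < ∞) :
    -- the limit constant is well defined, and the uniform large deviation relation holds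
    (∀ᵐ ω ∂P', Summable fun i : ℕ => ‖Θ i ω‖) ∧
    (∀ θ : E d, ‖θ‖ = 1 →
      Integrable (clusterDiff Θ α θ) P' ∧
      Tendsto (fun n : ℕ => ⨆ x ∈ Λ n, ENNReal.ofReal
          |P.real {ω | x < inner ℝ θ (partialSum X n ω)} / ((n : ℝ) * P.real {ω | x < ‖X 0 ω‖})
            - ∫ ω, clusterDiff Θ α θ ω ∂P'|)
        atTop (𝓝 0)) ∧
    -- the limit measure
    ((α ∉ Set.range (Nat.cast : ℕ → ℝ) ∨ P.map (fun ω => -X 0 ω) = P.map (X 0)) →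
      (∃! μ : Measure (PuncturedSpace d), IsLargeDeviationLimit P X Λ α μ) ∧
      ∀ μ : Measure (PuncturedSpace d), IsLargeDeviationLimit P X Λ α μ →
        -- it is determined by its values on half-spaces
        ((α ∉ Set.range (Nat.cast : ℕ → ℝ) ∨ d = 1) →
          ∀ ν : Measure (PuncturedSpace d), HomogeneousRadon α ν →
            AgreeOnHalfSpaces ν μ → ν = μ) ∧
        ((∃ m : ℕ, α = 2 * m + 1) → SymmetricSequence P X →
          SymmetricMeasure μ ∧
          ∀ ν : Measure (PuncturedSpace d), HomogeneousRadon α ν → SymmetricMeasure ν →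
            AgreeOnHalfSpaces ν μ → ν = μ)) := by
  have S : SpectralSetup P P' X Θ α := ⟨hX, hΘ, hα, hstat, hRV, hspec⟩
  have hC : ∀ xs : ℕ → ℝ, (∀ n, 1 ≤ n → xs n ∈ Λ n) → ClusterBound P X xs := fun xs hxs =>
    S.clusterBound hAC hxs (hΛ.tendsto_selection hxs)
  have hV : ∀ xs : ℕ → ℝ, (∀ n, 1 ≤ n → xs n ∈ Λ n) → SmallValueBound P X xs := fun xs hxs => by
    rcases lt_or_ge α 1 with h | h
    · exact S.smallValueBound_of_lt_one h (hΛ.tendsto_selection hxs)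
    · exact S.smallValueBound (hVSV h) hxs (hΛ.tendsto_selection hxs)
  -- One selection suffices to establish the properties of ν and of the limit measure. Neither
  -- depends on it, so the same measure is the limit along every selection.
  obtain ⟨ys, hys⟩ := hΛ.exists_selection
  have hylim := hΛ.tendsto_selection hys
  have hlimit : IsLargeDeviationLimit P X Λ α
      (extendMeasure ((clusterMeasure P' Θ α).restrict {0}ᶜ)) :=
    ⟨(S.homogeneousOn_clusterMeasure hylim (hC ys hys) hmom).homogeneousRadon, fun xs hxs =>
      S.vagueTendsto_scaledLaw (hΛ.tendsto_selection hxs) (hC xs hxs) (hV xs hxs) hmom⟩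
  refine ⟨S.ae_summable_norm hylim (hC ys hys) hmom, fun θ hθ =>
    ⟨S.integrable_clusterDiff hylim (hC ys hys) hmom hθ, ?_⟩, fun _ =>
    ⟨⟨_, hlimit, fun ν hν => hν.unique hΛ hlimit⟩, fun μ hμ => ⟨fun hcase ν hν hag => ?_,
      fun hodd hsym => ?_⟩⟩⟩
  · refine tendsto_iSup_of_selections hΛ.nonempty
      (g := fun n x => P.real {ω | x < inner ℝ θ (partialSum X n ω)} /
        ((n : ℝ) * P.real {ω | x < ‖X 0 ω‖}) - ∫ ω, clusterDiff Θ α θ ω ∂P') fun xs hxs => ?_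
    have h := (S.tendsto_halfSpace (hΛ.tendsto_selection hxs) (hC xs hxs) (hV xs hxs) hmom
      hθ).sub_const (∫ ω, clusterDiff Θ α θ ω ∂P')
    rwa [sub_self] at h
  · refine hμ.1.eq_of_map_finitePart_eq hα hν ?_
    have hν' := (hν.homogeneousOn hα).1
    have hμ' := (hμ.1.homogeneousOn hα).1
    have h := hμ.1.agreeOn_map_finitePart hα hν hag
    rcases hcase with hαn | hd1
    · exact eq_of_agreeOn_of_notMem_natCast hα hαn hν' hμ' h
    · exact eq_of_agreeOn_of_dim_one hd1 hν' hμ' h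
  · have hμs : SymmetricMeasure μ := by
      rw [hμ.unique hΛ hlimit]
      exact S.symmetricMeasure_extendMeasure_clusterMeasure hylim (hC ys hys) (hV ys hys) hmom hsym
    refine ⟨hμs, fun ν hν hνs hag => hμ.1.eq_of_map_finitePart_eq hα hν ?_⟩
    obtain ⟨l, hl⟩ := hodd
    exact eq_of_agreeOn_of_symmetric hl (hν.homogeneousOn hα).1 (hμ.1.homogeneousOn hα).1
      (hμ.1.agreeOn_map_finitePart hα hν hag) (fun A hA => hνs.map_finitePart hA)
      (fun A hA => hμs.map_finitePart hA)
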